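/- Let $T>0$, let $(\Omega,\mathcal F,\mathbf P)$ be a complete probability space with a filtration $\mathbb F=\{\mathcal F_t,\ t\in[0,T]\}$ satisfying the usual conditions (right-continuous, and every $\mathcal F_t$ contains all $\mathbf P$-null sets); a process $X$ is called adapted if $X(t)$ is $\mathcal F_t$-measurable for every $t\in[0,T]$. Let $G=\{G(t),\ t\in[0,T]\}$ be an adapted continuous centered Gaussian process, let $H\in(1/2,1)$, and assume: (A) there exist $C_1,C_2>0$ such that $C_1|t-s|^{2H}\le \mathbf E|G(t)-G(s)|^2\le C_2|t-s|^{2H}$ for all $s,t\in[0,T]$; (B) $\mathbf E\big(G(t_1)-G(s_1)\big)\big(G(t_2)-G(s_2)\big)\ge 0$ for all $0\le s_1\le t_1\le s_2\le t_2\le T$. Let $r>0$ and let $\xi$ be a random variable such that there is an adapted process $Z$ whose paths on $[0,T]$ are almost surely $r$-Hölder continuous (with a random constant) and for which $Z(T)=\xi$ almost surely. Notation. For $\alpha\in(0,1)$ and $f,g:[0,T]\to\mathbb R$ put, for $x\in(0,T)$, $$(\mathcal D^{\alpha}_{0+}f)(x)=\frac1{\Gamma(1-\alpha)}\Big(\frac{f(x)}{x^\alpha}+\alpha\int_0^x\frac{f(x)-f(u)}{(x-u)^{1+\alpha}}\,du\Big),$$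 $$(\mathcal D^{\alpha}_{T-}g)(x)=\frac1{\Gamma(1-\alpha)}\Big(\frac{g(x)}{(T-x)^\alpha}+\alpha\int_x^T\frac{g(x)-g(u)}{(u-x)^{1+\alpha}}\,du\Big),$$ $$\|f\|_{\alpha,T}=\int_0^T\Big(\frac{|f(s)|}{s^\alpha}+\int_0^s\frac{|f(s)-f(z)|}{(s-z)^{1+\alpha}}\,dz\Big)ds .$$ With $g_{T-}(x)=g(x)-g(T)$, the generalized Lebesgue–Stieltjes integral $\int_0^T f\,dg$ (of order $\alpha$) exists if the integrals in $\mathcal D^{\alpha}_{0+}f$ and $\mathcal D^{1-\alpha}_{T-}g_{T-}$ converge absolutely at almost every $x\in(0,T)$, $\mathcal D^{\alpha}_{0+}f\in L_1[0,T]$ and $\mathcal D^{1-\alpha}_{T-}g_{T-}\in L_\infty[0,T]$; it is then defined by $$\int_0^T f\,dg=-\int_0^T(\mathcal D^{\alpha}_{0+}f)(x)\,(\mathcal D^{1-\alpha}_{T-}g_{T-})(x)\,dx .$$ Then there exist an adapted process $\psi=\{\psi(t),\ t\in[0,T]\}$, bounded by a non-random constant, and a number $\alpha\in(1-H,1)$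 such that, almost surely, the path of $\psi$ is Borel measurable, $\|\psi\|_{\alpha,T}<\infty$, the generalized Lebesgue–Stieltjes integral $\int_0^T\psi(s)\,dG(s)$ of order $\alpha$ exists, and $$\xi=\int_0^T\psi(s)\,dG(s).$$ -/

import Mathlib

open MeasureTheory ProbabilityTheory Set
open scoped ENNReal NNReal

namespace FractionalIntegral

/-- Left-sided Riemann-Liouville (Weyl form) fractional derivative of order `α` of `f` on the
interval `(a, b)`, extended by `0` outside `(a, b)`. -/
noncomputable def leftDeriv (α a b : ℝ) (f : ℝ → ℝ) : ℝ → ℝ :=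
  (Ioo a b).indicator fun x =>
    (1 / Real.Gamma (1 - α)) *
      (f x / (x - a) ^ α + α * ∫ u in a..x, (f x - f u) / (x - u) ^ (1 + α))

/-- Right-sided Riemann-Liouville (Weyl form) fractional derivative of order `α` of `g` on the
interval `(a, b)`, without a factor `(-1) ^ α`, extended by `0` outside `(a, b)`. -/
noncomputable def rightDeriv (α a b : ℝ) (g : ℝ → ℝ) : ℝ → ℝ :=
  (Ioo a b).indicator fun x =>
    (1 / Real.Gamma (1 - α)) *
      (g x / (b - x) ^ α + α * ∫ u in x..b, (g x - g u) / (u - x) ^ (1 + α))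

/-- The generalized Lebesgue-Stieltjes integral `∫_a^b f dg` of order `α` exists: the two
fractional derivatives are given by absolutely convergent integrals at almost every point, the left
derivative of order `α` of `f` is in `L¹`, and the right derivative of order `1 - α` of
`g - g b` is in `L^∞`. -/
structure GLSIntegrable (α a b : ℝ) (f g : ℝ → ℝ) : Prop where
  left_conv : ∀ᵐ x ∂(volume.restrict (Ioo a b)),
    IntegrableOn (fun u => (f x - f u) / (x - u) ^ (1 + α)) (Ioo a x)
  right_conv : ∀ᵐ x ∂(volume.restrict (Ioo a b)),
    IntegrableOn (fun u => (g x - g u) / (u - x) ^ (1 + (1 - α))) (Ioo x b)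
  left_mem : MemLp (leftDeriv α a b f) 1 (volume.restrict (Icc a b))
  right_mem : MemLp (rightDeriv (1 - α) a b fun x => g x - g b) ∞ (volume.restrict (Icc a b))

/-- The generalized Lebesgue-Stieltjes integral `∫_a^b f dg` of order `α`. The sign is the product
`(-1) ^ α * (-1) ^ (1 - α) = -1` of the two sign factors in the usual definition; with it,
`∫_a^b 1 dg = g b - g a`. Meaningful under `GLSIntegrable α a b f g`. -/
noncomputable def glsIntegral (α a b : ℝ) (f g : ℝ → ℝ) : ℝ :=
  -∫ x in a..b, leftDeriv α a b f x * rightDeriv (1 - α) a b (fun y => g y - g b) x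

/-- The norm `‖f‖_{α,[a,b]} = ∫_a^b (|f s| / (s-a)^α + ∫_a^s |f s - f z| / (s-z)^(1+α) dz) ds`,
with values in `[0, ∞]`. -/
noncomputable def fracNorm (α a b : ℝ) (f : ℝ → ℝ) : ℝ≥0∞ :=
  ∫⁻ s in Ioo a b, (ENNReal.ofReal (|f s| / (s - a) ^ α) +
    ∫⁻ z in Ioo a s, ENNReal.ofReal (|f s - f z| / (s - z) ^ (1 + α)))

end FractionalIntegral

/-! The integral is steered towards the moving target `Z`. Cut `[0, T)` into blocks, the `n`-th of
length `T * 2 ^ (-(n + 1))`, and cut block `n` into `N n` pieces of mesh `l`. On a piece `[s, t)`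
use the integrand `± sin ((G x - G s) / l ^ H)`. By the pathwise chain rule (`glsIntegral_sinBump`)
its integral is `±` the gain `l ^ H * (1 - cos ((G t - G s) / l ^ H))`. A gain is nonnegative and at
most `2 * l ^ H`, whatever the path does, so the sign, which is known at time `s`, decides the
direction of the move. Always moving towards the value of `Z` at the start of the block reduces the
error by the sum of the gains, until an overshoot of at most `2 * l ^ H`.

The gains are large enough in total. By (A) each `1 - cos` has mean bounded below. By (B) and the
product formula for cosines, the covariance of two cosines is at most that of the Gaussian
increments themselves (`covariance_cos_le`). The variance of the sum over a block is therefore at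
most that of one telescoped increment, of order `N ^ (2 * H)`, which is negligible against `N ^ 2`.
Chebyshev and Borel–Cantelli give a total gain of at least `κ * N * l ^ H` in all but finitely many
blocks, almost surely.

Two kinds of blocks reconcile convergence with a finite fractional norm. Even blocks have few enough
pieces for their norms to be summable, yet enough gain to cancel the Hölder increments of `Z` and a
small residual error. They cannot cancel the random error left by the early blocks. Odd blocks are
so fine that their gain tends to infinity, but their norm is not controlled; they act only if the
error exceeds a threshold. Once one odd block has wiped out the large error, every even block leaves
an error below the next threshold, so only finitely many odd blocks ever act
(`tendsto_tracking_error`).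

The analytic part works path by path with a Hölder integrator of order `β < H`, `1 - α < β`, `α <
β`. The integral is bounded by the fractional norm and is countably additive (`hasSum_glsIntegral`).
On indicators it gives increments, because fractional integration inverts the right derivative
(`integral_rightDeriv`). Freezing a sine bump on short intervals then yields the chain rule. -/

namespace FractionalIntegral

/-! ### Integrals of power kernels -/

lemma lintegral_Ioo_ofReal_eq {f : ℝ → ℝ} {a b : ℝ} (hab : a ≤ b)
    (hf : IntervalIntegrable f volume a b) (h0 : ∀ x ∈ Ioo a b, 0 ≤ f x) :
    ∫⁻ x in Ioo a b, ENNReal.ofReal (f x) = ENNReal.ofReal (∫ x in a..b, f x) := by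
  rw [intervalIntegral.integral_of_le hab, integral_Ioc_eq_integral_Ioo,
    ofReal_integral_eq_lintegral_ofReal]
  · exact ((intervalIntegrable_iff_integrableOn_Ioo_of_le hab).1 hf)
  · exact (ae_restrict_iff' measurableSet_Ioo).2 (ae_of_all _ h0)

lemma intervalIntegrable_sub_rpow {a b c p : ℝ} (hp : -1 < p) :
    IntervalIntegrable (fun x => (x - c) ^ p) volume a b := by
  have := (intervalIntegral.intervalIntegrable_rpow' (a := a - c) (b := b - c) hp).comp_sub_right c
  simpa using this

lemma intervalIntegrable_sub_rpow' {a b c p : ℝ} (hp : -1 < p) :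
    IntervalIntegrable (fun x => (c - x) ^ p) volume a b := by
  have := (intervalIntegral.intervalIntegrable_rpow' (a := c - a) (b := c - b) hp).comp_sub_left c
  simpa using this

lemma integral_sub_rpow {a b p : ℝ} (hp : -1 < p) :
    ∫ x in a..b, (x - a) ^ p = (b - a) ^ (p + 1) / (p + 1) := by
  rw [intervalIntegral.integral_comp_sub_right (fun x => x ^ p), integral_rpow (Or.inl hp), sub_self,
    Real.zero_rpow (by linarith), sub_zero]

lemma integral_sub_rpow' {a b p : ℝ} (hp : -1 < p) :
    ∫ x in a..b, (b - x) ^ p = (b - a) ^ (p + 1) / (p + 1) := by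
  rw [intervalIntegral.integral_comp_sub_left (fun x => x ^ p), integral_rpow (Or.inl hp), sub_self,
    Real.zero_rpow (by linarith), sub_zero]

lemma lintegral_sub_rpow {a b p : ℝ} (hab : a ≤ b) (hp : -1 < p) :
    ∫⁻ x in Ioo a b, ENNReal.ofReal ((x - a) ^ p) =
      ENNReal.ofReal ((b - a) ^ (p + 1) / (p + 1)) := by
  rw [lintegral_Ioo_ofReal_eq hab (intervalIntegrable_sub_rpow hp), integral_sub_rpow hp]
  exact fun x hx => Real.rpow_nonneg (by linarith [hx.1]) _

lemma lintegral_sub_rpow' {a b p : ℝ} (hab : a ≤ b) (hp : -1 < p) :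
    ∫⁻ x in Ioo a b, ENNReal.ofReal ((b - x) ^ p) =
      ENNReal.ofReal ((b - a) ^ (p + 1) / (p + 1)) := by
  rw [lintegral_Ioo_ofReal_eq hab (intervalIntegrable_sub_rpow' hp), integral_sub_rpow' hp]
  exact fun x hx => Real.rpow_nonneg (by linarith [hx.2]) _

lemma integral_sub_rpow_tail {a b c α : ℝ} (hα : 0 < α) (hab : a ≤ b) (hc : c < a) :
    IntervalIntegrable (fun x => (x - c) ^ (-1 - α)) volume a b ∧
    ∫ x in a..b, (x - c) ^ (-1 - α) = ((a - c) ^ (-α) - (b - c) ^ (-α)) / α := by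
  have h0 : (0 : ℝ) ∉ uIcc (a - c) (b - c) := by
    rw [uIcc_of_le (by linarith)]; intro h; linarith [h.1]
  constructor
  · have := (intervalIntegral.intervalIntegrable_rpow (μ := volume) (r := -1 - α)
      (Or.inr h0)).comp_sub_right c
    simpa using this
  · rw [intervalIntegral.integral_comp_sub_right (fun x => x ^ (-1 - α)),
      integral_rpow (Or.inr ⟨by linarith, h0⟩)]
    have : -1 - α + 1 = -α := by ring
    rw [this, div_neg, ← neg_div, neg_sub]

lemma integral_sub_rpow_tail' {a b c α : ℝ} (hα : 0 < α) (hab : a ≤ b) (hc : b < c) :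
    IntervalIntegrable (fun x => (c - x) ^ (-1 - α)) volume a b ∧
    ∫ x in a..b, (c - x) ^ (-1 - α) = ((c - b) ^ (-α) - (c - a) ^ (-α)) / α := by
  have h0 : (0 : ℝ) ∉ uIcc (c - b) (c - a) := by
    rw [uIcc_of_le (by linarith)]; intro h; linarith [h.1]
  constructor
  · have := (intervalIntegral.intervalIntegrable_rpow (μ := volume) (r := -1 - α)
      (Or.inr h0)).comp_sub_left c
    simpa using this.symm
  · rw [intervalIntegral.integral_comp_sub_left (fun x => x ^ (-1 - α)),
      integral_rpow (Or.inr ⟨by linarith, h0⟩)]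
    have : -1 - α + 1 = -α := by ring
    rw [this, div_neg, ← neg_div, neg_sub]

lemma lintegral_sub_rpow_tail_le {a b c α : ℝ} (hα : 0 < α) (hc : c < a) :
    ∫⁻ x in Ioo a b, ENNReal.ofReal ((x - c) ^ (-1 - α)) ≤
      ENNReal.ofReal ((a - c) ^ (-α) / α) := by
  rcases le_or_gt a b with hab | hab
  · obtain ⟨h1, h2⟩ := integral_sub_rpow_tail hα hab hc
    rw [lintegral_Ioo_ofReal_eq hab h1, h2]
    · gcongr
      linarith [Real.rpow_nonneg (show 0 ≤ b - c by linarith) (-α)]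
    · exact fun x hx => Real.rpow_nonneg (by linarith [hx.1]) _
  · simp [Ioo_eq_empty_of_le hab.le]

lemma lintegral_sub_rpow_tail_le' {a b c α : ℝ} (hα : 0 < α) (hc : b < c) :
    ∫⁻ x in Ioo a b, ENNReal.ofReal ((c - x) ^ (-1 - α)) ≤
      ENNReal.ofReal ((c - b) ^ (-α) / α) := by
  rcases le_or_gt a b with hab | hab
  · obtain ⟨h1, h2⟩ := integral_sub_rpow_tail' hα hab hc
    rw [lintegral_Ioo_ofReal_eq hab h1, h2]
    · gcongr
      linarith [Real.rpow_nonneg (show 0 ≤ c - a by linarith) (-α)]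
    · exact fun x hx => Real.rpow_nonneg (by linarith [hx.2]) _
  · simp [Ioo_eq_empty_of_le hab.le]

/-! ### Fractional norm of a Hölder function supported on an interval -/

/-- Interaction of an interval `[s, t)` with its past in the fractional norm. -/
lemma lintegral_past_le {α s t : ℝ} (hα : α ∈ Ioo (0 : ℝ) 1) (hst : s ≤ t) :
    ∫⁻ u in Ioo s t, ∫⁻ z in Ioo 0 s, ENNReal.ofReal ((u - z) ^ (-1 - α)) ≤
      ENNReal.ofReal ((t - s) ^ (1 - α) / (α * (1 - α))) := by
  -- The past of `u` contributes at most `α⁻¹ * (u - s) ^ (-α)`, which is integrable up to the jump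
  -- point because `α < 1`.
  calc _ ≤ ∫⁻ u in Ioo s t, ENNReal.ofReal (α⁻¹) * ENNReal.ofReal ((u - s) ^ (-α)) := by
        refine setLIntegral_mono' measurableSet_Ioo fun u hu => ?_
        refine (lintegral_sub_rpow_tail_le' hα.1 hu.1).trans_eq ?_
        rw [← ENNReal.ofReal_mul (by have := hα.1; positivity), div_eq_inv_mul]
    _ = _ := by
        rw [lintegral_const_mul' _ _ ENNReal.ofReal_ne_top, lintegral_sub_rpow hst (by linarith [hα.2]),
          ← ENNReal.ofReal_mul (by have := hα.1; positivity)]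
        congr 1
        rw [show -α + 1 = 1 - α by ring]
        field_simp

/-- Interaction of an interval `[s, t)` with its future in the fractional norm. -/
lemma lintegral_future_le {α s t T : ℝ} (hα : α ∈ Ioo (0 : ℝ) 1) (hst : s ≤ t) :
    ∫⁻ u in Ioo t T, ∫⁻ z in Ioo s t, ENNReal.ofReal ((u - z) ^ (-1 - α)) ≤
      ENNReal.ofReal ((t - s) ^ (1 - α) / (α * (1 - α))) := by
  rw [lintegral_lintegral_swap (by fun_prop)]
  calc _ ≤ ∫⁻ z in Ioo s t, ENNReal.ofReal (α⁻¹) * ENNReal.ofReal ((t - z) ^ (-α)) := by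
        refine setLIntegral_mono' measurableSet_Ioo fun u hu => ?_
        refine (lintegral_sub_rpow_tail_le hα.1 hu.2).trans_eq ?_
        rw [← ENNReal.ofReal_mul (by have := hα.1; positivity), div_eq_inv_mul]
    _ = _ := by
        rw [lintegral_const_mul' _ _ ENNReal.ofReal_ne_top, lintegral_sub_rpow' hst (by linarith [hα.2]),
          ← ENNReal.ofReal_mul (by have := hα.1; positivity)]
        congr 1
        rw [show -α + 1 = 1 - α by ring]
        field_simp

lemma lintegral_inner_le {p s t : ℝ} (hp : -1 < p) (hst : s ≤ t) :
    ∫⁻ u in Ioo s t, ∫⁻ z in Ioo s u, ENNReal.ofReal ((u - z) ^ p) ≤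
      ENNReal.ofReal ((t - s) ^ (p + 2) / (p + 1)) := by
  calc _ ≤ ∫⁻ u in Ioo s t, ENNReal.ofReal ((t - s) ^ (p + 1) / (p + 1)) := by
        refine setLIntegral_mono' measurableSet_Ioo fun u hu => ?_
        rw [lintegral_sub_rpow' hu.1.le hp]
        have : 0 < p + 1 := by linarith
        gcongr
        · linarith [hu.1]
        · exact hu.2.le
    _ = _ := by
        rw [lintegral_const, Measure.restrict_apply_univ, Real.volume_Ioo,
          ← ENNReal.ofReal_mul (by have : 0 ≤ t - s := by linarith
                                   have : 0 < p + 1 := by linarith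
                                   positivity)]
        congr 1
        rcases hst.eq_or_lt with rfl | h
        · simp [Real.zero_rpow (show p + 2 ≠ 0 by linarith)]
        have h2 : (t - s) ^ (p + 2) = (t - s) ^ (p + 1) * (t - s) := by
          rw [show p + 2 = p + 1 + 1 by ring, Real.rpow_add_one (by linarith)]
        rw [h2]
        ring

/-- A constant for which the fractional norm of a Hölder bump is controlled. -/
noncomputable def bumpConst (α β : ℝ) : ℝ :=
  -- In order: the weight `|f u| / u ^ α`, the possible jumps at the two ends of the support, and
  -- the Hölder oscillation inside it.
  1 / (1 - α) + 2 / (α * (1 - α)) + 1 / (β - α)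

lemma bumpConst_pos {α β : ℝ} (hα : α ∈ Ioo (0 : ℝ) 1) (hβ : α < β) : 0 < bumpConst α β := by
  have := hα.1
  have : 0 < 1 - α := by linarith [hα.2]
  have : 0 < β - α := by linarith
  unfold bumpConst
  positivity

/-- Fractional norm of a function supported on `[s, t)` and Hölder continuous there. -/
theorem fracNorm_bump_le {α β T s t M K : ℝ} {f : ℝ → ℝ} (hα : α ∈ Ioo (0 : ℝ) 1) (hβ : α < β)
    (hs : 0 ≤ s) (hst : s ≤ t) (hM : 0 ≤ M) (hK : 0 ≤ K)
    (hf0 : ∀ x, x ∉ Ico s t → f x = 0) (hfM : ∀ x ∈ Ico s t, |f x| ≤ M)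
    (hfK : ∀ x ∈ Ico s t, ∀ y ∈ Ico s t, |f x - f y| ≤ K * |x - y| ^ β) :
    fracNorm α 0 T f ≤
      ENNReal.ofReal (bumpConst α β * (M * (t - s) ^ (1 - α) + K * (t - s) ^ (1 + β - α))) := by
  have h1 : 0 < 1 - α := by linarith [hα.2]
  have h0 := hα.1
  have hba : 0 < β - α := by linarith
  have hts : 0 ≤ t - s := by linarith
  have hl1 : 0 ≤ (t - s) ^ (1 - α) := Real.rpow_nonneg hts _
  have hl2 : 0 ≤ (t - s) ^ (1 + β - α) := Real.rpow_nonneg hts _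
  set m := ENNReal.ofReal M
  set k := ENNReal.ofReal K
  -- pointwise bound of the double integrand
  have key : ∀ u ∈ Ioo 0 T, u ≠ s → u ≠ t →
      (ENNReal.ofReal (|f u| / (u - 0) ^ α) +
        ∫⁻ z in Ioo 0 u, ENNReal.ofReal (|f u - f z| / (u - z) ^ (1 + α))) ≤
      (Ioo s t).indicator (fun u => m * ENNReal.ofReal ((u - s) ^ (-α)) +
          m * ∫⁻ z in Ioo 0 s, ENNReal.ofReal ((u - z) ^ (-1 - α))) u +
        (Ioo s t).indicator (fun u => k * ∫⁻ z in Ioo s u, ENNReal.ofReal ((u - z) ^ (β - α - 1))) u +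
        (Ioo t T).indicator (fun u => m * ∫⁻ z in Ioo s t,
          ENNReal.ofReal ((u - z) ^ (-1 - α))) u := by
    intro u hu hus hut
    have hdiv : ∀ {A c z : ℝ}, z < u → 0 ≤ c → A ≤ c →
        ENNReal.ofReal (A / (u - z) ^ (1 + α)) ≤
          ENNReal.ofReal c * ENNReal.ofReal ((u - z) ^ (-1 - α)) := by
      intro A c z hz hc hA
      have hz' : 0 < u - z := by linarith
      rw [← ENNReal.ofReal_mul hc, show -1 - α = -(1 + α) by ring, Real.rpow_neg hz'.le,
        ← div_eq_mul_inv]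
      gcongr
    rcases lt_or_gt_of_ne hus with h | h
    · -- before the support
      have hfu : f u = 0 := hf0 u (fun hh => by linarith [hh.1])
      have : ∫⁻ z in Ioo 0 u, ENNReal.ofReal (|f u - f z| / (u - z) ^ (1 + α)) = 0 := by
        rw [setLIntegral_congr_fun measurableSet_Ioo (g := fun _ => 0)]
        · simp
        · intro z hz
          have : f z = 0 := hf0 z (fun hh => by linarith [hh.1, hz.2])
          simp [hfu, this]
      rw [this, hfu]; simp
    rcases lt_or_gt_of_ne hut with h' | h'
    · -- inside
      have hmem : u ∈ Ioo s t := ⟨h, h'⟩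
      have hmem' : u ∈ Ico s t := ⟨h.le, h'⟩
      have hnot : u ∉ Ioo t T := fun hh => by linarith [hh.1]
      rw [indicator_of_mem hmem, indicator_of_mem hmem, indicator_of_notMem hnot, add_zero, add_assoc]
      gcongr ?_ + ?_
      -- Since `0 ≤ s`, the weight `u ^ (-α)` is at most `(u - s) ^ (-α)`; the bound then depends
      -- only on `t - s`.
      · rw [sub_zero, ← ENNReal.ofReal_mul hM, Real.rpow_neg (by linarith), ← div_eq_mul_inv]
        have : 0 < u - s := by linarith
        have := hfM u hmem'
        gcongr
        linarith
      -- To the left of `s` the function vanishes and only its size matters; to the right of `s` the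
      -- Hölder bound tames the singularity.
      · have hsub : Ioo 0 u ⊆ Ioo 0 s ∪ Ioo s u ∪ {s} := by
          intro z hz
          rcases lt_trichotomy z s with hh | hh | hh
          · exact Or.inl (Or.inl ⟨hz.1, hh⟩)
          · exact Or.inr hh
          · exact Or.inl (Or.inr ⟨hh, hz.2⟩)
        refine (lintegral_mono_set hsub).trans ?_
        refine (lintegral_union_le _ _ _).trans ?_
        rw [setLIntegral_measure_zero {s} _ (by simp), add_zero]
        refine (lintegral_union_le _ _ _).trans ?_
        rw [← lintegral_const_mul' _ _ ENNReal.ofReal_ne_top,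
          ← lintegral_const_mul' _ _ ENNReal.ofReal_ne_top]
        refine add_le_add (setLIntegral_mono' measurableSet_Ioo fun z hz => ?_)
          (setLIntegral_mono' measurableSet_Ioo fun z hz => ?_)
        · have : f z = 0 := hf0 z (fun hh => by linarith [hh.1, hz.2])
          refine hdiv (by linarith [hz.2]) hM ?_
          rw [this, sub_zero]; exact hfM u hmem'
        · have hz' : 0 < u - z := by linarith [hz.2]
          have := hfK u hmem' z ⟨hz.1.le, hz.2.trans h'⟩
          rw [abs_of_pos hz'] at this
          rw [← ENNReal.ofReal_mul hK, show β - α - 1 = β - (1 + α) by ring, Real.rpow_sub hz',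
            ← mul_div_assoc]
          gcongr
    · -- after
      have hnot : u ∉ Ioo s t := fun hh => by linarith [hh.2]
      have hmem : u ∈ Ioo t T := ⟨h', hu.2⟩
      have hfu : f u = 0 := hf0 u (fun hh => by linarith [hh.2])
      rw [indicator_of_mem hmem, indicator_of_notMem hnot, indicator_of_notMem hnot, zero_add, zero_add,
        hfu, abs_zero, zero_div, ENNReal.ofReal_zero, zero_add,
        ← lintegral_const_mul' _ _ ENNReal.ofReal_ne_top, ← lintegral_indicator measurableSet_Ioo,
        ← lintegral_indicator measurableSet_Ioo]
      refine lintegral_mono_ae ?_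
      filter_upwards [compl_mem_ae_iff.2 (show volume {s} = 0 by simp)] with z hzs
      by_cases hz : z ∈ Ioo 0 u
      · rw [indicator_of_mem hz]
        by_cases hz2 : z ∈ Ioo s t
        · rw [indicator_of_mem hz2]
          refine hdiv hz.2 hM ?_
          rw [zero_sub, abs_neg]; exact hfM z ⟨hz2.1.le, hz2.2⟩
        · have : f z = 0 := hf0 z (fun hh => hz2 ⟨lt_of_le_of_ne hh.1 (Ne.symm hzs), hh.2⟩)
          simp [this]
      · rw [indicator_of_notMem hz]; exact bot_le
  unfold fracNorm
  calc _ ≤ ∫⁻ u in Ioo 0 T, ((Ioo s t).indicator (fun u => m * ENNReal.ofReal ((u - s) ^ (-α)) +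
          m * ∫⁻ z in Ioo 0 s, ENNReal.ofReal ((u - z) ^ (-1 - α))) u +
        (Ioo s t).indicator (fun u => k * ∫⁻ z in Ioo s u, ENNReal.ofReal ((u - z) ^ (β - α - 1))) u +
        (Ioo t T).indicator (fun u => m * ∫⁻ z in Ioo s t,
          ENNReal.ofReal ((u - z) ^ (-1 - α))) u) := by
        refine lintegral_mono_ae ?_
        filter_upwards [ae_restrict_mem measurableSet_Ioo,
          ae_restrict_of_ae (compl_mem_ae_iff.2 (show volume {s} = 0 by simp)),
          ae_restrict_of_ae (compl_mem_ae_iff.2 (show volume {t} = 0 by simp))] with u hu h1 h2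
        exact key u hu h1 h2
    _ ≤ ∫⁻ u, ((Ioo s t).indicator (fun u => m * ENNReal.ofReal ((u - s) ^ (-α)) +
          m * ∫⁻ z in Ioo 0 s, ENNReal.ofReal ((u - z) ^ (-1 - α))) u +
        (Ioo s t).indicator (fun u => k * ∫⁻ z in Ioo s u, ENNReal.ofReal ((u - z) ^ (β - α - 1))) u +
        (Ioo t T).indicator (fun u => m * ∫⁻ z in Ioo s t,
          ENNReal.ofReal ((u - z) ^ (-1 - α))) u) := setLIntegral_le_lintegral _ _
    _ ≤ m * ENNReal.ofReal ((t - s) ^ (1 - α) / (1 - α)) +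
        m * ENNReal.ofReal ((t - s) ^ (1 - α) / (α * (1 - α))) +
        k * ENNReal.ofReal ((t - s) ^ (1 + β - α) / (β - α)) +
        m * ENNReal.ofReal ((t - s) ^ (1 - α) / (α * (1 - α))) := by
        have hmeas : ∀ c d : ℝ, Measurable fun u : ℝ => ∫⁻ z in Ioo c d,
            ENNReal.ofReal ((u - z) ^ (-1 - α)) := fun c d =>
          Measurable.lintegral_prod_right' (f := fun p : ℝ × ℝ => ENNReal.ofReal ((p.1 - p.2) ^ (-1 - α)))
            (by fun_prop)
        rw [lintegral_add_right, add_comm (lintegral _ _), lintegral_add_left, ← add_comm]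
        · rw [lintegral_indicator measurableSet_Ioo, lintegral_indicator measurableSet_Ioo,
            lintegral_indicator measurableSet_Ioo, lintegral_add_left (by fun_prop),
            lintegral_const_mul' _ _ ENNReal.ofReal_ne_top,
            lintegral_const_mul' _ _ ENNReal.ofReal_ne_top,
            lintegral_const_mul' _ _ ENNReal.ofReal_ne_top,
            lintegral_const_mul' _ _ ENNReal.ofReal_ne_top]
          gcongr
          · rw [lintegral_sub_rpow hst (by linarith), show -α + 1 = 1 - α by ring]
          · exact lintegral_past_le hα hst
          · have := lintegral_inner_le (p := β - α - 1) (by linarith) hst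
            rwa [show β - α - 1 + 2 = 1 + β - α by ring, show β - α - 1 + 1 = β - α by ring] at this
          · exact lintegral_future_le hα hst
        · refine Measurable.indicator ?_ measurableSet_Ioo
          have := hmeas 0 s
          fun_prop
        · exact ((hmeas s t).const_mul _).indicator measurableSet_Ioo
    _ ≤ _ := by
        rw [← ENNReal.ofReal_mul hM, ← ENNReal.ofReal_mul hM, ← ENNReal.ofReal_mul hK,
          ← ENNReal.ofReal_add (by positivity) (by positivity),
          ← ENNReal.ofReal_add (by positivity) (by positivity),
          ← ENNReal.ofReal_add (by positivity) (by positivity)]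
        refine ENNReal.ofReal_le_ofReal ?_
        have e1 : M * ((t - s) ^ (1 - α) / (1 - α)) + M * ((t - s) ^ (1 - α) / (α * (1 - α))) +
            K * ((t - s) ^ (1 + β - α) / (β - α)) + M * ((t - s) ^ (1 - α) / (α * (1 - α))) =
            (1 / (1 - α) + 2 / (α * (1 - α))) * (M * (t - s) ^ (1 - α)) +
              1 / (β - α) * (K * (t - s) ^ (1 + β - α)) := by ring
        rw [e1]
        have p1 : 0 ≤ M * (t - s) ^ (1 - α) := by positivity
        have p2 : 0 ≤ K * (t - s) ^ (1 + β - α) := by positivity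
        have p3 : 0 ≤ 1 / (1 - α) + 2 / (α * (1 - α)) := by positivity
        have p4 : 0 ≤ 1 / (β - α) := by positivity
        unfold bumpConst
        nlinarith [mul_nonneg p3 p2, mul_nonneg p4 p1]

/-! ### Existence, bounds and countable additivity of the integral against a Hölder function -/

lemma continuous_of_holder {g : ℝ → ℝ} {K β : ℝ} (hβ : 0 < β)
    (hg : ∀ x y, |g x - g y| ≤ K * |x - y| ^ β) : Continuous g := by
  refine continuous_iff_continuousAt.2 fun y => tendsto_iff_dist_tendsto_zero.2 ?_
  refine squeeze_zero (fun _ => dist_nonneg) (fun x => hg x y) ?_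
  have : Continuous fun x : ℝ => K * |x - y| ^ β := by
    refine continuous_const.mul (Continuous.rpow_const (by fun_prop) fun _ => Or.inr hβ.le)
  simpa [Real.zero_rpow hβ.ne'] using this.tendsto y

/-- The density of the fractional norm. -/
noncomputable def fracDensity (α : ℝ) (f : ℝ → ℝ) (s : ℝ) : ℝ≥0∞ :=
  -- The `- 0` is kept so that integrating this function over `Ioo 0 T` is `fracNorm α 0 T f` by
  -- definition.
  ENNReal.ofReal (|f s| / (s - 0) ^ α) +
    ∫⁻ z in Ioo 0 s, ENNReal.ofReal (|f s - f z| / (s - z) ^ (1 + α))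

lemma measurable_fracDensity {α : ℝ} {f : ℝ → ℝ} (hf : Measurable f) :
    Measurable (fracDensity α f) := by
  refine Measurable.add (f := fun s => ENNReal.ofReal (|f s| / (s - 0) ^ α)) (by fun_prop) ?_
  -- The moving domain becomes the indicator of a triangle, so that measurability of parametric
  -- integrals applies.
  have h : ∀ s : ℝ, ∫⁻ z in Ioo 0 s, ENNReal.ofReal (|f s - f z| / (s - z) ^ (1 + α)) =
      ∫⁻ z, {p : ℝ × ℝ | 0 < p.2 ∧ p.2 < p.1}.indicator
        (fun p => ENNReal.ofReal (|f p.1 - f p.2| / (p.1 - p.2) ^ (1 + α))) (s, z) := by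
    intro s
    rw [← lintegral_indicator measurableSet_Ioo]
    rfl
  simp_rw [h]
  refine Measurable.lintegral_prod_right' ?_
  refine Measurable.indicator (by fun_prop) ?_
  exact (measurableSet_lt measurable_const measurable_snd).inter
    (measurableSet_lt measurable_snd measurable_fst)

lemma measurable_leftDeriv {α T : ℝ} {f : ℝ → ℝ} (hf : Measurable f) :
    Measurable (leftDeriv α 0 T f) := by
  have h : leftDeriv α 0 T f = (Ioo 0 T).indicator fun x =>
    (1 / Real.Gamma (1 - α)) * (f x / (x - 0) ^ α + α * ∫ u,
      {p : ℝ × ℝ | 0 < p.2 ∧ p.2 ≤ p.1}.indicator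
        (fun p => (f p.1 - f p.2) / (p.1 - p.2) ^ (1 + α)) (x, u)) := by
    refine indicator_congr fun x hx => ?_
    rw [intervalIntegral.integral_of_le hx.1.le, ← integral_indicator measurableSet_Ioc]
    rfl
  rw [h]
  refine Measurable.indicator ?_ measurableSet_Ioo
  have : Measurable fun x => ∫ u, {p : ℝ × ℝ | 0 < p.2 ∧ p.2 ≤ p.1}.indicator
        (fun p => (f p.1 - f p.2) / (p.1 - p.2) ^ (1 + α)) (x, u) := by
    refine (StronglyMeasurable.integral_prod_right' ?_).measurable
    refine Measurable.stronglyMeasurable ?_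
    refine Measurable.indicator (by fun_prop) ?_
    exact (measurableSet_lt measurable_const measurable_snd).inter
      (measurableSet_le measurable_snd measurable_fst)
  fun_prop

lemma measurable_rightDeriv {δ T : ℝ} {f : ℝ → ℝ} (hf : Measurable f) :
    Measurable (rightDeriv δ 0 T f) := by
  have h : rightDeriv δ 0 T f = (Ioo 0 T).indicator fun x =>
    (1 / Real.Gamma (1 - δ)) * (f x / (T - x) ^ δ + δ * ∫ u,
      {p : ℝ × ℝ | p.1 < p.2 ∧ p.2 ≤ T}.indicator
        (fun p => (f p.1 - f p.2) / (p.2 - p.1) ^ (1 + δ)) (x, u)) := by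
    refine indicator_congr fun x hx => ?_
    rw [intervalIntegral.integral_of_le hx.2.le, ← integral_indicator measurableSet_Ioc]
    rfl
  rw [h]
  refine Measurable.indicator ?_ measurableSet_Ioo
  have : Measurable fun x => ∫ u, {p : ℝ × ℝ | p.1 < p.2 ∧ p.2 ≤ T}.indicator
        (fun p => (f p.1 - f p.2) / (p.2 - p.1) ^ (1 + δ)) (x, u) := by
    refine (StronglyMeasurable.integral_prod_right' ?_).measurable
    refine Measurable.stronglyMeasurable ?_
    refine Measurable.indicator (by fun_prop) ?_
    exact (measurableSet_lt measurable_fst measurable_snd).inter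
      (measurableSet_le measurable_snd measurable_const)
  fun_prop

/-- The norm of the kernel of the left derivative is the inner integrand of the fractional norm.
Finiteness of the density at `x` is thus what makes the left derivative converge absolutely there.
-/
lemma integrableOn_leftKernel {α x : ℝ} {f : ℝ → ℝ} (hf : Measurable f)
    (hx : fracDensity α f x ≠ ∞) :
    ∫⁻ u in Ioo 0 x, ‖(f x - f u) / (x - u) ^ (1 + α)‖ₑ =
      ∫⁻ z in Ioo 0 x, ENNReal.ofReal (|f x - f z| / (x - z) ^ (1 + α)) ∧
    IntegrableOn (fun u => (f x - f u) / (x - u) ^ (1 + α)) (Ioo 0 x) := by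
  have h : ∫⁻ u in Ioo 0 x, ‖(f x - f u) / (x - u) ^ (1 + α)‖ₑ =
      ∫⁻ z in Ioo 0 x, ENNReal.ofReal (|f x - f z| / (x - z) ^ (1 + α)) := by
    refine setLIntegral_congr_fun measurableSet_Ioo fun z hz => ?_
    rw [← ofReal_norm, Real.norm_eq_abs, abs_div,
      abs_of_nonneg (Real.rpow_nonneg (by linarith [hz.2] : (0 : ℝ) ≤ x - z) _)]
  refine ⟨h, Measurable.aestronglyMeasurable (by fun_prop), ?_⟩
  rw [HasFiniteIntegral, h]
  exact lt_of_le_of_lt le_add_self hx.lt_top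

lemma enorm_leftDeriv_le {α T x : ℝ} {f : ℝ → ℝ} (hα : α ∈ Ioo (0 : ℝ) 1) (hf : Measurable f) :
    ‖leftDeriv α 0 T f x‖ₑ ≤
      ENNReal.ofReal (1 / Real.Gamma (1 - α)) * (Ioo 0 T).indicator (fracDensity α f) x := by
  have hG : 0 < Real.Gamma (1 - α) := Real.Gamma_pos_of_pos (by linarith [hα.2])
  by_cases hx : x ∈ Ioo 0 T
  swap; · simp [leftDeriv, hx]
  rw [leftDeriv, indicator_of_mem hx, indicator_of_mem hx, enorm_mul,
    Real.enorm_eq_ofReal (by positivity)]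
  gcongr
  by_cases hfin : fracDensity α f x = ∞
  · rw [hfin]; exact le_top
  rw [fracDensity, ← (integrableOn_leftKernel hf hfin).1]
  refine (enorm_add_le _ _).trans ?_
  gcongr
  · rw [← ofReal_norm, Real.norm_eq_abs, abs_div,
      abs_of_nonneg (Real.rpow_nonneg (by linarith [hx.1] : (0 : ℝ) ≤ x - 0) _)]
  · rw [enorm_mul, intervalIntegral.integral_of_le hx.1.le, integral_Ioc_eq_integral_Ioo]
    calc _ ≤ 1 * ‖∫ u in Ioo 0 x, (f x - f u) / (x - u) ^ (1 + α)‖ₑ := by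
          gcongr
          rw [Real.enorm_eq_ofReal hα.1.le]
          exact ENNReal.ofReal_le_one.2 hα.2.le
      _ ≤ _ := by rw [one_mul]; exact enorm_integral_le_lintegral_enorm _

lemma lintegral_enorm_leftDeriv_le {α T : ℝ} {f : ℝ → ℝ} (hα : α ∈ Ioo (0 : ℝ) 1)
    (hf : Measurable f) :
    ∫⁻ x, ‖leftDeriv α 0 T f x‖ₑ ≤
      ENNReal.ofReal (1 / Real.Gamma (1 - α)) * fracNorm α 0 T f := by
  calc _ ≤ ∫⁻ x, ENNReal.ofReal (1 / Real.Gamma (1 - α)) *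
        (Ioo 0 T).indicator (fracDensity α f) x := lintegral_mono fun x => enorm_leftDeriv_le hα hf
    _ = _ := by
      rw [lintegral_const_mul' _ _ ENNReal.ofReal_ne_top, lintegral_indicator measurableSet_Ioo]
      rfl

/-- Bound of the right derivative of order `δ` of a Hölder function, up to the Hölder constant. -/
noncomputable def rightConst (δ β T : ℝ) : ℝ :=
  (1 / Real.Gamma (1 - δ)) * (T ^ (β - δ) + δ * (T ^ (β - δ) / (β - δ)))

lemma rightConst_nonneg {δ β T : ℝ} (hδ : δ ∈ Ioo (0 : ℝ) 1) (hβ : δ < β) (hT : 0 ≤ T) :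
    0 ≤ rightConst δ β T := by
  have hG : 0 < Real.Gamma (1 - δ) := Real.Gamma_pos_of_pos (by linarith [hδ.2])
  have := hδ.1
  have : 0 < β - δ := by linarith
  unfold rightConst
  positivity

/-- Hölder continuity weakens the singularity from order `1 + δ` to `1 + δ - β`, which is integrable
as soon as `δ < β`. -/
lemma norm_rightKernel_le {δ β K x u : ℝ} {h : ℝ → ℝ} (hxu : x < u)
    (hg : |h x - h u| ≤ K * |x - u| ^ β) :
    ‖(h x - h u) / (u - x) ^ (1 + δ)‖ ≤ K * (u - x) ^ (β - 1 - δ) := by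
  have hxu' : 0 < u - x := by linarith
  rw [abs_sub_comm x u, abs_of_pos hxu'] at hg
  rw [Real.norm_eq_abs, abs_div, abs_of_pos (Real.rpow_pos_of_pos hxu' _),
    show β - 1 - δ = β - (1 + δ) by ring, Real.rpow_sub hxu', ← mul_div_assoc]
  gcongr

lemma intervalIntegrable_rightKernel {δ β T K x : ℝ} {h : ℝ → ℝ} (hβ : δ < β) (hxT : x ≤ T)
    (hm : Measurable h) (hg : ∀ u, |h x - h u| ≤ K * |x - u| ^ β) :
    IntervalIntegrable (fun u => (h x - h u) / (u - x) ^ (1 + δ)) volume x T := by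
  refine IntervalIntegrable.mono_fun'
    ((intervalIntegrable_sub_rpow (c := x) (p := β - 1 - δ) (by linarith)).const_mul K)
    (Measurable.aestronglyMeasurable (by fun_prop)) ?_
  rw [uIoc_of_le hxT]
  filter_upwards [ae_restrict_mem measurableSet_Ioc] with u hu
  exact norm_rightKernel_le hu.1 (hg u)

lemma abs_rightDeriv_le {δ β T K : ℝ} {h : ℝ → ℝ} (hδ : δ ∈ Ioo (0 : ℝ) 1) (hβ : δ < β)
    (hT : 0 ≤ T) (hK : 0 ≤ K) (hg : ∀ x y, |h x - h y| ≤ K * |x - y| ^ β) (hT0 : h T = 0) (x : ℝ) :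
    |rightDeriv δ 0 T h x| ≤ rightConst δ β T * K := by
  have hG : 0 < Real.Gamma (1 - δ) := Real.Gamma_pos_of_pos (by linarith [hδ.2])
  have h0 := hδ.1
  have hβδ : 0 < β - δ := by linarith
  by_cases hx : x ∈ Ioo 0 T
  swap
  · rw [rightDeriv, indicator_of_notMem hx, abs_zero]
    exact mul_nonneg (rightConst_nonneg hδ hβ hT) hK
  have hTx : 0 < T - x := by linarith [hx.2]
  have hmono : (T - x) ^ (β - δ) ≤ T ^ (β - δ) :=
    Real.rpow_le_rpow hTx.le (by linarith [hx.1]) hβδ.le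
  rw [rightDeriv, indicator_of_mem hx, abs_mul, abs_of_pos (by positivity), rightConst, mul_assoc]
  gcongr
  rw [add_mul]
  refine (abs_add_le _ _).trans (add_le_add ?_ ?_)
  · rw [abs_div, abs_of_pos (Real.rpow_pos_of_pos hTx _), div_le_iff₀ (Real.rpow_pos_of_pos hTx _)]
    have h1 := hg x T
    rw [hT0, sub_zero, abs_sub_comm, abs_of_pos hTx] at h1
    calc _ ≤ K * (T - x) ^ β := h1
      _ = (T - x) ^ (β - δ) * K * (T - x) ^ δ := by
        rw [show β = β - δ + δ by ring, Real.rpow_add hTx]; ring_nf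
      _ ≤ _ := by gcongr
  · rw [abs_mul, abs_of_pos h0, mul_assoc]
    gcongr
    have hint : IntervalIntegrable (fun u => K * (u - x) ^ (β - 1 - δ)) volume x T :=
      (intervalIntegrable_sub_rpow (by linarith)).const_mul K
    have := intervalIntegral.norm_integral_le_of_norm_le hx.2.le
      (g := fun u => K * (u - x) ^ (β - 1 - δ))
      (f := fun u => (h x - h u) / (u - x) ^ (1 + δ))
      (by filter_upwards with u hu; exact norm_rightKernel_le hu.1 (hg x u)) hint
    refine this.trans ?_
    rw [intervalIntegral.integral_const_mul, integral_sub_rpow (by linarith), mul_comm,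
      show β - 1 - δ + 1 = β - δ by ring]
    gcongr

section
variable {α β T K : ℝ} {f g : ℝ → ℝ}

lemma holder_sub_const (hg : ∀ x y, |g x - g y| ≤ K * |x - y| ^ β) (c : ℝ) :
    ∀ x y, |(g x - c) - (g y - c)| ≤ K * |x - y| ^ β := fun x y => by
  simpa using hg x y

lemma abs_rightDeriv_le' (hα : α ∈ Ioo (0 : ℝ) 1) (hβ : 1 - α < β) (hT : 0 ≤ T) (hK : 0 ≤ K)
    (hg : ∀ x y, |g x - g y| ≤ K * |x - y| ^ β) (x : ℝ) :
    |rightDeriv (1 - α) 0 T (fun y => g y - g T) x| ≤ rightConst (1 - α) β T * K :=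
  abs_rightDeriv_le ⟨by linarith [hα.2], by linarith [hα.1]⟩ hβ hT hK
    (holder_sub_const hg _) (by simp) x

/-- Existence of the generalized Lebesgue-Stieltjes integral against a Hölder function. -/
theorem glsIntegrable_of_fracNorm (hα : α ∈ Ioo (0 : ℝ) 1) (hβ : 1 - α < β) (hT : 0 ≤ T)
    (hK : 0 ≤ K) (hg : ∀ x y, |g x - g y| ≤ K * |x - y| ^ β) (hf : Measurable f)
    (hfin : fracNorm α 0 T f ≠ ∞) : GLSIntegrable α 0 T f g := by
  have hgm : Measurable g := (continuous_of_holder (by linarith [hα.2]) hg).measurable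
  refine ⟨?_, ?_, ?_, ?_⟩
  · have := ae_lt_top (μ := volume.restrict (Ioo 0 T)) (measurable_fracDensity (α := α) hf) hfin
    filter_upwards [this] with x hx
    exact (integrableOn_leftKernel hf hx.ne).2
  · filter_upwards [ae_restrict_mem measurableSet_Ioo] with x hx
    exact (intervalIntegrable_iff_integrableOn_Ioo_of_le hx.2.le).1
      (intervalIntegrable_rightKernel hβ hx.2.le hgm (hg x))
  · refine memLp_one_iff_integrable.2 ⟨(measurable_leftDeriv hf).aestronglyMeasurable, ?_⟩
    refine lt_of_le_of_lt ((setLIntegral_le_lintegral _ _).trans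
      (lintegral_enorm_leftDeriv_le hα hf)) ?_
    exact ENNReal.mul_lt_top ENNReal.ofReal_lt_top hfin.lt_top
  · exact memLp_top_of_bound (measurable_rightDeriv (by fun_prop)).aestronglyMeasurable _
      (ae_of_all _ fun x => abs_rightDeriv_le' hα hβ hT hK hg x)

lemma glsIntegral_eq (hT : 0 ≤ T) (f g : ℝ → ℝ) : glsIntegral α 0 T f g =
    -∫ x, leftDeriv α 0 T f x * rightDeriv (1 - α) 0 T (fun y => g y - g T) x := by
  rw [glsIntegral, intervalIntegral.integral_of_le hT, integral_Ioc_eq_integral_Ioo,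
    ← integral_indicator measurableSet_Ioo]
  congr 1
  refine integral_congr_ae (ae_of_all _ fun x => ?_)
  by_cases hx : x ∈ Ioo 0 T
  · simp [hx]
  · simp [hx, leftDeriv]

/-- Constant in the estimate of the generalized Lebesgue-Stieltjes integral. -/
noncomputable def glsConst (α β T : ℝ) : ℝ :=
  1 / Real.Gamma (1 - α) * rightConst (1 - α) β T

lemma glsConst_nonneg (hα : α ∈ Ioo (0 : ℝ) 1) (hβ : 1 - α < β) (hT : 0 ≤ T) :
    0 ≤ glsConst α β T := by
  have hG : 0 < Real.Gamma (1 - α) := Real.Gamma_pos_of_pos (by linarith [hα.2])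
  exact mul_nonneg (by positivity)
    (rightConst_nonneg ⟨by linarith [hα.2], by linarith [hα.1]⟩ hβ hT)

lemma lintegral_glsIntegrand_le (hα : α ∈ Ioo (0 : ℝ) 1) (hβ : 1 - α < β) (hT : 0 ≤ T)
    (hK : 0 ≤ K) (hg : ∀ x y, |g x - g y| ≤ K * |x - y| ^ β) (hf : Measurable f) :
    ∫⁻ x, ‖leftDeriv α 0 T f x * rightDeriv (1 - α) 0 T (fun y => g y - g T) x‖ₑ ≤
      ENNReal.ofReal (glsConst α β T * K) * fracNorm α 0 T f := by
  have hG : 0 < Real.Gamma (1 - α) := Real.Gamma_pos_of_pos (by linarith [hα.2])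
  have hR := rightConst_nonneg (δ := 1 - α) (T := T) (β := β)
    ⟨by linarith [hα.2], by linarith [hα.1]⟩ hβ hT
  calc _ ≤ ∫⁻ x, ‖leftDeriv α 0 T f x‖ₑ * ENNReal.ofReal (rightConst (1 - α) β T * K) := by
        refine lintegral_mono fun x => ?_
        rw [enorm_mul]
        gcongr
        rw [← ofReal_norm]
        exact ENNReal.ofReal_le_ofReal (abs_rightDeriv_le' hα hβ hT hK hg x)
    _ ≤ ENNReal.ofReal (1 / Real.Gamma (1 - α)) * fracNorm α 0 T f *
        ENNReal.ofReal (rightConst (1 - α) β T * K) := by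
        rw [lintegral_mul_const' _ _ ENNReal.ofReal_ne_top]
        gcongr
        exact lintegral_enorm_leftDeriv_le hα hf
    _ = _ := by
        rw [mul_right_comm, ← ENNReal.ofReal_mul (by positivity), glsConst, mul_assoc (1 / _)]

theorem abs_glsIntegral_le (hα : α ∈ Ioo (0 : ℝ) 1) (hβ : 1 - α < β) (hT : 0 ≤ T)
    (hK : 0 ≤ K) (hg : ∀ x y, |g x - g y| ≤ K * |x - y| ^ β) (hf : Measurable f) {c : ℝ}
    (hc : 0 ≤ c) (hfin : fracNorm α 0 T f ≤ ENNReal.ofReal c) :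
    |glsIntegral α 0 T f g| ≤ glsConst α β T * K * c := by
  have h0 := glsConst_nonneg hα hβ hT
  rw [glsIntegral_eq hT, abs_neg, ← Real.norm_eq_abs]
  refine (ENNReal.ofReal_le_ofReal_iff (by positivity)).1 ?_
  rw [ofReal_norm]
  refine (enorm_integral_le_lintegral_enorm _).trans
    ((lintegral_glsIntegrand_le hα hβ hT hK hg hf).trans ?_)
  rw [ENNReal.ofReal_mul (p := glsConst α β T * K) (by positivity)]
  exact mul_le_mul_right hfin _

/-- Termwise integration under absolute convergence, phrased with `lintegral` so that bounds by
fractional norms can be inserted directly. -/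
lemma hasSum_integral_of_tsum_lintegral {X ι : Type*} [MeasurableSpace X] {μ : Measure X}
    [Countable ι] {F : ι → X → ℝ} {f : X → ℝ} (hF : ∀ i, AEStronglyMeasurable (F i) μ)
    (hsum : ∀ᵐ x ∂μ, HasSum (fun i => F i x) (f x)) (hfin : ∑' i, ∫⁻ x, ‖F i x‖ₑ ∂μ ≠ ∞) :
    HasSum (fun i => ∫ x, F i x ∂μ) (∫ x, f x ∂μ) := by
  have h1 : ∀ i, ∫⁻ x, ‖F i x‖ₑ ∂μ ≠ ∞ := ENNReal.ne_top_of_tsum_ne_top hfin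
  have := hasSum_integral_of_summable_integral_norm (F := F) (μ := μ)
    (fun i => ⟨hF i, (h1 i).lt_top⟩) ?_
  · rwa [integral_congr_ae (hsum.mono fun x hx => hx.tsum_eq)] at this
  · simp_rw [integral_norm_eq_lintegral_enorm (hF _)]
    exact ENNReal.summable_toReal hfin

/-- The countable triangle inequality, applied to `f x` and to the differences `f x - f z`. -/
lemma fracDensity_tsum_le {ι : Type*} [Countable ι] {F : ι → ℝ → ℝ}
    (hF : ∀ i, Measurable (F i)) (hsum : ∀ x, HasSum (fun i => F i x) (f x)) {x : ℝ} (hx : 0 ≤ x) :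
    fracDensity α f x ≤ ∑' i, fracDensity α (F i) x := by
  have aux : ∀ {u : ι → ℝ} {v : ℝ} {w : ℝ}, 0 ≤ w → HasSum u v →
      ENNReal.ofReal (|v| / w) ≤ ∑' i, ENNReal.ofReal (|u i| / w) := by
    intro u v w hw huv
    have h : ∀ y : ℝ, ENNReal.ofReal (|y| / w) = ENNReal.ofReal |y| * ENNReal.ofReal (w⁻¹) := by
      intro y; rw [div_eq_mul_inv, ENNReal.ofReal_mul (abs_nonneg _)]
    simp_rw [h]
    rw [ENNReal.tsum_mul_right]
    gcongr
    have := enorm_tsum_le_tsum_enorm (f := u)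
    rw [huv.tsum_eq] at this
    simpa [← ofReal_norm] using this
  simp only [fracDensity]
  rw [ENNReal.tsum_add]
  refine add_le_add (aux (Real.rpow_nonneg (by linarith) _) (hsum x)) ?_
  rw [← lintegral_tsum (fun i => by have := hF i; fun_prop)]
  refine setLIntegral_mono' measurableSet_Ioo fun z hz => ?_
  exact aux (Real.rpow_nonneg (by linarith [hz.2]) _) ((hsum x).sub (hsum z))

theorem fracNorm_tsum_le {ι : Type*} [Countable ι] {F : ι → ℝ → ℝ}
    (hF : ∀ i, Measurable (F i)) (hsum : ∀ x, HasSum (fun i => F i x) (f x)) :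
    fracNorm α 0 T f ≤ ∑' i, fracNorm α 0 T (F i) := by
  calc fracNorm α 0 T f ≤ ∫⁻ x in Ioo 0 T, ∑' i, fracDensity α (F i) x :=
        setLIntegral_mono' measurableSet_Ioo fun x hx => fracDensity_tsum_le hF hsum hx.1.le
    _ = _ := lintegral_tsum fun i => (measurable_fracDensity (hF i)).aemeasurable

/-- Countable additivity of the generalized Lebesgue-Stieltjes integral in the integrand. -/
theorem hasSum_glsIntegral {ι : Type*} [Countable ι] {F : ι → ℝ → ℝ} (hα : α ∈ Ioo (0 : ℝ) 1)
    (hβ : 1 - α < β) (hT : 0 ≤ T) (hK : 0 ≤ K) (hg : ∀ x y, |g x - g y| ≤ K * |x - y| ^ β)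
    (hF : ∀ i, Measurable (F i)) (hsum : ∀ x, HasSum (fun i => F i x) (f x))
    (hfin : ∑' i, fracNorm α 0 T (F i) ≠ ∞) :
    HasSum (fun i => glsIntegral α 0 T (F i) g) (glsIntegral α 0 T f g) := by
  have hgm : Measurable g := (continuous_of_holder (by linarith [hα.2]) hg).measurable
  simp_rw [glsIntegral_eq hT]
  refine HasSum.neg (hasSum_integral_of_tsum_lintegral (fun i => ?_) ?_ ?_)
  · exact ((measurable_leftDeriv (hF i)).mul
      (measurable_rightDeriv (by fun_prop))).aestronglyMeasurable
  -- Sum and integral are exchanged twice. A finite sum of norms makes the sum of densities finite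
  -- at almost every `x`, which permits the exchange inside the left derivative at `x`.
  · have h1 : ∀ᵐ x ∂(volume.restrict (Ioo 0 T)), ∑' i, fracDensity α (F i) x < ∞ := by
      refine ae_lt_top (Measurable.tsum fun i => measurable_fracDensity (hF i)) ?_
      rw [lintegral_tsum fun i => (measurable_fracDensity (hF i)).aemeasurable]
      exact hfin
    rw [ae_restrict_iff' measurableSet_Ioo] at h1
    filter_upwards [h1] with x hx
    refine HasSum.mul_right _ ?_
    by_cases hxT : x ∈ Ioo 0 T
    swap; · simp [leftDeriv, hxT]
    simp only [leftDeriv, indicator_of_mem hxT]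
    refine HasSum.mul_left _ (((hsum x).div_const _).add (HasSum.mul_left _ ?_))
    simp_rw [intervalIntegral.integral_of_le hxT.1.le, integral_Ioc_eq_integral_Ioo]
    refine hasSum_integral_of_tsum_lintegral
      (fun i => by have := hF i; exact Measurable.aestronglyMeasurable (by fun_prop))
      (ae_of_all _ fun u => ((hsum x).sub (hsum u)).div_const _) (ne_top_of_le_ne_top (hx hxT).ne ?_)
    refine ENNReal.tsum_le_tsum fun i => ?_
    rw [(integrableOn_leftKernel (hF i) (ENNReal.ne_top_of_tsum_ne_top (hx hxT).ne i)).1]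
    exact le_add_self
  -- The outer exchange: each product of derivatives has `L¹` norm at most a constant times the
  -- fractional norm of its integrand.
  · refine ne_top_of_le_ne_top ?_ (ENNReal.tsum_le_tsum fun i =>
      lintegral_glsIntegrand_le hα hβ hT hK hg (hF i))
    rw [ENNReal.tsum_mul_left]
    exact ENNReal.mul_ne_top ENNReal.ofReal_ne_top hfin

lemma fracNorm_const_mul (c : ℝ) (f : ℝ → ℝ) :
    fracNorm α 0 T (fun x => c * f x) = ENNReal.ofReal |c| * fracNorm α 0 T f := by
  rw [fracNorm, fracNorm, ← lintegral_const_mul' _ _ ENNReal.ofReal_ne_top]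
  refine lintegral_congr fun x => ?_
  rw [mul_add, ← lintegral_const_mul' _ _ ENNReal.ofReal_ne_top]
  simp_rw [← ENNReal.ofReal_mul (abs_nonneg c), ← mul_sub, abs_mul, mul_div_assoc]

lemma glsIntegral_const_mul (c : ℝ) (f g : ℝ → ℝ) :
    glsIntegral α 0 T (fun x => c * f x) g = c * glsIntegral α 0 T f g := by
  have : leftDeriv α 0 T (fun x => c * f x) = fun x => c * leftDeriv α 0 T f x := by
    ext x
    by_cases hx : x ∈ Ioo 0 T
    · simp only [leftDeriv, indicator_of_mem hx, ← mul_sub, mul_div_assoc,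
        intervalIntegral.integral_const_mul]
      ring
    · simp [leftDeriv, hx]
  rw [glsIntegral, glsIntegral, this]
  simp only [mul_assoc, intervalIntegral.integral_const_mul]
  ring

lemma glsIntegral_add {f₁ f₂ : ℝ → ℝ} (hα : α ∈ Ioo (0 : ℝ) 1)
    (hβ : 1 - α < β) (hT : 0 ≤ T) (hK : 0 ≤ K) (hg : ∀ x y, |g x - g y| ≤ K * |x - y| ^ β)
    (h₁ : Measurable f₁) (h₂ : Measurable f₂) (hfin₁ : fracNorm α 0 T f₁ ≠ ∞)
    (hfin₂ : fracNorm α 0 T f₂ ≠ ∞) :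
    glsIntegral α 0 T (fun x => f₁ x + f₂ x) g =
      glsIntegral α 0 T f₁ g + glsIntegral α 0 T f₂ g := by
  have := hasSum_glsIntegral (ι := Bool) (F := fun b => bif b then f₁ else f₂)
    (f := fun x => f₁ x + f₂ x) hα hβ hT hK hg (by simp [h₁, h₂]) ?_ ?_
  · simpa using this.unique (hasSum_fintype _)
  · intro x
    simpa using hasSum_fintype fun b : Bool => (bif b then f₁ else f₂) x
  · simp [tsum_fintype, hfin₁, hfin₂]

end

/-! ### Inversion of the right fractional derivative and integrals of indicators -/

/-- After rescaling to the unit interval the powers of `b - a` cancel, as `-α + (α - 1) + 1 = 0`,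
and the normalization of the beta density gives the value. -/
lemma lintegral_beta {α a b : ℝ} (hα : α ∈ Ioo (0 : ℝ) 1) (hab : a < b) :
    ∫⁻ x in Ioo a b, ENNReal.ofReal ((x - a) ^ (-α) * (b - x) ^ (α - 1)) =
      ENNReal.ofReal (Real.Gamma (1 - α) * Real.Gamma α) := by
  have h1 : 0 < 1 - α := by linarith [hα.2]
  have hB : beta (1 - α) α = Real.Gamma (1 - α) * Real.Gamma α := by
    rw [beta]; simp
  have hBpos := beta_pos h1 hα.1
  have hd : 0 < b - a := by linarith
  have himg : Ioo a b = (fun y => a + (b - a) * y) '' Ioo 0 1 := by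
    ext x
    constructor
    · intro hx
      refine ⟨(x - a) / (b - a), ⟨by have := hx.1; apply div_pos <;> linarith,
        (div_lt_one hd).2 (by linarith [hx.2])⟩, ?_⟩
      simp only
      field_simp
      ring
    · rintro ⟨y, hy, rfl⟩
      constructor <;> simp only <;> nlinarith [hy.1, hy.2]
  rw [himg, lintegral_image_eq_lintegral_abs_deriv_mul measurableSet_Ioo
    (f' := fun _ => b - a) (fun y _ => ?_) ?_]
  · have h2 := lintegral_betaPDF_eq_one h1 hα.1
    rw [lintegral_betaPDF] at h2
    rw [← hB, ← mul_one (ENNReal.ofReal (beta (1 - α) α)), ← h2,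
      ← lintegral_const_mul' _ _ ENNReal.ofReal_ne_top]
    refine setLIntegral_congr_fun measurableSet_Ioo fun y hy => ?_
    have hy1 : 0 < 1 - y := by linarith [hy.2]
    rw [← ENNReal.ofReal_mul (abs_nonneg _), ← ENNReal.ofReal_mul hBpos.le, abs_of_pos hd]
    congr 1
    rw [show a + (b - a) * y - a = (b - a) * y by ring,
      show b - (a + (b - a) * y) = (b - a) * (1 - y) by ring,
      Real.mul_rpow hd.le hy.1.le, Real.mul_rpow hd.le hy1.le, Real.rpow_sub hd, Real.rpow_one,
      Real.rpow_neg hd.le, show 1 - α - 1 = -α by ring]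
    have := Real.rpow_pos_of_pos hd α
    field_simp
  · intro x _ y _ hxy
    simpa [hd.ne'] using hxy
  · have : HasDerivAt (fun y : ℝ => a + (b - a) * y) ((b - a) * 1) y :=
      ((hasDerivAt_id y).const_mul (b - a)).const_add a
    simpa using this.hasDerivWithinAt

lemma integral_beta {α a b : ℝ} (hα : α ∈ Ioo (0 : ℝ) 1) (hab : a < b) :
    ∫ x in Ioo a b, (x - a) ^ (-α) * (b - x) ^ (α - 1) =
      Real.Gamma (1 - α) * Real.Gamma α := by
  have h1 : 0 < 1 - α := by linarith [hα.2]
  have := Real.Gamma_pos_of_pos h1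
  have := Real.Gamma_pos_of_pos hα.1
  rw [integral_eq_lintegral_of_nonneg_ae, lintegral_beta hα hab, ENNReal.toReal_ofReal (by positivity)]
  · filter_upwards [ae_restrict_mem measurableSet_Ioo] with x hx
    exact mul_nonneg (Real.rpow_nonneg (by linarith [hx.1]) _)
      (Real.rpow_nonneg (by linarith [hx.2]) _)
  · exact Measurable.aestronglyMeasurable (by fun_prop)

/-- Composition of fractional integrals, for a bounded measurable function. -/
lemma integral_frac_swap {α t T M : ℝ} {k : ℝ → ℝ} (hα : α ∈ Ioo (0 : ℝ) 1)
    (hk : Measurable k) (hM : ∀ u ∈ Ioo t T, |k u| ≤ M) :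
    ∫ x in Ioo t T, (x - t) ^ (-α) * ∫ u in Ioo x T, (u - x) ^ (α - 1) * k u =
      Real.Gamma (1 - α) * Real.Gamma α * ∫ u in Ioo t T, k u := by
  -- Fubini on the triangle `t < x < u < T`: for fixed `u` the integral in `x` is the beta integral,
  -- whose value does not depend on `u`.
  set S : Set (ℝ × ℝ) := {p | t < p.1 ∧ p.1 < p.2 ∧ p.2 < T} with hS
  have hSm : MeasurableSet S := (measurableSet_lt measurable_const measurable_fst).inter
    ((measurableSet_lt measurable_fst measurable_snd).inter
      (measurableSet_lt measurable_snd measurable_const))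
  set F : ℝ × ℝ → ℝ := S.indicator fun p => (p.1 - t) ^ (-α) * (p.2 - p.1) ^ (α - 1) * k p.2 with hF
  have hFm : Measurable F := Measurable.indicator (by fun_prop) hSm
  have e1 : ∀ x, ∫ u, F (x, u) = (Ioo t T).indicator
      (fun x => (x - t) ^ (-α) * ∫ u in Ioo x T, (u - x) ^ (α - 1) * k u) x := by
    intro x
    by_cases hx : x ∈ Ioo t T
    · rw [indicator_of_mem hx, ← integral_const_mul, ← integral_indicator measurableSet_Ioo]
      congr 1; ext u
      by_cases hu : u ∈ Ioo x T
      · rw [indicator_of_mem hu, hF, indicator_of_mem (show (x, u) ∈ S from ⟨hx.1, hu.1, hu.2⟩)]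
        ring
      · rw [indicator_of_notMem hu, hF, indicator_of_notMem (fun h => hu ⟨h.2.1, h.2.2⟩)]
    · rw [indicator_of_notMem hx]
      convert integral_zero ℝ ℝ using 2
      ext u
      rw [hF, indicator_of_notMem (fun h => hx ⟨h.1, h.2.1.trans h.2.2⟩)]
  have e2 : ∀ u, ∫ x, F (x, u) = (Ioo t T).indicator
      (fun u => Real.Gamma (1 - α) * Real.Gamma α * k u) u := by
    intro u
    by_cases hu : u ∈ Ioo t T
    · rw [indicator_of_mem hu, ← integral_beta hα hu.1, ← integral_mul_const,
        ← integral_indicator measurableSet_Ioo]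
      congr 1; ext x
      by_cases hx : x ∈ Ioo t u
      · rw [indicator_of_mem hx, hF, indicator_of_mem (show (x, u) ∈ S from ⟨hx.1, hx.2, hu.2⟩)]
      · rw [indicator_of_notMem hx, hF, indicator_of_notMem (fun h => hx ⟨h.1, h.2.1⟩)]
    · rw [indicator_of_notMem hu]
      convert integral_zero ℝ ℝ using 2
      ext x
      rw [hF, indicator_of_notMem (fun h => hu ⟨h.1.trans h.2.1, h.2.2⟩)]
  have hint : Integrable F (volume.prod volume) := by
    refine ⟨hFm.aestronglyMeasurable, ?_⟩
    rw [HasFiniteIntegral, lintegral_prod_symm _ (by fun_prop)]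
    have hb : ∀ u, ∫⁻ x, ‖F (x, u)‖ₑ ≤ (Ioo t T).indicator
        (fun _ => ENNReal.ofReal (Real.Gamma (1 - α) * Real.Gamma α) * ENNReal.ofReal M) u := by
      intro u
      by_cases hu : u ∈ Ioo t T
      · rw [indicator_of_mem hu, ← lintegral_beta hα hu.1, ← lintegral_mul_const' _ _
          ENNReal.ofReal_ne_top, ← lintegral_indicator measurableSet_Ioo]
        refine lintegral_mono fun x => ?_
        by_cases hx : x ∈ Ioo t u
        · rw [indicator_of_mem hx, hF, indicator_of_mem (show (x, u) ∈ S from ⟨hx.1, hx.2, hu.2⟩),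
            enorm_mul, Real.enorm_eq_ofReal (mul_nonneg (Real.rpow_nonneg (by linarith [hx.1]) _)
              (Real.rpow_nonneg (by linarith [hx.2]) _))]
          gcongr
          rw [← ofReal_norm]
          exact ENNReal.ofReal_le_ofReal (hM u hu)
        · rw [indicator_of_notMem hx, hF, indicator_of_notMem (fun h => hx ⟨h.1, h.2.1⟩)]
          simp
      · rw [indicator_of_notMem hu, hF]
        simp only [nonpos_iff_eq_zero]
        convert lintegral_zero (μ := (volume : Measure ℝ)) using 2
        ext x
        rw [indicator_of_notMem (fun h => hu ⟨h.1.trans h.2.1, h.2.2⟩)]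
        simp
    refine lt_of_le_of_lt (lintegral_mono hb) ?_
    rw [lintegral_indicator measurableSet_Ioo, lintegral_const]
    refine ENNReal.mul_lt_top (ENNReal.mul_lt_top ENNReal.ofReal_lt_top ENNReal.ofReal_lt_top) ?_
    simp
  have := integral_integral_swap (f := fun x u => F (x, u)) hint
  simp_rw [e1, e2] at this
  rwa [integral_indicator measurableSet_Ioo, integral_indicator measurableSet_Ioo,
    integral_const_mul] at this

/-- The right fractional derivative of a `C¹` function vanishing at the right end. -/
lemma rightDeriv_of_hasDerivAt {α T x K : ℝ} {h h' : ℝ → ℝ} (hα : α ∈ Ioo (0 : ℝ) 1)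
    (hx : x ∈ Ioo 0 T) (hd : ∀ y, HasDerivAt h (h' y) y) (hc : Continuous h')
    (hL : ∀ u ∈ Icc x T, |h x - h u| ≤ K * (u - x)) (hT : h T = 0) :
    rightDeriv (1 - α) 0 T h x =
      -(1 / Real.Gamma α) * ∫ u in Ioo x T, (u - x) ^ (α - 1) * h' u := by
  have hcont : Continuous h := continuous_iff_continuousAt.2 fun y => (hd y).continuousAt
  have hK : IntervalIntegrable (fun u => (h x - h u) / (u - x) ^ (1 + (1 - α))) volume x T := by
    refine IntervalIntegrable.mono_fun'
      ((intervalIntegrable_sub_rpow (c := x) (p := α - 1) (by linarith [hα.1])).const_mul K)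
      (Measurable.aestronglyMeasurable (by have := hcont.measurable; fun_prop)) ?_
    rw [uIoc_of_le hx.2.le]
    filter_upwards [ae_restrict_mem measurableSet_Ioc] with u hu
    have hu' : 0 < u - x := by linarith [hu.1]
    have := norm_rightKernel_le (δ := 1 - α) (β := 1) (K := K) (h := h) hu.1 (by
      rw [Real.rpow_one, abs_sub_comm x u, abs_of_pos hu']
      exact hL u ⟨hu.1.le, hu.2⟩)
    rwa [show (1 : ℝ) - 1 - (1 - α) = α - 1 by ring] at this
  have hI : IntervalIntegrable (fun u => (u - x) ^ (α - 1) * h' u) volume x T :=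
    (intervalIntegrable_sub_rpow (by linarith [hα.1])).mul_continuousOn hc.continuousOn
  -- Integration by parts in the Weyl form: the singular kernel is the derivative of a power of `u -
  -- x`. The Lipschitz bound kills the boundary term at `x`, and the one at `T` is the first summand
  -- of the right derivative.
  have hftc := intervalIntegral.integral_eq_sub_of_hasDerivAt_of_le hx.2.le
    (f := fun u => (h x - h u) * (u - x) ^ (α - 1))
    (f' := fun u => -((u - x) ^ (α - 1) * h' u) -
      (1 - α) * ((h x - h u) / (u - x) ^ (1 + (1 - α)))) ?_ ?_ ?_
  · rw [intervalIntegral.integral_sub (f := fun u => -((u - x) ^ (α - 1) * h' u)) hI.neg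
      (hK.const_mul _), intervalIntegral.integral_neg,
      intervalIntegral.integral_const_mul, hT] at hftc
    simp only [sub_self, zero_mul, sub_zero] at hftc
    rw [rightDeriv, indicator_of_mem hx, show 1 - (1 - α) = α by ring]
    rw [← integral_Ioc_eq_integral_Ioo, ← intervalIntegral.integral_of_le hx.2.le, neg_mul,
      ← mul_neg]
    congr 1
    have : h x / (T - x) ^ (1 - α) = h x * (T - x) ^ (α - 1) := by
      rw [show α - 1 = -(1 - α) by ring, Real.rpow_neg (by linarith [hx.2]), div_eq_mul_inv]
    rw [this, ← hftc]
    ring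
  · intro u hu
    rcases hu.1.eq_or_lt with rfl | hxu
    -- At the singular end the product is dominated by `K * (u - x) ^ α`, which tends to `0`.
    · have h0 : Filter.Tendsto (fun u => K * (u - x) ^ α) (nhdsWithin x (Icc x T)) (nhds 0) := by
        have hco : Continuous fun u : ℝ => K * (u - x) ^ α :=
          continuous_const.mul (Continuous.rpow_const (by fun_prop) fun _ => Or.inr hα.1.le)
        have := hco.tendsto x
        simp only [sub_self, Real.zero_rpow hα.1.ne', mul_zero] at this
        exact this.mono_left nhdsWithin_le_nhds
      rw [ContinuousWithinAt, sub_self, zero_mul]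
      refine squeeze_zero_norm' ?_ h0
      filter_upwards [self_mem_nhdsWithin] with u hu
      rcases hu.1.eq_or_lt with rfl | hxu
      · simp [Real.zero_rpow hα.1.ne']
      have hu' : 0 < u - x := by linarith
      rw [Real.norm_eq_abs, abs_mul, abs_of_pos (Real.rpow_pos_of_pos hu' _),
        Real.rpow_sub_one hu'.ne']
      calc _ ≤ K * (u - x) * ((u - x) ^ α / (u - x)) := by gcongr; exact hL u hu
        _ = _ := by field_simp
    · refine ContinuousAt.continuousWithinAt ?_
      refine ContinuousAt.mul (by fun_prop) ?_
      exact ContinuousAt.rpow_const (by fun_prop) (Or.inl (by linarith))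
  · intro u hu
    have hu' : 0 < u - x := by linarith [hu.1]
    have h1 := ((hd u).const_sub (h x)).mul
      (((hasDerivAt_id u).sub_const x).rpow_const (p := α - 1) (Or.inl hu'.ne'))
    refine HasDerivAt.congr_deriv h1 ?_
    simp only [id]
    rw [show α - 1 - 1 = -(1 + (1 - α)) by ring, Real.rpow_neg hu'.le]
    ring
  · exact hI.neg.sub (hK.const_mul _)

/-- Smooth approximation of a Hölder function by moving averages, with the same Hölder constant. -/
lemma exists_smooth_approx {β K T : ℝ} {h : ℝ → ℝ} (hβ : 0 < β) (hK : 0 ≤ K)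
    (hg : ∀ x y, |h x - h y| ≤ K * |x - y| ^ β) (hT : h T = 0) :
    ∃ φ φ' : ℕ → ℝ → ℝ, (∀ n y, HasDerivAt (φ n) (φ' n y) y) ∧ (∀ n, Continuous (φ' n)) ∧
      (∀ n x y, |φ n x - φ n y| ≤ K * |x - y| ^ β) ∧ (∀ n, φ n T = 0) ∧
      ∀ x, Filter.Tendsto (fun n => φ n x) Filter.atTop (nhds (h x)) := by
  have hc : Continuous h := continuous_of_holder hβ hg
  have hshift : ∀ x, Continuous fun v => h (x + v) := fun x => by fun_prop
  set ε : ℕ → ℝ := fun n => 1 / ((n : ℝ) + 1) with hε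
  have hε0 : ∀ n, 0 < ε n := fun n => by positivity
  set A : ℕ → ℝ → ℝ := fun n x => (ε n)⁻¹ * ∫ v in (0 : ℝ)..ε n, h (x + v) with hA
  have hAd : ∀ n y, HasDerivAt (A n) ((ε n)⁻¹ * (h (y + ε n) - h y)) y := by
    intro n y
    have e : A n = fun x => (ε n)⁻¹ * ((∫ u in (0 : ℝ)..(x + ε n), h u) - ∫ u in (0 : ℝ)..x, h u) := by
      ext x
      simp only [hA]
      rw [intervalIntegral.integral_comp_add_left, add_zero,
        intervalIntegral.integral_interval_sub_left (hc.intervalIntegrable _ _)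
          (hc.intervalIntegrable _ _)]
    rw [e]
    refine HasDerivAt.const_mul _ (HasDerivAt.sub ?_ ?_)
    · have := (hc.integral_hasStrictDerivAt 0 (y + ε n)).hasDerivAt
      exact this.comp_add_const y (ε n)
    · exact (hc.integral_hasStrictDerivAt 0 y).hasDerivAt
  have hmean : ∀ n (k : ℝ → ℝ) (c : ℝ), Continuous k → (∀ v ∈ Icc 0 (ε n), |k v| ≤ c) →
      |(ε n)⁻¹ * ∫ v in (0 : ℝ)..ε n, k v| ≤ c := by
    intro n k c hk hkc
    have := intervalIntegral.norm_integral_le_of_norm_le_const (a := 0) (b := ε n) (f := k) (C := c)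
      (fun v hv => by
        rw [uIoc_of_le (hε0 n).le] at hv
        exact hkc v ⟨hv.1.le, hv.2⟩)
    rw [abs_mul, abs_of_pos (inv_pos.2 (hε0 n)), inv_mul_le_iff₀ (hε0 n)]
    rwa [sub_zero, abs_of_pos (hε0 n), mul_comm, Real.norm_eq_abs] at this
  have hAlim : ∀ x, Filter.Tendsto (fun n => A n x) Filter.atTop (nhds (h x)) := by
    intro x
    refine tendsto_iff_dist_tendsto_zero.2 (squeeze_zero (fun _ => dist_nonneg)
      (g := fun n => K * ε n ^ β) (fun n => ?_) ?_)
    · have : A n x - h x = (ε n)⁻¹ * ∫ v in (0 : ℝ)..ε n, (h (x + v) - h x) := by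
        rw [intervalIntegral.integral_sub ((hshift x).intervalIntegrable _ _)
          (by simp), intervalIntegral.integral_const, sub_zero, smul_eq_mul, mul_sub,
          inv_mul_cancel_left₀ (hε0 n).ne']
      rw [Real.dist_eq, this]
      refine hmean n _ _ (by fun_prop) fun v hv => (hg _ _).trans ?_
      rw [add_sub_cancel_left, abs_of_nonneg hv.1]
      have := hv.1
      gcongr
      exact hv.2
    · have h1 : Filter.Tendsto ε Filter.atTop (nhds 0) := tendsto_one_div_add_atTop_nhds_zero_nat
      have h2 := (h1.rpow_const (p := β) (Or.inr hβ.le)).const_mul K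
      simpa [Real.zero_rpow hβ.ne'] using h2
  -- Averaging translates keeps the Hölder constant; subtracting `A n T` restores the zero at `T`.
  refine ⟨fun n x => A n x - A n T, fun n y => (ε n)⁻¹ * (h (y + ε n) - h y), ?_, ?_, ?_, ?_, ?_⟩
  · exact fun n y => (hAd n y).sub_const _
  · intro n; fun_prop
  · intro n x y
    have : A n x - A n T - (A n y - A n T) =
        (ε n)⁻¹ * ∫ v in (0 : ℝ)..ε n, (h (x + v) - h (y + v)) := by
      rw [intervalIntegral.integral_sub ((hshift x).intervalIntegrable _ _)
          ((hshift y).intervalIntegrable _ _)]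
      simp only [hA]; ring
    simp only [this]
    refine hmean n _ _ (by fun_prop) fun v _ => (hg _ _).trans_eq ?_
    rw [add_sub_add_right_eq_sub]
  · intro n; simp
  · intro x
    simpa [hT] using (hAlim x).sub (hAlim T)

/-- The fractional integral inverts the right fractional derivative on Hölder functions. -/
theorem integral_rightDeriv {α β K t T : ℝ} {h : ℝ → ℝ} (hα : α ∈ Ioo (0 : ℝ) 1)
    (hβ : 1 - α < β) (hK : 0 ≤ K) (ht0 : 0 ≤ t) (htT : t ≤ T)
    (hg : ∀ x y, |h x - h y| ≤ K * |x - y| ^ β) (hT : h T = 0) :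
    ∫ x in Ioo t T, (x - t) ^ (-α) * rightDeriv (1 - α) 0 T h x = Real.Gamma (1 - α) * h t := by
  have hGα := Real.Gamma_pos_of_pos hα.1
  have hβ0 : 0 < β := by linarith [hα.2]
  have hα' : 1 - α ∈ Ioo (0 : ℝ) 1 := ⟨by linarith [hα.2], by linarith [hα.1]⟩
  have hT0 : 0 ≤ T := ht0.trans htT
  obtain ⟨φ, φ', hd, hc, hhol, hφT, hlim⟩ := exists_smooth_approx hβ0 hK hg hT
  have hφc : ∀ n, Continuous (φ n) := fun n =>
    continuous_iff_continuousAt.2 fun y => (hd n y).continuousAt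
  -- the identity for the smooth approximations
  have hsmooth : ∀ n, ∫ x in Ioo t T, (x - t) ^ (-α) * rightDeriv (1 - α) 0 T (φ n) x =
      Real.Gamma (1 - α) * φ n t := by
    intro n
    obtain ⟨M, hM⟩ := isCompact_Icc.exists_bound_of_continuousOn (s := Icc 0 T) (hc n).continuousOn
    have hL : ∀ x ∈ Icc 0 T, ∀ u ∈ Icc x T, |φ n x - φ n u| ≤ M * (u - x) := by
      intro x hx u hu
      have := Convex.norm_image_sub_le_of_norm_hasDerivWithin_le (f := φ n) (f' := φ' n)
        (s := Icc 0 T) (C := M) (fun y _ => (hd n y).hasDerivWithinAt) hM (convex_Icc 0 T)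
        (x := u) (y := x) ⟨hx.1.trans hu.1, hu.2⟩ hx
      rwa [Real.norm_eq_abs, Real.norm_eq_abs, abs_sub_comm x u,
        abs_of_nonneg (by linarith [hu.1] : (0 : ℝ) ≤ u - x)] at this
    have e : ∀ x ∈ Ioo t T, (x - t) ^ (-α) * rightDeriv (1 - α) 0 T (φ n) x =
        -(1 / Real.Gamma α) *
          ((x - t) ^ (-α) * ∫ u in Ioo x T, (u - x) ^ (α - 1) * φ' n u) := by
      intro x hx
      rw [rightDeriv_of_hasDerivAt hα ⟨by linarith [hx.1], hx.2⟩ (hd n) (hc n)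
        (hL x ⟨by linarith [hx.1], hx.2.le⟩) (hφT n)]
      ring
    rw [setIntegral_congr_fun measurableSet_Ioo e, integral_const_mul,
      integral_frac_swap hα (hc n).measurable (M := M)
        (fun u hu => hM u ⟨by linarith [hu.1], hu.2.le⟩),
      ← integral_Ioc_eq_integral_Ioo, ← intervalIntegral.integral_of_le htT,
      intervalIntegral.integral_eq_sub_of_hasDerivAt (fun y _ => hd n y)
        ((hc n).intervalIntegrable _ _), hφT n]
    field_simp
    ring
  -- pointwise convergence of the derivatives
  have hpt : ∀ x ∈ Ioo 0 T, Filter.Tendsto (fun n => rightDeriv (1 - α) 0 T (φ n) x) Filter.atTop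
      (nhds (rightDeriv (1 - α) 0 T h x)) := by
    intro x hx
    simp only [rightDeriv, indicator_of_mem hx]
    refine Filter.Tendsto.const_mul _ (((hlim x).div_const _).add (Filter.Tendsto.const_mul _ ?_))
    refine intervalIntegral.tendsto_integral_filter_of_dominated_convergence
      (fun u => K * (u - x) ^ (β - 1 - (1 - α))) ?_ ?_ ?_ ?_
    · refine Filter.Eventually.of_forall fun n => Measurable.aestronglyMeasurable ?_
      have := (hφc n).measurable
      fun_prop
    · refine Filter.Eventually.of_forall fun n => ae_of_all _ fun u hu => ?_
      rw [uIoc_of_le hx.2.le] at hu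
      exact norm_rightKernel_le hu.1 (hhol n x u)
    · exact (intervalIntegrable_sub_rpow (by linarith)).const_mul K
    · exact ae_of_all _ fun u _ => ((hlim x).sub (hlim u)).div_const _
  have hdct : Filter.Tendsto (fun n => ∫ x in Ioo t T, (x - t) ^ (-α) *
      rightDeriv (1 - α) 0 T (φ n) x) Filter.atTop
      (nhds (∫ x in Ioo t T, (x - t) ^ (-α) * rightDeriv (1 - α) 0 T h x)) := by
    -- The approximations share the Hölder constant `K`, so their right derivatives have a common
    -- bound and `(x - t) ^ (-α)` dominates up to a constant.
    refine tendsto_integral_of_dominated_convergence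
      (fun x => (x - t) ^ (-α) * (rightConst (1 - α) β T * K)) (fun n => ?_) ?_ (fun n => ?_) ?_
    · have := measurable_rightDeriv (δ := 1 - α) (T := T) (hφc n).measurable
      exact Measurable.aestronglyMeasurable (by fun_prop)
    · exact ((intervalIntegrable_iff_integrableOn_Ioo_of_le htT).1
        (intervalIntegrable_sub_rpow (by linarith [hα.2]))).mul_const _
    · filter_upwards [ae_restrict_mem measurableSet_Ioo] with x hx
      have hxt : 0 ≤ (x - t) ^ (-α) := Real.rpow_nonneg (by linarith [hx.1]) _
      rw [norm_mul, Real.norm_of_nonneg hxt]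
      gcongr
      exact abs_rightDeriv_le hα' hβ hT0 hK (hhol n) (hφT n) x
    · filter_upwards [ae_restrict_mem measurableSet_Ioo] with x hx
      exact (hpt x ⟨by linarith [hx.1], hx.2⟩).const_mul _
  simp_rw [hsmooth] at hdct
  exact tendsto_nhds_unique hdct ((hlim t).const_mul _)

/-- For `x > t` only `u < t` contributes to the kernel integral, which gives `(x - t) ^ (-α) - x ^
(-α)`; the last power cancels the term `f x / x ^ α`. -/
lemma leftDeriv_indicator_Ici {α t T x : ℝ} (hα : α ∈ Ioo (0 : ℝ) 1) (ht0 : 0 ≤ t)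
    (hxt : x ≠ t) : leftDeriv α 0 T ((Ici t).indicator 1) x =
      (Ioo t T).indicator (fun x => 1 / Real.Gamma (1 - α) * (x - t) ^ (-α)) x := by
  by_cases hx : x ∈ Ioo 0 T
  swap
  · rw [leftDeriv, indicator_of_notMem hx, indicator_of_notMem]
    exact fun h => hx ⟨by linarith [h.1], h.2⟩
  rw [leftDeriv, indicator_of_mem hx]
  rcases lt_or_gt_of_ne hxt with h | h
  · rw [indicator_of_notMem (fun h' => by linarith [h'.1] : x ∉ Ioo t T)]
    have : ∀ u ∈ Ioc 0 x, ((Ici t).indicator (1 : ℝ → ℝ) x - (Ici t).indicator (1 : ℝ → ℝ) u) /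
        (x - u) ^ (1 + α) = 0 := by
      intro u hu
      rw [indicator_of_notMem (by simp [h]), indicator_of_notMem (by simp; linarith [hu.2])]
      simp
    rw [intervalIntegral.integral_of_le hx.1.le, setIntegral_congr_fun measurableSet_Ioc this,
      indicator_of_notMem (by simp [h])]
    simp
  · rw [indicator_of_mem (show x ∈ Ioo t T from ⟨h, hx.2⟩)]
    obtain ⟨h1, h2⟩ := integral_sub_rpow_tail' hα.1 ht0 h
    have e1 : ∫ u in (0 : ℝ)..x, ((Ici t).indicator (1 : ℝ → ℝ) x -
        (Ici t).indicator (1 : ℝ → ℝ) u) / (x - u) ^ (1 + α) =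
        ∫ u in (0 : ℝ)..t, (x - u) ^ (-1 - α) := by
      rw [intervalIntegral.integral_of_le hx.1.le, intervalIntegral.integral_of_le ht0,
        integral_Ioc_eq_integral_Ioo (x := 0) (y := t), ← integral_indicator measurableSet_Ioc,
        ← integral_indicator measurableSet_Ioo]
      congr 1; ext u
      rw [indicator_of_mem (show x ∈ Ici t from h.le)]
      by_cases hu : u ∈ Ioo 0 t
      · have hxu : 0 < x - u := by linarith [hu.2]
        rw [indicator_of_mem hu, indicator_of_mem
          (show u ∈ Ioc 0 x from ⟨hu.1, by linarith [hu.2]⟩),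
          indicator_of_notMem (by simpa using hu.2), show -1 - α = -(1 + α) by ring,
          Real.rpow_neg hxu.le]
        simp
      · rw [indicator_of_notMem hu]
        by_cases hu' : u ∈ Ioc 0 x
        · rw [indicator_of_mem hu', indicator_of_mem (show u ∈ Ici t from
            not_lt.1 fun hh => hu ⟨hu'.1, hh⟩)]
          simp
        · rw [indicator_of_notMem hu']
    rw [e1, h2, indicator_of_mem (show x ∈ Ici t from h.le), mul_div_cancel₀ _ hα.1.ne',
      Real.rpow_neg (by linarith : 0 ≤ x - 0)]
    simp

/-- The left derivative of the indicator is the kernel of a fractional integral of order `1 - α`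
started at `t`, so pairing it with the right derivative recovers `g t - g T`. -/
theorem glsIntegral_indicator_Ici {α β K t T : ℝ} {g : ℝ → ℝ} (hα : α ∈ Ioo (0 : ℝ) 1)
    (hβ : 1 - α < β) (hK : 0 ≤ K) (ht0 : 0 ≤ t) (htT : t ≤ T)
    (hg : ∀ x y, |g x - g y| ≤ K * |x - y| ^ β) :
    glsIntegral α 0 T ((Ici t).indicator 1) g = g T - g t := by
  have hG := Real.Gamma_pos_of_pos (show 0 < 1 - α by linarith [hα.2])
  have h1 := integral_rightDeriv hα hβ hK ht0 htT (holder_sub_const hg (g T)) (by simp)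
  rw [glsIntegral_eq (ht0.trans htT)]
  have : ∫ x, leftDeriv α 0 T ((Ici t).indicator 1) x *
      rightDeriv (1 - α) 0 T (fun y => g y - g T) x =
      ∫ x in Ioo t T, 1 / Real.Gamma (1 - α) *
        ((x - t) ^ (-α) * rightDeriv (1 - α) 0 T (fun y => g y - g T) x) := by
    rw [← integral_indicator measurableSet_Ioo]
    refine integral_congr_ae ?_
    filter_upwards [compl_mem_ae_iff.2 (show volume {t} = 0 by simp)] with x hx
    rw [leftDeriv_indicator_Ici hα ht0 hx]
    by_cases hx : x ∈ Ioo t T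
    · rw [indicator_of_mem hx, indicator_of_mem hx]; ring
    · rw [indicator_of_notMem hx, indicator_of_notMem hx, zero_mul]
  rw [this, integral_const_mul, h1]
  field_simp
  ring

/-! ### Locality of the norm and of the integral; indicators of intervals -/

lemma fracNorm_congr {α T : ℝ} {f f' : ℝ → ℝ} (h : ∀ x ∈ Ioo 0 T, f x = f' x) :
    fracNorm α 0 T f = fracNorm α 0 T f' := by
  refine setLIntegral_congr_fun measurableSet_Ioo fun x hx => ?_
  rw [h x hx]
  congr 1
  refine setLIntegral_congr_fun measurableSet_Ioo fun z hz => ?_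
  rw [h z ⟨hz.1, hz.2.trans hx.2⟩]

lemma rightDeriv_congr {α T : ℝ} {g g' : ℝ → ℝ} (h : ∀ x ∈ Ioc 0 T, g x = g' x) :
    rightDeriv α 0 T g = rightDeriv α 0 T g' := by
  refine indicator_congr fun x hx => ?_
  rw [h x ⟨hx.1, hx.2.le⟩]
  congr 3
  rw [intervalIntegral.integral_of_le hx.2.le, intervalIntegral.integral_of_le hx.2.le]
  refine setIntegral_congr_fun measurableSet_Ioc fun u hu => ?_
  rw [h u ⟨hx.1.trans hu.1, hu.2⟩]

/-- Allows a path that is Hölder only on `[0, T]` to be replaced by a globally Hölder extension. -/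
lemma glsIntegral_congr_right {α T : ℝ} (hT : 0 < T) {f g g' : ℝ → ℝ}
    (h : ∀ x ∈ Ioc 0 T, g x = g' x) : glsIntegral α 0 T f g = glsIntegral α 0 T f g' := by
  rw [glsIntegral, glsIntegral, rightDeriv_congr (g' := fun y => g' y - g' T)]
  intro x hx
  rw [h x hx, h T ⟨hT, le_rfl⟩]

lemma GLSIntegrable.congr_right {α T : ℝ} (hT : 0 < T) {f g g' : ℝ → ℝ}
    (h : ∀ x ∈ Ioc 0 T, g x = g' x) (hg : GLSIntegrable α 0 T f g) :
    GLSIntegrable α 0 T f g' := by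
  refine ⟨hg.left_conv, ?_, hg.left_mem, ?_⟩
  · filter_upwards [hg.right_conv, ae_restrict_mem measurableSet_Ioo] with x hx hxT
    refine hx.congr_fun (fun u hu => ?_) measurableSet_Ioo
    simp only
    rw [h x ⟨hxT.1, hxT.2.le⟩, h u ⟨hxT.1.trans hu.1, hu.2.le⟩]
  · have := hg.right_mem
    rwa [rightDeriv_congr (g' := fun y => g' y - g' T)] at this
    intro x hx
    rw [h x hx, h T ⟨hT, le_rfl⟩]

section
variable {α β T K s t : ℝ} {g : ℝ → ℝ}

lemma fracNorm_indicator_Ico_ne_top (hα : α ∈ Ioo (0 : ℝ) 1) (hs : 0 ≤ s) (hst : s ≤ t) :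
    fracNorm α 0 T ((Ico s t).indicator 1) ≠ ∞ := by
  refine ne_top_of_le_ne_top ENNReal.ofReal_ne_top
    (fracNorm_bump_le (β := 1) (M := 1) (K := 0) hα hα.2 hs hst zero_le_one le_rfl
      (fun x hx => indicator_of_notMem hx _) (fun x hx => ?_) (fun x hx y hy => ?_))
  · rw [indicator_of_mem hx]; simp
  · rw [indicator_of_mem hx, indicator_of_mem hy]; simp

lemma fracNorm_indicator_Ici_ne_top (hα : α ∈ Ioo (0 : ℝ) 1) (hs : 0 ≤ s) (hsT : s ≤ T) :
    fracNorm α 0 T ((Ici s).indicator 1) ≠ ∞ := by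
  rw [fracNorm_congr (f' := (Ico s T).indicator 1)]
  · exact fracNorm_indicator_Ico_ne_top hα hs hsT
  · intro x hx
    by_cases h : s ≤ x
    · rw [indicator_of_mem (show x ∈ Ici s from h), indicator_of_mem (show x ∈ Ico s T from ⟨h, hx.2⟩)]
    · rw [indicator_of_notMem (show x ∉ Ici s from h), indicator_of_notMem fun h' => h h'.1]

lemma glsIntegral_indicator_Ico (hα : α ∈ Ioo (0 : ℝ) 1) (hβ : 1 - α < β) (hK : 0 ≤ K)
    (hg : ∀ x y, |g x - g y| ≤ K * |x - y| ^ β) (hs : 0 ≤ s) (hst : s ≤ t) (htT : t ≤ T) :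
    glsIntegral α 0 T ((Ico s t).indicator 1) g = g t - g s := by
  have h1 := glsIntegral_add (f₁ := (Ico s t).indicator 1) (f₂ := (Ici t).indicator 1) hα hβ
    (hs.trans (hst.trans htT)) hK hg (measurable_one.indicator measurableSet_Ico)
    (measurable_one.indicator measurableSet_Ici)
    (fracNorm_indicator_Ico_ne_top hα hs hst) (fracNorm_indicator_Ici_ne_top hα (hs.trans hst) htT)
  have h2 : (fun x => (Ico s t).indicator (1 : ℝ → ℝ) x + (Ici t).indicator (1 : ℝ → ℝ) x) =
      (Ici s).indicator 1 := by
    have : Disjoint (Ico s t) (Ici t) := by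
      rw [Set.disjoint_left]; intro x hx hx'; exact absurd hx.2 (not_lt.2 hx')
    rw [← Ico_union_Ici_eq_Ici hst, indicator_union_of_disjoint this]
  rw [h2, glsIntegral_indicator_Ici hα hβ hK hs (hst.trans htT) hg,
    glsIntegral_indicator_Ici hα hβ hK (hs.trans hst) htT hg] at h1
  linarith

/-! ### Chain rule for sine bumps -/

/-- An additive interval function with a superlinear modulus is constant. -/
lemma eq_of_abs_sub_le_rpow {A : ℝ → ℝ} {C θ : ℝ} (hθ : 1 < θ) (hst : s ≤ t)
    (h : ∀ u v, s ≤ u → u ≤ v → v ≤ t → |A v - A u| ≤ C * (v - u) ^ θ) : A t = A s := by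
  have hlim : ∀ x, Filter.Tendsto (fun y : ℝ => C * |y - x| ^ (θ - 1)) (nhds x) (nhds 0) := by
    intro x
    have hco : Continuous fun y : ℝ => C * |y - x| ^ (θ - 1) :=
      continuous_const.mul (Continuous.rpow_const (by fun_prop) fun _ => Or.inr (by linarith))
    simpa [Real.zero_rpow (show θ - 1 ≠ 0 by linarith)] using hco.tendsto x
  have hab : ∀ u ∈ Icc s t, ∀ v ∈ Icc s t, |A v - A u| ≤ C * |v - u| ^ (θ - 1) * |v - u| := by
    intro u hu v hv
    have e : ∀ d : ℝ, 0 ≤ d → C * d ^ (θ - 1) * d = C * d ^ θ := by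
      intro d hd
      rcases hd.eq_or_lt with rfl | hd
      · simp [Real.zero_rpow (show θ ≠ 0 by linarith)]
      · rw [Real.rpow_sub_one hd.ne']; field_simp
    rw [e _ (abs_nonneg _)]
    rcases le_total u v with huv | huv
    · rw [abs_of_nonneg (by linarith : 0 ≤ v - u)]
      exact h u v hu.1 huv hv.2
    · rw [abs_sub_comm (A v), abs_sub_comm v, abs_of_nonneg (by linarith : 0 ≤ u - v)]
      exact h v u hv.1 huv hu.2
  -- An increment is `|y - x|` times a factor of order `|y - x| ^ (θ - 1)`, which tends to `0`;
  -- hence the derivative vanishes everywhere.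
  have hder : ∀ x ∈ Icc s t, HasDerivWithinAt A 0 (Icc s t) x := by
    intro x hx
    rw [hasDerivWithinAt_iff_isLittleO]
    simp only [smul_zero, sub_zero]
    rw [Asymptotics.isLittleO_iff]
    intro c hc
    have h1 := (hlim x).eventually (gt_mem_nhds hc)
    filter_upwards [mem_nhdsWithin_of_mem_nhds h1, self_mem_nhdsWithin] with y hy hyI
    refine (hab x hx y hyI).trans ?_
    rw [Real.norm_eq_abs]
    gcongr
  exact constant_of_derivWithin_zero (fun x hx => (hder x hx).differentiableWithinAt)
    (fun x hx => (hder x ⟨hx.1, hx.2.le⟩).derivWithin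
      (uniqueDiffOn_Icc (hx.1.trans_lt hx.2) x ⟨hx.1, hx.2.le⟩)) t ⟨hst, le_rfl⟩

/-- The integrand `sin ((g x - g s) / a)` on `[s, t)`. -/
noncomputable def sinBump (g : ℝ → ℝ) (a s t : ℝ) : ℝ → ℝ :=
  (Ico s t).indicator fun x => Real.sin ((g x - g s) / a)

lemma abs_sin_sub_sin_le (x y : ℝ) : |Real.sin x - Real.sin y| ≤ |x - y| := by
  have := Convex.norm_image_sub_le_of_norm_hasDerivWithin_le (f := Real.sin) (f' := Real.cos)
    (s := univ) (C := 1) (fun y _ => (Real.hasDerivAt_sin y).hasDerivWithinAt)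
    (fun y _ => by simpa using Real.abs_cos_le_one y) convex_univ (x := y) (y := x)
    (mem_univ _) (mem_univ _)
  simpa using this

/-- The mean value inequality for `-cos z - sin x * z`, whose derivative `sin z - sin x` is at most
`|y - x|` between `x` and `y`. -/
lemma abs_cos_taylor_le (x y : ℝ) :
    |Real.cos x - Real.cos y - Real.sin x * (y - x)| ≤ |y - x| * |y - x| := by
  have := Convex.norm_image_sub_le_of_norm_hasDerivWithin_le
    (f := fun z => -Real.cos z - Real.sin x * z) (f' := fun z => Real.sin z - Real.sin x)
    (s := uIcc x y) (C := |y - x|) (fun z _ => ?_) (fun z hz => ?_) (convex_uIcc x y) (x := x) (y := y)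
    left_mem_uIcc right_mem_uIcc
  · simp only [Real.norm_eq_abs] at this
    convert this using 2
    ring
  · have h1 := ((Real.hasDerivAt_cos z).neg.sub ((hasDerivAt_id z).const_mul (Real.sin x)))
    refine (h1.congr_deriv ?_).hasDerivWithinAt
    simp
  · exact (abs_sin_sub_sin_le z x).trans (abs_sub_left_of_mem_uIcc hz)

lemma measurable_sinBump (hg : Measurable g) (a s t : ℝ) : Measurable (sinBump g a s t) :=
  Measurable.indicator (by fun_prop) measurableSet_Ico

lemma abs_sinBump_le (a x : ℝ) : |sinBump g a s t x| ≤ 1 := by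
  by_cases hx : x ∈ Ico s t
  · rw [sinBump, indicator_of_mem hx]; exact Real.abs_sin_le_one _
  · rw [sinBump, indicator_of_notMem hx]; simp

lemma abs_sin_holder {a : ℝ} (ha : 0 < a) (hg : ∀ x y, |g x - g y| ≤ K * |x - y| ^ β) (x y : ℝ) :
    |Real.sin ((g x - g s) / a) - Real.sin ((g y - g s) / a)| ≤ K / a * |x - y| ^ β := by
  refine (abs_sin_sub_sin_le _ _).trans ?_
  rw [← sub_div, sub_sub_sub_cancel_right, abs_div, abs_of_pos ha, div_mul_eq_mul_div]
  gcongr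
  exact hg x y

lemma fracNorm_sinBump_le {a : ℝ} (hα : α ∈ Ioo (0 : ℝ) 1) (hβ : α < β) (ha : 0 < a) (hK : 0 ≤ K)
    (hg : ∀ x y, |g x - g y| ≤ K * |x - y| ^ β) (hs : 0 ≤ s) (hst : s ≤ t) :
    fracNorm α 0 T (sinBump g a s t) ≤ ENNReal.ofReal
      (bumpConst α β * (1 * (t - s) ^ (1 - α) + K / a * (t - s) ^ (1 + β - α))) := by
  refine fracNorm_bump_le hα hβ hs hst zero_le_one (by positivity)
    (fun x hx => indicator_of_notMem hx _) (fun x _ => abs_sinBump_le a x) (fun x hx y hy => ?_)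
  rw [sinBump, indicator_of_mem hx, indicator_of_mem hy]
  exact abs_sin_holder ha hg x y

/-- Change of variables for the integrand `sin ((g - g s) / a)` on an interval. -/
theorem glsIntegral_sinBump {a : ℝ} (hα : α ∈ Ioo (0 : ℝ) 1) (hβ : 1 - α < β) (hαβ : α < β)
    (ha : 0 < a) (hK : 0 ≤ K) (hg : ∀ x y, |g x - g y| ≤ K * |x - y| ^ β) (hs : 0 ≤ s)
    (hst : s ≤ t) (htT : t ≤ T) :
    glsIntegral α 0 T (sinBump g a s t) g = a * (1 - Real.cos ((g t - g s) / a)) := by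
  have hβ0 : 0 < β := hα.1.trans hαβ
  have hT : 0 ≤ T := hs.trans (hst.trans htT)
  have hgm := (continuous_of_holder hβ0 hg).measurable
  set w : ℝ → ℝ := fun x => Real.sin ((g x - g s) / a) with hw
  have hwm : Measurable w := by fun_prop
  set F : ℝ → ℝ := fun x => a * (1 - Real.cos ((g x - g s) / a)) with hF
  -- The integral over `[s, v)` is compared with the antiderivative `F v`. Over a short interval the
  -- integrand frozen at its left end errs with exponent `1 + β - α`, and the Taylor remainder of
  -- `F` has exponent `2 * β`. Both exceed `1`.
  set θ : ℝ := min (1 + β - α) (2 * β) with hθ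
  have hθ1 : 1 < θ := lt_min (by linarith) (by linarith)
  have hB := bumpConst_pos hα hαβ
  have hC0 := glsConst_nonneg hα hβ hT
  set C₁ : ℝ := glsConst α β T * K * (bumpConst α β * (2 * (K / a)))
  set C : ℝ := C₁ * (t - s) ^ (1 + β - α - θ) + K ^ 2 / a * (t - s) ^ (2 * β - θ)
  have hmain : ∀ u v, s ≤ u → u ≤ v → v ≤ t →
      |(glsIntegral α 0 T (sinBump g a s v) g - F v) -
        (glsIntegral α 0 T (sinBump g a s u) g - F u)| ≤ C * (v - u) ^ θ := by
    intro u v hsu huv hvt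
    have hu0 : 0 ≤ u := hs.trans hsu
    have hvu : 0 ≤ v - u := by linarith
    -- On the added interval `[u, v)` the integrand is its value frozen at `u` plus an oscillating
    -- rest. The frozen part integrates exactly to `w u * (g v - g u)`.
    set f₁ : ℝ → ℝ := fun x => w u * (Ico u v).indicator 1 x
    set f₂ : ℝ → ℝ := (Ico u v).indicator fun x => w x - w u
    have hf₁ : Measurable f₁ := (measurable_one.indicator measurableSet_Ico).const_mul _
    have hf₂ : Measurable f₂ := Measurable.indicator (by fun_prop) measurableSet_Ico
    have hf₁n : fracNorm α 0 T f₁ ≠ ∞ := by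
      rw [fracNorm_const_mul]
      exact ENNReal.mul_ne_top ENNReal.ofReal_ne_top (fracNorm_indicator_Ico_ne_top hα hu0 huv)
    have hwK : ∀ x y, |w x - w y| ≤ K / a * |x - y| ^ β := abs_sin_holder ha hg
    have hf₂n : fracNorm α 0 T f₂ ≤
        ENNReal.ofReal (bumpConst α β * (2 * (K / a)) * (v - u) ^ (1 + β - α)) := by
      refine (fracNorm_bump_le (M := K / a * (v - u) ^ β) hα hαβ hu0 huv (by positivity)
        (K := K / a) (by positivity)
        (fun x hx => indicator_of_notMem hx _) (fun x hx => ?_) (fun x hx y hy => ?_)).trans ?_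
      · rw [indicator_of_mem hx]
        refine (hwK x u).trans ?_
        rw [abs_of_nonneg (by linarith [hx.1])]
        have := hx.1
        gcongr
        exact hx.2.le
      · rw [indicator_of_mem hx, indicator_of_mem hy, sub_sub_sub_cancel_right]
        exact hwK x y
      · refine ENNReal.ofReal_le_ofReal (le_of_eq ?_)
        rcases hvu.eq_or_lt with h | h
        · rw [← h, Real.zero_rpow hβ0.ne', Real.zero_rpow (show 1 + β - α ≠ 0 by linarith)]; ring
        · rw [mul_assoc (K / a), ← Real.rpow_add h, show β + (1 - α) = 1 + β - α by ring]; ring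
    have hsplit : sinBump g a s v = fun x => sinBump g a s u x + (f₁ x + f₂ x) := by
      ext x
      simp only [sinBump, f₁, f₂]
      rcases lt_or_ge x s with h1 | h1
      · rw [indicator_of_notMem fun h => by linarith [h.1],
          indicator_of_notMem fun h => by linarith [h.1],
          indicator_of_notMem fun h => by linarith [h.1],
          indicator_of_notMem fun h => by linarith [h.1]]
        simp
      rcases lt_or_ge x u with h2 | h2
      · rw [indicator_of_mem (show x ∈ Ico s v from ⟨h1, by linarith⟩),
          indicator_of_mem (show x ∈ Ico s u from ⟨h1, h2⟩),
          indicator_of_notMem fun h => by linarith [h.1],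
          indicator_of_notMem fun h => by linarith [h.1]]
        simp
      rcases lt_or_ge x v with h3 | h3
      · rw [indicator_of_mem (show x ∈ Ico s v from ⟨h1, h3⟩),
          indicator_of_notMem fun h => by linarith [h.2],
          indicator_of_mem (show x ∈ Ico u v from ⟨h2, h3⟩),
          indicator_of_mem (show x ∈ Ico u v from ⟨h2, h3⟩)]
        simp [hw]
      · rw [indicator_of_notMem fun h => by linarith [h.2],
          indicator_of_notMem fun h => by linarith [h.2],
          indicator_of_notMem fun h => by linarith [h.2],
          indicator_of_notMem fun h => by linarith [h.2]]
        simp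
    have hadd := glsIntegral_add hα hβ hT hK hg hf₁ hf₂ hf₁n
      (ne_top_of_le_ne_top ENNReal.ofReal_ne_top hf₂n)
    have hadd' := glsIntegral_add (T := T) (f₁ := sinBump g a s u) (f₂ := fun x => f₁ x + f₂ x)
      hα hβ hT hK hg
      (measurable_sinBump hgm a s u) (hf₁.add hf₂)
      (ne_top_of_le_ne_top ENNReal.ofReal_ne_top (fracNorm_sinBump_le hα hαβ ha hK hg hs hsu))
      ?_
    swap
    · refine ne_top_of_le_ne_top ?_ (fracNorm_tsum_le (ι := Bool) (F := fun b => bif b then f₁ else f₂)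
        (by simp [hf₁, hf₂]) (fun x => by
          simpa using hasSum_fintype fun b : Bool => (bif b then f₁ else f₂) x))
      simp [tsum_fintype, hf₁n, (ne_top_of_le_ne_top ENNReal.ofReal_ne_top hf₂n)]
    rw [hsplit, hadd', hadd, glsIntegral_const_mul,
      glsIntegral_indicator_Ico hα hβ hK hg hu0 huv (hvt.trans htT)]
    have hI₂ := abs_glsIntegral_le hα hβ hT hK hg hf₂ (by positivity) hf₂n
    have hgvu : |g v - g u| ≤ K * (v - u) ^ β := by
      have := hg v u
      rwa [abs_of_nonneg hvu] at this
    have hTay : |w u * (g v - g u) - (F v - F u)| ≤ K ^ 2 / a * (v - u) ^ (2 * β) := by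
      have h1 := abs_cos_taylor_le ((g u - g s) / a) ((g v - g s) / a)
      have e1 : (g v - g s) / a - (g u - g s) / a = (g v - g u) / a := by ring
      rw [e1] at h1
      have e2 : w u * (g v - g u) - (F v - F u) = -(a * (Real.cos ((g u - g s) / a) -
          Real.cos ((g v - g s) / a) - Real.sin ((g u - g s) / a) * ((g v - g u) / a))) := by
        simp only [hw, hF]; field_simp; ring
      rw [e2, abs_neg, abs_mul, abs_of_pos ha]
      calc _ ≤ a * (|(g v - g u) / a| * |(g v - g u) / a|) := by gcongr
        _ = |g v - g u| * |g v - g u| / a := by rw [abs_div, abs_of_pos ha]; field_simp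
        _ ≤ (K * (v - u) ^ β) * (K * (v - u) ^ β) / a := by gcongr
        _ = _ := by
          rw [two_mul, Real.rpow_add_of_nonneg hvu hβ0.le hβ0.le]; ring
    -- Excess powers of `v - u` are absorbed into powers of the total length `t - s`, leaving the
    -- common exponent `θ`.
    have hpow : ∀ e : ℝ, θ ≤ e → (v - u) ^ e ≤ (t - s) ^ (e - θ) * (v - u) ^ θ := by
      intro e he
      have : (v - u) ^ e = (v - u) ^ (e - θ) * (v - u) ^ θ := by
        rw [← Real.rpow_add_of_nonneg hvu (by linarith) (by linarith)]; ring_nf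
      rw [this]
      have : (v - u) ^ (e - θ) ≤ (t - s) ^ (e - θ) :=
        Real.rpow_le_rpow hvu (by linarith) (by linarith)
      gcongr
    have hC₁ : 0 ≤ C₁ := by positivity
    have p1 := mul_le_mul_of_nonneg_left (hpow _ (min_le_left _ _)) hC₁
    have p2 := mul_le_mul_of_nonneg_left (hpow _ (min_le_right _ _))
      (show 0 ≤ K ^ 2 / a by positivity)
    calc _ = |(w u * (g v - g u) - (F v - F u)) + glsIntegral α 0 T f₂ g| := by
          congr 1; ring
      _ ≤ _ := abs_add_le _ _
      _ ≤ K ^ 2 / a * (v - u) ^ (2 * β) + C₁ * (v - u) ^ (1 + β - α) := by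
          refine add_le_add hTay (hI₂.trans_eq ?_)
          simp only [C₁]; ring
      _ ≤ _ := by
          simp only [C, add_mul]
          linarith
  have := eq_of_abs_sub_le_rpow
    (A := fun v => glsIntegral α 0 T (sinBump g a s v) g - F v) hθ1 hst hmain
  have h0 : glsIntegral α 0 T (sinBump g a s s) g = 0 := by
    have : sinBump g a s s = fun x => 0 * (0 : ℝ → ℝ) x := by
      ext x; simp [sinBump]
    rw [this, glsIntegral_const_mul, zero_mul]
  simp only [h0, hF, sub_self, zero_div, Real.cos_zero, mul_zero] at this
  linarith

/-- Integral of a countable superposition of sine bumps. -/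
theorem hasSum_sinBump {ι : Type*} [Countable ι] {e a l r : ι → ℝ} {f : ℝ → ℝ}
    (hα : α ∈ Ioo (0 : ℝ) 1) (hβ : 1 - α < β) (hαβ : α < β) (hT : 0 ≤ T) (hK : 0 ≤ K)
    (hg : ∀ x y, |g x - g y| ≤ K * |x - y| ^ β) (ha : ∀ i, 0 < a i) (hl : ∀ i, 0 ≤ l i)
    (hlr : ∀ i, l i ≤ r i) (hrT : ∀ i, r i ≤ T)
    (hf : ∀ x, HasSum (fun i => e i * sinBump g (a i) (l i) (r i) x) (f x))
    (hsum : Summable fun i =>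
      |e i| * ((r i - l i) ^ (1 - α) + (a i)⁻¹ * (r i - l i) ^ (1 + β - α))) :
    Measurable f ∧ fracNorm α 0 T f < ∞ ∧ GLSIntegrable α 0 T f g ∧
      HasSum (fun i => e i * (a i * (1 - Real.cos ((g (r i) - g (l i)) / a i))))
        (glsIntegral α 0 T f g) := by
  have hgm := (continuous_of_holder (hα.1.trans hαβ) hg).measurable
  have hB := bumpConst_pos hα hαβ
  have hFm : ∀ i, Measurable fun x => e i * sinBump g (a i) (l i) (r i) x :=
    fun i => (measurable_sinBump hgm _ _ _).const_mul _
  have hfin : ∑' i, fracNorm α 0 T (fun x => e i * sinBump g (a i) (l i) (r i) x) ≠ ∞ := by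
    -- The factor `1 + K` absorbs the Hölder constant, which is random in the application; the
    -- summability condition itself does not involve it.
    have hs := (hsum.mul_left (bumpConst α β * (1 + K)))
    refine ne_top_of_le_ne_top (ENNReal.ofReal_ne_top (r := ∑' i, bumpConst α β * (1 + K) *
      (|e i| * ((r i - l i) ^ (1 - α) + (a i)⁻¹ * (r i - l i) ^ (1 + β - α))))) ?_
    have hnn : ∀ i, 0 ≤ (r i - l i) ^ (1 - α) := fun i =>
      Real.rpow_nonneg (by linarith [hlr i]) _
    have hnn' : ∀ i, 0 ≤ (a i)⁻¹ * (r i - l i) ^ (1 + β - α) := fun i =>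
      mul_nonneg (inv_nonneg.2 (ha i).le) (Real.rpow_nonneg (by linarith [hlr i]) _)
    rw [ENNReal.ofReal_tsum_of_nonneg (fun i => by have := hnn i; have := hnn' i; positivity) hs]
    refine ENNReal.tsum_le_tsum fun i => ?_
    rw [fracNorm_const_mul]
    calc _ ≤ ENNReal.ofReal |e i| * _ := mul_le_mul_right
          (fracNorm_sinBump_le hα hαβ (ha i) hK hg (hl i) (hlr i)) _
      _ ≤ _ := by
        rw [← ENNReal.ofReal_mul (abs_nonneg _)]
        refine ENNReal.ofReal_le_ofReal ?_
        have h1 := hnn i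
        have h2 := hnn' i
        calc _ = bumpConst α β * |e i| * ((r i - l i) ^ (1 - α) +
              K * ((a i)⁻¹ * (r i - l i) ^ (1 + β - α))) := by ring
          _ ≤ bumpConst α β * |e i| * ((1 + K) * ((r i - l i) ^ (1 - α) +
              (a i)⁻¹ * (r i - l i) ^ (1 + β - α))) := by
            gcongr
            nlinarith [mul_nonneg hK h1]
          _ = _ := by ring
  have hN := (fracNorm_tsum_le hFm hf (α := α) (T := T)).trans_lt hfin.lt_top
  have hfm : Measurable f := by
    have : f = fun x => ∑' i, e i * sinBump g (a i) (l i) (r i) x :=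
      funext fun x => (hf x).tsum_eq.symm
    rw [this]
    exact Measurable.tsum hFm
  refine ⟨hfm, hN, glsIntegrable_of_fracNorm hα hβ hT hK hg hfm hN.ne, ?_⟩
  have := hasSum_glsIntegral hα hβ hT hK hg hFm hf hfin
  simp_rw [glsIntegral_const_mul] at this
  convert this using 3 with i
  rw [glsIntegral_sinBump hα hβ hαβ (ha i) hK hg (hl i) (hlr i) (hrT i)]

end

/-! ### Increments of Gaussian processes -/

section Gaussian

variable {Ω : Type*} {mΩ : MeasurableSpace Ω} {P : Measure Ω}

lemma isGaussianProcess_increments {ι : Type*} {X : ι → Ω → ℝ} (hX : IsGaussianProcess X P) :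
    IsGaussianProcess (fun (p : ι × ι) ω => X p.1 ω - X p.2 ω) P := by
  classical
  refine hX.of_isGaussianProcess fun p => ⟨{p.1, p.2},
    { toFun x := x ⟨p.1, by simp⟩ - x ⟨p.2, by simp⟩
      map_add' x y := by simp; ring
      map_smul' c x := by simp; ring
      cont := by fun_prop }, fun ω => by simp⟩

variable [IsProbabilityMeasure P]

/-- The real part of the characteristic function at `1`. -/
lemma integral_cos_of_hasGaussianLaw {X : Ω → ℝ} (hX : HasGaussianLaw X P) (h0 : ∫ ω, X ω ∂P = 0) :
    ∫ ω, Real.cos (X ω) ∂P = Real.exp (-(∫ ω, X ω ^ 2 ∂P) / 2) := by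
  have h1 := hX.charFun_map_eq (1 : ℝ)
  have hm := hX.aemeasurable
  rw [charFun_apply_real, integral_map hm (by fun_prop)] at h1
  simp only [RCLike.inner_apply, conj_trivial, mul_one, h0, variance_of_integral_eq_zero hm h0,
    Complex.ofReal_zero, zero_mul, zero_sub, Complex.ofReal_one, one_mul] at h1
  have h2 := congrArg Complex.re h1
  have hint : Integrable (fun ω => Complex.exp (X ω * Complex.I)) P := by
    refine Integrable.of_bound (C := 1) (by fun_prop) (ae_of_all _ fun ω => ?_)
    rw [Complex.norm_exp_ofReal_mul_I]
  have h3 := integral_re hint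
  simp only [RCLike.re_to_complex, Complex.exp_ofReal_mul_I_re] at h3
  rw [h3, h2, ← Complex.ofReal_ofNat, ← Complex.ofReal_div, ← Complex.ofReal_neg,
    Complex.exp_ofReal_re, neg_div]

/-- The left side is `exp (-m) * (cosh c - 1)`. As `c ≤ m`, it is at most `exp (-c) * (cosh c - 1) =
(1 - exp (-c)) ^ 2 / 2`, and `1 - exp (-c)` lies between `0` and both `1` and `c`. -/
lemma exp_cov_le {m c : ℝ} (hc : 0 ≤ c) (hcm : c ≤ m) :
    (Real.exp (-(m + c)) + Real.exp (-(m - c))) / 2 - Real.exp (-m) ≤ c := by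
  have h1 : Real.exp (-(m + c)) = Real.exp (-m) * Real.exp (-c) := by rw [← Real.exp_add]; ring_nf
  have h2 : Real.exp (-(m - c)) = Real.exp (-m) * Real.exp c := by rw [← Real.exp_add]; ring_nf
  have h3 : Real.exp (-m) ≤ Real.exp (-c) := Real.exp_le_exp.2 (by linarith)
  have h4 : Real.exp (-c) * Real.exp c = 1 := by rw [← Real.exp_add]; simp
  have h5 := Real.add_one_le_exp (-c)
  have h6 : Real.exp (-c) ≤ 1 := Real.exp_le_one_iff.2 (by linarith)
  have h7 := Real.exp_pos (-c)
  have h8 := Real.exp_pos c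
  have h9 := Real.exp_pos (-m)
  have h10 : 0 ≤ Real.exp (-c) + Real.exp c - 2 := by
    nlinarith [sq_nonneg (Real.exp (-c) - Real.exp c), sq_nonneg (Real.exp (-c) + Real.exp c - 2)]
  have h11 : Real.exp (-m) * (Real.exp (-c) + Real.exp c - 2) ≤
      Real.exp (-c) * (Real.exp (-c) + Real.exp c - 2) := by gcongr
  have h12 : Real.exp (-c) * (Real.exp (-c) + Real.exp c - 2) = (1 - Real.exp (-c)) ^ 2 := by
    linear_combination h4
  rw [h1, h2]
  nlinarith

/-- The product of cosines is the mean of `cos (X + Y)` and `cos (X - Y)`, whose arguments are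
centered Gaussian with variances `2 * (m + c)` and `2 * (m - c)`; `exp_cov_le` concludes. The point
is that no constant is lost, so covariances can be summed back to the variance of a sum of
increments. -/
lemma covariance_cos_le {X Y : Ω → ℝ} (hX : HasGaussianLaw X P) (hY : HasGaussianLaw Y P)
    (hadd : HasGaussianLaw (fun ω => X ω + Y ω) P) (hsub : HasGaussianLaw (fun ω => X ω - Y ω) P)
    (hX0 : ∫ ω, X ω ∂P = 0) (hY0 : ∫ ω, Y ω ∂P = 0) (hc : 0 ≤ ∫ ω, X ω * Y ω ∂P) :
    cov[fun ω => Real.cos (X ω), fun ω => Real.cos (Y ω); P] ≤ ∫ ω, X ω * Y ω ∂P := by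
  have hXm := hX.aemeasurable
  have hYm := hY.aemeasurable
  have hcosm : ∀ Z : Ω → ℝ, AEMeasurable Z P → MemLp (fun ω => Real.cos (Z ω)) 2 P := fun Z hZ =>
    MemLp.of_bound (C := 1) (by fun_prop) (ae_of_all _ fun ω => by simpa using Real.abs_cos_le_one _)
  have hi : ∀ Z : Ω → ℝ, AEMeasurable Z P → Integrable (fun ω => Real.cos (Z ω)) P := fun Z hZ =>
    (hcosm Z hZ).integrable (by norm_num)
  have hX2 := hX.memLp_two.integrable_sq
  have hY2 := hY.memLp_two.integrable_sq
  have hXY : Integrable (fun ω => X ω * Y ω) P := hX.memLp_two.integrable_mul hY.memLp_two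
  have hXi := hX.integrable
  have hYi := hY.integrable
  set c := ∫ ω, X ω * Y ω ∂P
  set m := ((∫ ω, X ω ^ 2 ∂P) + ∫ ω, Y ω ^ 2 ∂P) / 2
  have ea : ∫ ω, (X ω + Y ω) ^ 2 ∂P = 2 * (m + c) := by
    have : ∀ ω, (X ω + Y ω) ^ 2 = X ω ^ 2 + Y ω ^ 2 + 2 * (X ω * Y ω) := fun ω => by ring
    simp_rw [this]
    rw [integral_add (f := fun ω => X ω ^ 2 + Y ω ^ 2) (hX2.add hY2) (hXY.const_mul 2), integral_add hX2 hY2, integral_const_mul]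
    simp only [m, c]; ring
  have es : ∫ ω, (X ω - Y ω) ^ 2 ∂P = 2 * (m - c) := by
    have : ∀ ω, (X ω - Y ω) ^ 2 = X ω ^ 2 + Y ω ^ 2 - 2 * (X ω * Y ω) := fun ω => by ring
    simp_rw [this]
    rw [integral_sub (f := fun ω => X ω ^ 2 + Y ω ^ 2) (hX2.add hY2) (hXY.const_mul 2), integral_add hX2 hY2, integral_const_mul]
    simp only [m, c]; ring
  have hcm : c ≤ m := by
    have : 0 ≤ ∫ ω, (X ω - Y ω) ^ 2 ∂P := integral_nonneg fun ω => sq_nonneg _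
    rw [es] at this; linarith
  have hprod : ∫ ω, Real.cos (X ω) * Real.cos (Y ω) ∂P =
      (Real.exp (-(m + c)) + Real.exp (-(m - c))) / 2 := by
    have : ∀ ω, Real.cos (X ω) * Real.cos (Y ω) =
        (Real.cos (X ω + Y ω) + Real.cos (X ω - Y ω)) / 2 := fun ω => by
      rw [Real.cos_add, Real.cos_sub]; ring
    simp_rw [this]
    rw [integral_div, integral_add (hi _ (by fun_prop)) (hi _ (by fun_prop)),
      integral_cos_of_hasGaussianLaw hadd (by rw [integral_add hXi hYi, hX0, hY0, add_zero]),
      integral_cos_of_hasGaussianLaw hsub (by rw [integral_sub hXi hYi, hX0, hY0, sub_zero]), ea, es]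
    ring_nf
  rw [covariance_eq_sub (hcosm X hXm) (hcosm Y hYm)]
  simp only [Pi.mul_apply]
  rw [hprod, integral_cos_of_hasGaussianLaw hX hX0, integral_cos_of_hasGaussianLaw hY hY0,
    ← Real.exp_add]
  have : -(∫ ω, X ω ^ 2 ∂P) / 2 + -(∫ ω, Y ω ^ 2 ∂P) / 2 = -m := by simp only [m]; ring
  rw [this]
  exact exp_cov_le hc hcm

/-- Lower deviations of `∑ (1 - cos X_k)` for a positively correlated Gaussian sequence. -/
theorem measure_sum_one_sub_cos_lt {X : ℕ → Ω → ℝ} (hX : IsGaussianProcess X P)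
    (h0 : ∀ k, ∫ ω, X k ω ∂P = 0) {N : ℕ} (hN : 0 < N)
    (hc : ∀ j < N, ∀ k < N, 0 ≤ ∫ ω, X j ω * X k ω ∂P) {C V : ℝ} (hC : 0 < C)
    (hCX : ∀ k < N, C ≤ ∫ ω, X k ω ^ 2 ∂P)
    (hV : ∫ ω, (∑ k ∈ Finset.range N, X k ω) ^ 2 ∂P ≤ V) :
    P {ω | ∑ k ∈ Finset.range N, (1 - Real.cos (X k ω)) < N * (1 - Real.exp (-C / 2)) / 2} ≤
      ENNReal.ofReal (V / (N * (1 - Real.exp (-C / 2)) / 2) ^ 2) := by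
  have hm : ∀ k, AEMeasurable (X k) P := hX.aemeasurable
  set κ := 1 - Real.exp (-C / 2)
  have hκ : 0 < κ := by
    have : Real.exp (-C / 2) < 1 := Real.exp_lt_one_iff.2 (by linarith)
    simp only [κ]; linarith
  have hcosm : ∀ k, MemLp (fun ω => Real.cos (X k ω)) 2 P := fun k =>
    MemLp.of_bound (C := 1) (by have := hm k; fun_prop)
      (ae_of_all _ fun ω => by simpa using Real.abs_cos_le_one _)
  set S : Ω → ℝ := fun ω => ∑ k ∈ Finset.range N, Real.cos (X k ω)
  have hS : MemLp S 2 P := memLp_finsetSum _ fun k _ => hcosm k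
  have hN0 : (0 : ℝ) < N := Nat.cast_pos.2 hN
  have hES : ∫ ω, S ω ∂P ≤ N * (1 - κ) := by
    simp only [S]
    rw [integral_finsetSum _ fun k _ => (hcosm k).integrable (by norm_num)]
    calc _ ≤ ∑ k ∈ Finset.range N, (1 - κ) := by
          refine Finset.sum_le_sum fun k hk => ?_
          rw [integral_cos_of_hasGaussianLaw (hX.hasGaussianLaw_eval k) (h0 k)]
          simp only [κ, sub_sub_cancel]
          refine Real.exp_le_exp.2 ?_
          linarith [hCX k (Finset.mem_range.1 hk)]
      _ = _ := by simp [mul_sub]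
  have hVar : Var[S; P] ≤ V := by
    simp only [S]
    rw [variance_fun_sum' fun k _ => hcosm k]
    calc _ ≤ ∑ j ∈ Finset.range N, ∑ k ∈ Finset.range N, ∫ ω, X j ω * X k ω ∂P := by
          refine Finset.sum_le_sum fun j hj => Finset.sum_le_sum fun k hk => ?_
          exact covariance_cos_le (hX.hasGaussianLaw_eval j) (hX.hasGaussianLaw_eval k)
            hX.hasGaussianLaw_fun_add hX.hasGaussianLaw_fun_sub (h0 j) (h0 k)
            (hc j (Finset.mem_range.1 hj) k (Finset.mem_range.1 hk))
      _ = ∫ ω, (∑ k ∈ Finset.range N, X k ω) ^ 2 ∂P := by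
          have hij : ∀ j k, Integrable (fun ω => X j ω * X k ω) P := fun j k =>
            (hX.hasGaussianLaw_eval j).memLp_two.integrable_mul (hX.hasGaussianLaw_eval k).memLp_two
          simp_rw [sq, Finset.sum_mul_sum]
          rw [integral_finsetSum _ fun j _ => integrable_finsetSum _ fun k _ => hij j k]
          refine Finset.sum_congr rfl fun j _ => ?_
          rw [integral_finsetSum _ fun k _ => hij j k]
      _ ≤ V := hV
  -- The mean of `N - S` is at least `N * κ`, so falling below half of it is a deviation of `S` by
  -- at least `N * κ / 2`, to which Chebyshev applies.
  have hcpos : 0 < N * κ / 2 := by positivity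
  refine le_trans (measure_mono fun ω hω => ?_) ((meas_ge_le_variance_div_sq hS hcpos).trans
    (ENNReal.ofReal_le_ofReal (by gcongr)))
  have hω' : (N : ℝ) - S ω < N * κ / 2 := by
    have : ∑ k ∈ Finset.range N, (1 - Real.cos (X k ω)) = N - S ω := by
      simp [S, Finset.sum_sub_distrib]
    have h := hω
    simp only [mem_ofPred_eq, this] at h
    exact h
  rw [mem_ofPred_eq]
  refine le_trans ?_ (le_abs_self _)
  linarith

/-- A centered Gaussian variable is sub-Gaussian with any parameter above its variance; the Chernoff
bound is used for both signs. -/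
lemma measure_abs_ge_le_of_hasGaussianLaw {X : Ω → ℝ} (hX : HasGaussianLaw X P)
    (h0 : ∫ ω, X ω ∂P = 0) {c ε : ℝ} (hc0 : 0 ≤ c) (hc : ∫ ω, X ω ^ 2 ∂P ≤ c) (hε : 0 ≤ ε) :
    P {ω | ε ≤ |X ω|} ≤ ENNReal.ofReal (2 * Real.exp (-ε ^ 2 / (2 * c))) := by
  have key : ∀ Y : Ω → ℝ, HasGaussianLaw Y P → ∫ ω, Y ω ∂P = 0 → ∫ ω, Y ω ^ 2 ∂P ≤ c →
      P {ω | ε ≤ Y ω} ≤ ENNReal.ofReal (Real.exp (-ε ^ 2 / (2 * c))) := by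
    intro Y hY hY0 hYc
    have hmap := hY.map_eq_gaussianReal
    have hsg : HasSubgaussianMGF Y c.toNNReal P := by
      refine ⟨fun t => ?_, fun t => ?_⟩
      · have := integrable_exp_mul_gaussianReal (μ := P[Y]) (v := Var[Y; P].toNNReal) t
        rw [← hmap] at this
        exact (integrable_map_measure (by fun_prop) hY.aemeasurable).1 this
      · rw [mgf_gaussianReal hmap, hY0, variance_of_integral_eq_zero hY.aemeasurable hY0,
          Real.coe_toNNReal _ (integral_nonneg fun ω => sq_nonneg _), Real.coe_toNNReal _ hc0]
        refine Real.exp_le_exp.2 ?_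
        have := mul_le_mul_of_nonneg_right hYc (sq_nonneg t)
        linarith
    have := hsg.measure_ge_le hε
    rw [Real.coe_toNNReal _ hc0] at this
    rw [← ofReal_measureReal]
    exact ENNReal.ofReal_le_ofReal this
  have hsub : {ω | ε ≤ |X ω|} ⊆ {ω | ε ≤ X ω} ∪ {ω | ε ≤ -X ω} := fun ω hω => by
    simpa only [mem_union, mem_ofPred_eq, le_abs] using hω
  refine (measure_mono hsub).trans ((measure_union_le _ _).trans ?_)
  rw [two_mul, ENNReal.ofReal_add (Real.exp_pos _).le (Real.exp_pos _).le]
  exact add_le_add (key X hX h0 hc) (key _ hX.fun_neg (by rw [integral_neg, h0, neg_zero])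
    (by simpa using hc))

end Gaussian

/-! ### Hölder continuity of Gaussian paths by dyadic chaining -/

/-- A continuous function whose dyadic increments decay geometrically is Hölder continuous. -/
theorem exists_holder_of_dyadic {T β C : ℝ} {f : ℝ → ℝ} (hT : 0 < T) (hβ : 0 < β) (hC : 0 ≤ C)
    (hf : ContinuousOn f (Icc 0 T))
    (h : ∀ n i : ℕ, i < 2 ^ n →
      |f (T * ((i + 1 : ℕ) / 2 ^ n)) - f (T * ((i : ℕ) / 2 ^ n))| ≤ C * ((1 / 2 : ℝ) ^ β) ^ n) :
    ∃ K, 0 ≤ K ∧ ∀ s ∈ Icc 0 T, ∀ t ∈ Icc 0 T, |f s - f t| ≤ K * |s - t| ^ β := by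
  set q : ℝ := (1 / 2 : ℝ) ^ β with hq
  have hq0 : 0 < q := by positivity
  have hq1 : q < 1 := Real.rpow_lt_one (by norm_num) (by norm_num) hβ
  have h1q : 0 < 1 - q := by linarith
  set k : ℕ → ℝ → ℕ := fun n t => ⌊t / T * 2 ^ n⌋₊ with hk
  set d : ℕ → ℝ → ℝ := fun n t => T * (k n t / 2 ^ n) with hd
  have hx0 : ∀ n, ∀ t ∈ Icc 0 T, 0 ≤ t / T * 2 ^ n := fun n t ht => by
    have := ht.1; positivity
  have hkle : ∀ n, ∀ t ∈ Icc 0 T, (k n t : ℝ) ≤ t / T * 2 ^ n := fun n t ht =>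
    Nat.floor_le (hx0 n t ht)
  have hklt : ∀ n t, t / T * 2 ^ n < k n t + 1 := fun n t => Nat.lt_floor_add_one _
  have hkN : ∀ n, ∀ t ∈ Icc 0 T, k n t ≤ 2 ^ n := by
    intro n t ht
    have h1 := hkle n t ht
    have h2 : t / T * 2 ^ n ≤ 1 * 2 ^ n := by gcongr; exact (div_le_one hT).2 ht.2
    exact_mod_cast h1.trans (h2.trans_eq (one_mul _))
  have hadj : ∀ n i j : ℕ, i ≤ 2 ^ n → j ≤ 2 ^ n → i ≤ j + 1 → j ≤ i + 1 →
      |f (T * (i / 2 ^ n)) - f (T * (j / 2 ^ n))| ≤ C * q ^ n := by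
    intro n i j hi hj hij hji
    have hnn : 0 ≤ C * q ^ n := by positivity
    rcases lt_trichotomy i j with hlt | rfl | hlt
    · obtain rfl : j = i + 1 := by omega
      rw [abs_sub_comm]; exact h n i (by omega)
    · simpa using hnn
    · obtain rfl : i = j + 1 := by omega
      exact h n j (by omega)
  have hstep : ∀ n, ∀ t ∈ Icc 0 T, dist (f (d n t)) (f (d (n + 1) t)) ≤ C * q ^ n := by
    intro n t ht
    have e : d n t = T * ((2 * k n t : ℕ) / 2 ^ (n + 1)) := by
      simp only [hd]; push_cast; rw [pow_succ]; field_simp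
    have h1 := hkle n t ht
    have h2 := hklt n t
    have h3 := hkle (n + 1) t ht
    have h4 := hklt (n + 1) t
    have e2 : t / T * 2 ^ (n + 1) = 2 * (t / T * 2 ^ n) := by rw [pow_succ]; ring
    rw [e2] at h3 h4
    have h5 : (2 * k n t : ℕ) ≤ k (n + 1) t := by
      have : ((2 * k n t : ℕ) : ℝ) < k (n + 1) t + 1 := by push_cast; linarith
      have : 2 * k n t < k (n + 1) t + 1 := by exact_mod_cast this
      omega
    have h6 : k (n + 1) t ≤ 2 * k n t + 1 := by
      have : (k (n + 1) t : ℝ) < (2 * k n t + 2 : ℕ) := by push_cast; linarith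
      have : k (n + 1) t < 2 * k n t + 2 := by exact_mod_cast this
      omega
    rw [Real.dist_eq, e]
    refine (hadj (n + 1) _ _ (h5.trans (hkN _ t ht)) (hkN _ t ht) (by omega) (by omega)).trans ?_
    rw [pow_succ]
    have : 0 ≤ C * q ^ n := by positivity
    nlinarith
  have hdT : ∀ n, ∀ t ∈ Icc 0 T, d n t ∈ Icc 0 T ∧ |d n t - t| ≤ T * (1 / 2) ^ n := by
    intro n t ht
    have h1 := hkle n t ht
    have h2 := hklt n t
    have hp : (0 : ℝ) < 2 ^ n := by positivity
    have e : t = T * (t / T * 2 ^ n / 2 ^ n) := by field_simp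
    have h3 : d n t ≤ t := by
      nth_rewrite 2 [e]
      simp only [hd]; gcongr
    have h4 : t ≤ d n t + T * (1 / 2) ^ n := by
      calc t = T * (t / T * 2 ^ n / 2 ^ n) := e
        _ ≤ T * ((k n t + 1) / 2 ^ n) := by gcongr
        _ = _ := by simp only [hd, one_div, inv_pow]; ring
    have h5 : 0 ≤ d n t := by positivity
    refine ⟨⟨h5, h3.trans ht.2⟩, ?_⟩
    rw [abs_sub_comm, abs_of_nonneg (by linarith)]
    linarith
  have hlim : ∀ t ∈ Icc 0 T, Filter.Tendsto (fun n => f (d n t)) Filter.atTop (nhds (f t)) := by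
    intro t ht
    have h1 : Filter.Tendsto (fun n => d n t) Filter.atTop (nhds t) := by
      refine tendsto_iff_dist_tendsto_zero.2 (squeeze_zero (fun _ => dist_nonneg)
        (fun n => (hdT n t ht).2) ?_)
      simpa using (tendsto_pow_atTop_nhds_zero_of_lt_one (show (0 : ℝ) ≤ 1 / 2 by norm_num)
        (by norm_num)).const_mul T
    exact (hf t ht).tendsto.comp (tendsto_nhdsWithin_iff.2
      ⟨h1, Filter.Eventually.of_forall fun n => (hdT n t ht).1⟩)
  have hdist : ∀ n, ∀ t ∈ Icc 0 T, |f (d n t) - f t| ≤ C * q ^ n / (1 - q) := fun n t ht =>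
    dist_le_of_le_geometric_of_tendsto q C hq1 (fun n => hstep n t ht) (hlim t ht) n
  -- Two geometric tails, from `s` and `t` to their dyadic points, and one step between these
  -- points.
  set A : ℝ := C * (2 / (1 - q) + 1)
  refine ⟨A * (2 / T) ^ β, by positivity, fun s hs t ht => ?_⟩
  rcases eq_or_ne s t with rfl | hst
  · simp [Real.zero_rpow hβ.ne']
  have hpos : 0 < |s - t| := abs_pos.2 (sub_ne_zero.2 hst)
  have hle : |s - t| ≤ T := abs_sub_le_iff.2 ⟨by linarith [hs.2, ht.1], by linarith [hs.1, ht.2]⟩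
  -- The level is chosen with `2 ^ (-(n + 1)) < |s - t| / T ≤ 2 ^ (-n)`: the dyadic points of `s`
  -- and `t` are then equal or adjacent, while `q ^ n` is still comparable to `|s - t| ^ β`.
  obtain ⟨n, hn1, hn2⟩ := exists_nat_pow_near_of_lt_one (x := |s - t| / T) (y := (1 / 2 : ℝ))
    (by positivity) ((div_le_one hT).2 hle) (by norm_num) (by norm_num)
  have hmid : |f (d n s) - f (d n t)| ≤ C * q ^ n := by
    have hab : |s / T * 2 ^ n - t / T * 2 ^ n| ≤ 1 := by
      have e : s / T * 2 ^ n - t / T * 2 ^ n = (s - t) / T * 2 ^ n := by ring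
      rw [e, abs_mul, abs_div, abs_of_pos hT, abs_of_pos (by positivity : (0 : ℝ) < 2 ^ n)]
      calc _ ≤ (1 / 2 : ℝ) ^ n * 2 ^ n := by gcongr
        _ = 1 := by rw [← mul_pow]; norm_num
    have ⟨h7, h8⟩ := abs_sub_le_iff.1 hab
    have := hkle n s hs
    have := hkle n t ht
    have := hklt n s
    have := hklt n t
    refine hadj n _ _ (hkN n s hs) (hkN n t ht) ?_ ?_
    · have : (k n s : ℝ) < (k n t + 2 : ℕ) := by push_cast; linarith
      have : k n s < k n t + 2 := by exact_mod_cast this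
      omega
    · have : (k n t : ℝ) < (k n s + 2 : ℕ) := by push_cast; linarith
      have : k n t < k n s + 2 := by exact_mod_cast this
      omega
  have hqn : q ^ n ≤ (2 / T) ^ β * |s - t| ^ β := by
    rw [← Real.mul_rpow (by positivity) (abs_nonneg _), hq, ← Real.rpow_natCast, ← Real.rpow_mul
      (by norm_num), mul_comm β, Real.rpow_mul (by norm_num), Real.rpow_natCast]
    refine Real.rpow_le_rpow (by positivity) ?_ hβ.le
    rw [pow_succ] at hn1
    have : (1 / 2 : ℝ) ^ n < 2 * (|s - t| / T) := by linarith
    refine this.le.trans_eq (by ring)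
  have h9 := hdist n s hs
  have h10 := hdist n t ht
  calc |f s - f t| = |-(f (d n s) - f s) + (f (d n s) - f (d n t)) + (f (d n t) - f t)| := by
        congr 1; ring
    _ ≤ |f (d n s) - f s| + |f (d n s) - f (d n t)| + |f (d n t) - f t| := by
        refine (abs_add_three _ _ _).trans ?_
        rw [abs_neg]
    _ ≤ C * q ^ n / (1 - q) + C * q ^ n + C * q ^ n / (1 - q) := by gcongr
    _ = A * q ^ n := by simp only [A]; ring
    _ ≤ A * ((2 / T) ^ β * |s - t| ^ β) := by gcongr
    _ = _ := by ring

/-- The bound `exp (-y) ≤ m! / y ^ m` with `m > 1 / η` beats the factor `2 ^ n` geometrically. -/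
lemma summable_two_pow_mul_exp {c η : ℝ} (hc : 0 < c) (hη : 0 < η) :
    Summable fun n : ℕ => (2 : ℝ) ^ n * (2 * Real.exp (-(c * ((2 : ℝ) ^ η) ^ n))) := by
  obtain ⟨m, hm⟩ := exists_nat_gt (1 / η)
  have h2η : (1 : ℝ) < 2 ^ η := Real.one_lt_rpow (by norm_num) hη
  have hρ : 2 / ((2 : ℝ) ^ η) ^ m < 1 := by
    rw [div_lt_one (by positivity), ← Real.rpow_natCast, ← Real.rpow_mul (by norm_num)]
    calc (2 : ℝ) = 2 ^ (1 : ℝ) := by simp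
      _ < _ := Real.rpow_lt_rpow_of_exponent_lt (by norm_num) (by
        rw [div_lt_iff₀ hη] at hm; linarith)
  refine Summable.of_nonneg_of_le (fun n => by positivity) (fun n => ?_)
    ((summable_geometric_of_lt_one (by positivity) hρ).mul_left (2 * (m.factorial / c ^ m)))
  set y := c * ((2 : ℝ) ^ η) ^ n
  have hy : 0 < y := by positivity
  have h1 := Real.pow_div_factorial_le_exp y hy.le m
  have h2 : Real.exp (-y) ≤ m.factorial / y ^ m := by
    rw [Real.exp_neg, inv_le_comm₀ (Real.exp_pos _) (by positivity), inv_div]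
    exact h1
  calc _ ≤ (2 : ℝ) ^ n * (2 * (m.factorial / y ^ m)) := by gcongr
    _ = _ := by
      simp only [y]
      rw [div_pow, mul_pow, ← pow_mul, ← pow_mul, mul_comm n m]
      field_simp

/-- Hölder continuity of the paths of a continuous Gaussian process. -/
theorem ae_exists_holder {Ω : Type*} {mΩ : MeasurableSpace Ω} {P : Measure Ω}
    [IsProbabilityMeasure P] {T H β C₂ : ℝ} (hT : 0 < T) (hβ : 0 < β) (hβH : β < H) (hC : 0 < C₂)
    {G : ℝ → Ω → ℝ} (hG : IsGaussianProcess (fun t : Icc (0 : ℝ) T => G t) P)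
    (hG0 : ∀ t ∈ Icc (0 : ℝ) T, ∫ ω, G t ω ∂P = 0)
    (hGc : ∀ᵐ ω ∂P, ContinuousOn (fun t => G t ω) (Icc 0 T))
    (hA : ∀ s ∈ Icc (0 : ℝ) T, ∀ t ∈ Icc (0 : ℝ) T,
      ∫ ω, (G t ω - G s ω) ^ 2 ∂P ≤ C₂ * |t - s| ^ (2 * H)) :
    ∀ᵐ ω ∂P, ∃ K, 0 ≤ K ∧ ∀ s ∈ Icc 0 T, ∀ t ∈ Icc 0 T, |G s ω - G t ω| ≤ K * |s - t| ^ β := by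
  have hH : 0 < H := hβ.trans hβH
  set q : ℝ := (1 / 2 : ℝ) ^ β with hq
  have hq0 : 0 < q := by positivity
  have hq1 : q < 1 := Real.rpow_lt_one (by norm_num) (by norm_num) hβ
  -- The bad event of level `n`: some dyadic increment reaches `2 ^ (-β * n)`. Its standard
  -- deviation is of order `2 ^ (-H * n)`, so each tail is doubly exponentially small, which pays
  -- for the `2 ^ n` increments.
  set E : ℕ → Set Ω := fun n => ⋃ i ∈ Finset.range (2 ^ n),
    {ω | q ^ n ≤ |G (T * ((i + 1 : ℕ) / 2 ^ n)) ω - G (T * ((i : ℕ) / 2 ^ n)) ω|}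
  set c : ℝ := 1 / (2 * (C₂ * T ^ (2 * H)))
  set η : ℝ := 2 * (H - β)
  have hη : 0 < η := by simp only [η]; linarith
  have hmem : ∀ n i : ℕ, i ≤ 2 ^ n → T * ((i : ℕ) / 2 ^ n) ∈ Icc 0 T := by
    intro n i hi
    have h1 : ((i : ℕ) : ℝ) / 2 ^ n ≤ 1 := (div_le_one (by positivity)).2 (by exact_mod_cast hi)
    exact ⟨by positivity, by nlinarith⟩
  have hE : ∀ n, P (E n) ≤ ENNReal.ofReal ((2 : ℝ) ^ n * (2 * Real.exp (-(c * ((2 : ℝ) ^ η) ^ n)))) := by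
    intro n
    refine (measure_biUnion_finset_le _ _).trans ?_
    have hi : ∀ i ∈ Finset.range (2 ^ n), P {ω | q ^ n ≤ |G (T * ((i + 1 : ℕ) / 2 ^ n)) ω -
        G (T * ((i : ℕ) / 2 ^ n)) ω|} ≤ ENNReal.ofReal (2 * Real.exp (-(c * ((2 : ℝ) ^ η) ^ n))) := by
      intro i hi
      rw [Finset.mem_range] at hi
      have m1 := hmem n (i + 1) hi
      have m0 := hmem n i hi.le
      have hg := (hG.hasGaussianLaw_fun_sub (s := ⟨_, m1⟩) (t := ⟨_, m0⟩))
      have hint : ∀ t ∈ Icc 0 T, Integrable (G t) P := fun t ht =>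
        (hG.hasGaussianLaw_eval ⟨t, ht⟩).integrable
      have h2 := hA _ m0 _ m1
      have e1 : T * (((i + 1 : ℕ) : ℝ) / 2 ^ n) - T * ((i : ℕ) / 2 ^ n) = T * (1 / 2) ^ n := by
        push_cast; rw [one_div, inv_pow]; ring
      rw [e1, abs_of_pos (by positivity)] at h2
      refine (measure_abs_ge_le_of_hasGaussianLaw hg
        (by rw [integral_sub (hint _ m1) (hint _ m0), hG0 _ m1, hG0 _ m0, sub_zero])
        (c := C₂ * (T * (1 / 2) ^ n) ^ (2 * H)) (by positivity) h2 (by positivity)).trans ?_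
      refine ENNReal.ofReal_le_ofReal (le_of_eq ?_)
      congr 2
      have e2 : (T * (1 / 2 : ℝ) ^ n) ^ (2 * H) = T ^ (2 * H) * ((1 / 2 : ℝ) ^ (2 * H)) ^ n := by
        rw [Real.mul_rpow hT.le (by positivity), Real.rpow_pow_comm (by norm_num)]
      have e3 : (q ^ n) ^ 2 = ((1 / 2 : ℝ) ^ (2 * β)) ^ n := by
        rw [← pow_mul, mul_comm n, pow_mul, hq, mul_comm 2 β, Real.rpow_mul (by norm_num)]
        simp
      have e4 : (2 : ℝ) ^ η = (1 / 2 : ℝ) ^ (2 * β) / (1 / 2 : ℝ) ^ (2 * H) := by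
        rw [← Real.rpow_sub (by norm_num), one_div, Real.inv_rpow (by norm_num),
          ← Real.rpow_neg (by norm_num)]
        congr 1; simp only [η]; ring
      rw [e2, e3, e4, div_pow]
      simp only [c]
      field_simp
    refine (Finset.sum_le_sum hi).trans ?_
    rw [Finset.sum_const, Finset.card_range, nsmul_eq_mul, ENNReal.ofReal_mul (by positivity)]
    simp
  have hBC : ∀ᵐ ω ∂P, ∀ᶠ n in Filter.atTop, ω ∉ E n := by
    refine ae_eventually_notMem (ne_top_of_le_ne_top ?_ (ENNReal.tsum_le_tsum hE))
    exact (summable_two_pow_mul_exp (by positivity) hη).tsum_ofReal_ne_top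
  filter_upwards [hBC, hGc] with ω hω hcont
  obtain ⟨N, hN⟩ := Filter.eventually_atTop.1 hω
  obtain ⟨M, hM⟩ := isCompact_Icc.exists_bound_of_continuousOn hcont
  have hM0 : 0 ≤ M := (norm_nonneg _).trans (hM 0 ⟨le_rfl, hT.le⟩)
  -- The summand `2 * M / q ^ N` takes care of the finitely many levels below `N`, using only that
  -- the path is bounded by `M`.
  refine exists_holder_of_dyadic (C := 1 + 2 * M / q ^ N) hT hβ (by positivity) hcont
    fun n i hi => ?_
  rcases le_or_gt N n with hn | hn
  · have := hN n hn
    simp only [E, mem_iUnion, mem_ofPred_eq, Finset.mem_range, not_exists, not_le] at this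
    calc _ ≤ 1 * q ^ n := by rw [one_mul]; exact (this i hi).le
      _ ≤ _ := by gcongr; simp; positivity
  · have m1 := hM _ (hmem n (i + 1) hi)
    have m0 := hM _ (hmem n i hi.le)
    rw [Real.norm_eq_abs] at m1 m0
    have hqq : q ^ N ≤ q ^ n := pow_le_pow_of_le_one hq0.le hq1.le hn.le
    calc _ ≤ M + M := (abs_sub _ _).trans (add_le_add m1 m0)
      _ = 2 * M / q ^ N * q ^ N := by field_simp; ring
      _ ≤ 2 * M / q ^ N * q ^ n := by gcongr
      _ ≤ _ := by gcongr; simp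

/-- Lower deviations of the sum of `1 - cos` of normalized increments over a uniform grid. -/
theorem measure_grid_lt {Ω : Type*} {mΩ : MeasurableSpace Ω} {P : Measure Ω}
    [IsProbabilityMeasure P] {T H C₁ C₂ : ℝ} (hC₁ : 0 < C₁)
    {G : ℝ → Ω → ℝ} (hG : IsGaussianProcess (fun t : Icc (0 : ℝ) T => G t) P)
    (hG0 : ∀ t ∈ Icc (0 : ℝ) T, ∫ ω, G t ω ∂P = 0)
    (hA₁ : ∀ s ∈ Icc (0 : ℝ) T, ∀ t ∈ Icc (0 : ℝ) T,
      C₁ * |t - s| ^ (2 * H) ≤ ∫ ω, (G t ω - G s ω) ^ 2 ∂P)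
    (hA₂ : ∀ s ∈ Icc (0 : ℝ) T, ∀ t ∈ Icc (0 : ℝ) T,
      ∫ ω, (G t ω - G s ω) ^ 2 ∂P ≤ C₂ * |t - s| ^ (2 * H))
    (hB : ∀ s₁ t₁ s₂ t₂ : ℝ, 0 ≤ s₁ → s₁ ≤ t₁ → t₁ ≤ s₂ → s₂ ≤ t₂ → t₂ ≤ T →
      0 ≤ ∫ ω, (G t₁ ω - G s₁ ω) * (G t₂ ω - G s₂ ω) ∂P)
    {a l : ℝ} {N : ℕ} (ha : 0 ≤ a) (hl : 0 < l) (hN : 0 < N) (hT : a + N * l ≤ T) :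
    P {ω | ∑ k ∈ Finset.range N,
        (1 - Real.cos ((G (a + (k + 1 : ℕ) * l) ω - G (a + (k : ℕ) * l) ω) / l ^ H)) <
          N * (1 - Real.exp (-C₁ / 2)) / 2} ≤
      ENNReal.ofReal (C₂ * (N : ℝ) ^ (2 * H) / (N * (1 - Real.exp (-C₁ / 2)) / 2) ^ 2) := by
  have hlH : 0 < l ^ H := Real.rpow_pos_of_pos hl _
  have hl2 : l ^ (2 * H) = l ^ H * l ^ H := by rw [two_mul, Real.rpow_add hl]
  have hp : ∀ k : ℕ, a + (min k N : ℕ) * l ∈ Icc 0 T := by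
    intro k
    have h1 : ((min k N : ℕ) : ℝ) ≤ N := by exact_mod_cast min_le_right k N
    exact ⟨by positivity, le_trans (by gcongr) hT⟩
  -- Indices are capped at `N` so that the increments form a process over all of `ℕ` without leaving
  -- `[0, T]`; beyond `N` they vanish.
  set p : ℕ → Icc (0 : ℝ) T := fun k => ⟨a + (min k N : ℕ) * l, hp k⟩ with hpdef
  have hpv : ∀ k ≤ N, (p k : ℝ) = a + (k : ℕ) * l := fun k hk => by
    simp only [hpdef]; rw [min_eq_left hk]
  set X : ℕ → Ω → ℝ := fun k ω => (l ^ H)⁻¹ • (G (p (k + 1)) ω - G (p k) ω) with hXdef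
  have hX : IsGaussianProcess X P :=
    ((isGaussianProcess_increments hG).comp_right fun k : ℕ => (p (k + 1), p k)).smul
      fun _ => (l ^ H)⁻¹
  have hint : ∀ k, Integrable (G (p k)) P := fun k => (hG.hasGaussianLaw_eval (p k)).integrable
  have hpmono : ∀ j k : ℕ, j ≤ k → (p j : ℝ) ≤ p k := by
    intro j k hjk
    have : ((min j N : ℕ) : ℝ) ≤ (min k N : ℕ) := by exact_mod_cast min_le_min_right N hjk
    simp only [hpdef]; gcongr
  have hXX : ∀ j k, ∫ ω, X j ω * X k ω ∂P = ((l ^ H)⁻¹ * (l ^ H)⁻¹) *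
      ∫ ω, (G (p (j + 1)) ω - G (p j) ω) * (G (p (k + 1)) ω - G (p k) ω) ∂P := by
    intro j k
    rw [← integral_const_mul]
    congr 1; ext ω; simp only [hXdef, smul_eq_mul]; ring
  have hcov : ∀ j k, j ≤ k → 0 ≤ ∫ ω, X j ω * X k ω ∂P := by
    intro j k hjk
    rcases hjk.eq_or_lt with rfl | hlt
    · exact integral_nonneg fun ω => mul_self_nonneg _
    · rw [hXX]
      exact mul_nonneg (by positivity) (hB _ _ _ _ (hp j).1 (hpmono _ _ (by omega))
        (hpmono _ _ (by omega)) (hpmono _ _ (by omega)) (hp (k + 1)).2)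
  have hsum : ∀ ω, ∑ k ∈ Finset.range N, X k ω = (l ^ H)⁻¹ * (G (p N) ω - G (p 0) ω) := by
    intro ω
    simp only [hXdef, smul_eq_mul]
    rw [← Finset.mul_sum, Finset.sum_range_sub fun k => G (p k) ω]
  have key := measure_sum_one_sub_cos_lt hX (fun k => ?_) hN (fun j _ k _ => ?_) hC₁
    (fun k hk => ?_) (V := C₂ * (N : ℝ) ^ (2 * H)) ?_
  · refine le_trans (le_of_eq ?_) key
    congr 1; ext ω
    simp only [mem_ofPred_eq]
    rw [Finset.sum_congr rfl fun k hk => ?_]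
    have hk' := Finset.mem_range.1 hk
    simp only [hXdef, smul_eq_mul]
    rw [hpv k hk'.le, hpv (k + 1) hk', inv_mul_eq_div]
  · simp only [hXdef, smul_eq_mul]
    rw [integral_const_mul, integral_sub (hint _) (hint _), hG0 _ (hp _), hG0 _ (hp _)]
    simp
  · rcases le_total j k with h | h
    · exact hcov j k h
    · simp_rw [mul_comm (X j _)]; exact hcov k j h
  · have h1 := hA₁ _ (hp k) _ (hp (k + 1))
    have e1 : (p (k + 1) : ℝ) - p k = l := by
      rw [hpv k hk.le, hpv (k + 1) hk]; push_cast; ring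
    change C₁ * |(p (k + 1) : ℝ) - p k| ^ (2 * H) ≤
      ∫ ω, (G (p (k + 1)) ω - G (p k) ω) ^ 2 ∂P at h1
    rw [e1, abs_of_pos hl, hl2] at h1
    simp_rw [sq] at h1 ⊢
    rw [hXX, ← mul_inv, inv_mul_eq_div, le_div_iff₀ (by positivity)]
    exact h1
  -- The sum telescopes to one increment over length `N * l`; normalization cancels `l ^ (2 * H)`
  -- and leaves `C₂ * N ^ (2 * H)`.
  · simp_rw [hsum, mul_pow]
    rw [integral_const_mul]
    have h1 := hA₂ _ (hp 0) _ (hp N)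
    have e1 : (p N : ℝ) - p 0 = N * l := by
      rw [hpv 0 (by omega), hpv N le_rfl]; push_cast; ring
    change ∫ ω, (G (p N) ω - G (p 0) ω) ^ 2 ∂P ≤ C₂ * |(p N : ℝ) - p 0| ^ (2 * H) at h1
    rw [e1, abs_of_nonneg (by positivity), Real.mul_rpow (by positivity) hl.le, hl2] at h1
    rw [inv_pow, inv_mul_eq_div, div_le_iff₀ (by positivity), sq (l ^ H)]
    linarith

/-! ### The tracking strategy -/

/-- Direction of the next move: none if the initial error `|z - v|` is at most `θ`, otherwise
from the current value `w` towards `z`. -/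
noncomputable def direction (θ z v w : ℝ) : ℝ :=
  if θ < |z - v| then (if 0 ≤ z - w then 1 else -1) else 0

lemma abs_direction_le (θ z v w : ℝ) : |direction θ z v w| ≤ 1 := by
  unfold direction; split_ifs <;> simp

lemma direction_of_le {θ z v w : ℝ} (h : |z - v| ≤ θ) : direction θ z v w = 0 := by
  simp [direction, not_lt.2 h]

/-- Values inside a block started at `v`, moving by the gains `F` towards `z`. -/
noncomputable def blockValue (θ z v : ℝ) (F : ℕ → ℝ) : ℕ → ℝ
  | 0 => v
  | k + 1 => blockValue θ z v F k + direction θ z v (blockValue θ z v F k) * F k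

lemma blockValue_of_le {θ z v : ℝ} (F : ℕ → ℝ) (h : |z - v| ≤ θ) (k : ℕ) :
    blockValue θ z v F k = v := by
  induction k with
  | zero => rfl
  | succ k ih => rw [blockValue, direction_of_le h, ih]; simp

/-- A step either shortens the error by the full gain or overshoots the target by at most one gain,
and an error already within `2 * a` stays there. -/
lemma abs_sub_blockValue_le {θ z v a : ℝ} {F : ℕ → ℝ} (h : θ < |z - v|) (hF0 : ∀ k, 0 ≤ F k)
    (hFa : ∀ k, F k ≤ 2 * a) (k : ℕ) : |z - blockValue θ z v F k| ≤
      max (|z - v| - ∑ i ∈ Finset.range k, F i) (2 * a) := by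
  induction k with
  | zero => simp [blockValue]
  | succ k ih =>
    have h0 := hF0 k
    have h1 := hFa k
    rw [blockValue, Finset.sum_range_succ, direction, if_pos h]
    set w := blockValue θ z v F k
    have hstep : |z - (w + (if 0 ≤ z - w then 1 else -1) * F k)| ≤ max (|z - w| - F k) (2 * a) := by
      split_ifs with hw
      · rw [abs_of_nonneg hw]
        rcases le_total (F k) (z - w) with h2 | h2
        · rw [abs_of_nonneg (by linarith)]
          exact le_max_of_le_left (by linarith)
        · rw [abs_of_nonpos (by linarith)]
          exact le_max_of_le_right (by linarith)
      · have hw' : z - w < 0 := not_le.1 hw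
        rw [abs_of_neg hw']
        rcases le_total (F k) (-(z - w)) with h2 | h2
        · rw [abs_of_nonpos (by linarith)]
          exact le_max_of_le_left (by linarith)
        · rw [abs_of_nonneg (by linarith)]
          exact le_max_of_le_right (by linarith)
    refine hstep.trans (max_le ?_ (le_max_right _ _))
    rcases le_max_iff.1 ih with h2 | h2
    · exact le_max_of_le_left (by linarith)
    · exact le_max_of_le_right (by linarith)

/-- Values at the block ends. -/
noncomputable def trackValue (θ ζ : ℕ → ℝ) (F : ℕ → ℕ → ℝ) (N : ℕ → ℕ) : ℕ → ℝ
  | 0 => 0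
  | n + 1 => blockValue (θ n) (ζ n) (trackValue θ ζ F N n) (F n) (N n)

/-- The coefficients in front of the gains. -/
noncomputable def trackCoef (θ ζ : ℕ → ℝ) (F : ℕ → ℕ → ℝ) (N : ℕ → ℕ) (n k : ℕ) : ℝ :=
  direction (θ n) (ζ n) (trackValue θ ζ F N n)
    (blockValue (θ n) (ζ n) (trackValue θ ζ F N n) (F n) k)

lemma blockValue_eq_sum (θ z v : ℝ) (F : ℕ → ℝ) (k : ℕ) : blockValue θ z v F k =
    v + ∑ i ∈ Finset.range k, direction θ z v (blockValue θ z v F i) * F i := by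
  induction k with
  | zero => simp [blockValue]
  | succ k ih => rw [blockValue, Finset.sum_range_succ, ← add_assoc, ← ih]

/-- Identifies the tracked values with partial sums of the series that represents the integral. -/
lemma trackValue_eq_sum (θ ζ : ℕ → ℝ) (F : ℕ → ℕ → ℝ) (N : ℕ → ℕ) (n : ℕ) :
    trackValue θ ζ F N n =
      ∑ m ∈ Finset.range n, ∑ k ∈ Finset.range (N m), trackCoef θ ζ F N m k * F m k := by
  induction n with
  | zero => simp [trackValue]
  | succ n ih => rw [trackValue, blockValue_eq_sum, Finset.sum_range_succ, ← ih]; rfl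

lemma measurable_direction {Ω : Type*} [MeasurableSpace Ω] (θ : ℝ) {z v w : Ω → ℝ}
    (hz : Measurable z) (hv : Measurable v) (hw : Measurable w) :
    Measurable fun ω => direction θ (z ω) (v ω) (w ω) := by
  unfold direction
  refine Measurable.ite (measurableSet_lt measurable_const (by fun_prop)) ?_ measurable_const
  exact Measurable.ite (measurableSet_le measurable_const (by fun_prop)) measurable_const
    measurable_const

/-- Here `m k` is the information at the start of piece `k`. The gain of that piece is known only at
its end, but its coefficient uses earlier gains alone, so no anticipation occurs. -/
lemma measurable_blockValue {Ω : Type*} {m : ℕ → MeasurableSpace Ω} {N : ℕ}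
    (hm : ∀ k < N, m k ≤ m (k + 1)) (θ : ℝ) {z v : Ω → ℝ} {F : ℕ → Ω → ℝ}
    (hz : Measurable[m 0] z) (hv : Measurable[m 0] v)
    (hF : ∀ k < N, Measurable[m (k + 1)] (F k)) : ∀ k ≤ N,
      Measurable[m k] (fun ω => blockValue θ (z ω) (v ω) (fun i => F i ω) k) ∧
      Measurable[m k] (fun ω => direction θ (z ω) (v ω)
        (blockValue θ (z ω) (v ω) (fun i => F i ω) k)) := by
  have hm0 : ∀ k ≤ N, m 0 ≤ m k := by
    intro k
    induction k with
    | zero => exact fun _ => le_rfl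
    | succ k ih => exact fun hk => (ih (by omega)).trans (hm k hk)
  intro k
  induction k with
  | zero => exact fun _ => ⟨hv, @measurable_direction Ω (m 0) θ _ _ _ hz hv hv⟩
  | succ k ih =>
    intro hk
    obtain ⟨h1, h2⟩ := ih (by omega)
    have hle := hm k hk
    have h3 : Measurable[m (k + 1)]
        (fun ω => blockValue θ (z ω) (v ω) (fun i => F i ω) (k + 1)) := by
      have h4 := (h1.mono hle le_rfl).add ((h2.mono hle le_rfl).mul (hF k hk))
      exact h4
    exact ⟨h3, @measurable_direction Ω (m (k + 1)) θ _ _ _ (hz.mono (hm0 _ hk) le_rfl)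
      (hv.mono (hm0 _ hk) le_rfl) h3⟩

lemma measurable_trackValue {Ω : Type*} {m : ℕ → ℕ → MeasurableSpace Ω} {N : ℕ → ℕ}
    (hm : ∀ n, ∀ k < N n, m n k ≤ m n (k + 1)) (hmn : ∀ n, m n (N n) ≤ m (n + 1) 0)
    (θ : ℕ → ℝ) {ζ : ℕ → Ω → ℝ} {F : ℕ → ℕ → Ω → ℝ}
    (hz : ∀ n, Measurable[m n 0] (ζ n)) (hF : ∀ n, ∀ k < N n, Measurable[m n (k + 1)] (F n k))
    (n : ℕ) :
    Measurable[m n 0] fun ω => trackValue θ (fun i => ζ i ω) (fun i j => F i j ω) N n := by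
  induction n with
  | zero => exact @measurable_const _ _ _ (m 0 0) _
  | succ n ih =>
    exact (measurable_blockValue (hm n) (θ n) (hz n) ih (hF n) (N n) le_rfl).1.mono (hmn n) le_rfl

lemma measurable_trackCoef {Ω : Type*} {m : ℕ → ℕ → MeasurableSpace Ω} {N : ℕ → ℕ}
    (hm : ∀ n, ∀ k < N n, m n k ≤ m n (k + 1)) (hmn : ∀ n, m n (N n) ≤ m (n + 1) 0)
    (θ : ℕ → ℝ) {ζ : ℕ → Ω → ℝ} {F : ℕ → ℕ → Ω → ℝ}
    (hz : ∀ n, Measurable[m n 0] (ζ n)) (hF : ∀ n, ∀ k < N n, Measurable[m n (k + 1)] (F n k))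
    (n k : ℕ) (hk : k ≤ N n) :
    Measurable[m n k] fun ω => trackCoef θ (fun i => ζ i ω) (fun i j => F i j ω) N n k :=
  (measurable_blockValue (hm n) (θ n) (hz n) (measurable_trackValue hm hmn θ hz hF n) (hF n) k hk).2

/-- Convergence of the tracking error. At odd times the gains are large and the threshold is
positive, at even times the gains are just sufficient and the threshold vanishes. -/
theorem tendsto_tracking_error {D a c S Λ θ : ℕ → ℝ} (hD : ∀ n, 0 ≤ D n) (ha : ∀ n, 0 ≤ a n)
    (hc : ∀ n, 0 ≤ c n) (hS : ∀ n, 0 ≤ S n) (has : Summable a) (hcs : Summable c)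
    (hact : ∀ n, θ n < D n → D (n + 1) ≤ c n + max (D n - S n) (2 * a n))
    (hina : ∀ n, D n ≤ θ n → D (n + 1) ≤ c n + D n)
    (hSΛ : ∀ᶠ n in Filter.atTop, Λ n ≤ S n)
    (hΛ : Filter.Tendsto (fun m => Λ (2 * m + 1)) Filter.atTop Filter.atTop)
    (hθe : ∀ m, θ (2 * m) = 0) (hθ0 : ∀ m, 0 ≤ θ (2 * m + 1))
    (hθ : Filter.Tendsto (fun m => θ (2 * m + 1)) Filter.atTop (nhds 0))
    (h1 : ∀ᶠ m in Filter.atTop,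
      θ (2 * m + 1) + c (2 * m + 1) + 2 * a (2 * m + 1) ≤ Λ (2 * m + 2))
    (h2 : ∀ᶠ m in Filter.atTop, c (2 * m + 2) + 2 * a (2 * m + 2) ≤ θ (2 * m + 3)) :
    Filter.Tendsto D Filter.atTop (nhds 0) ∧
      ∀ᶠ m in Filter.atTop, D (2 * m + 1) ≤ θ (2 * m + 1) := by
  -- Even in blocks with insufficient gain the error grows by a summable amount only, so it stays
  -- below a finite bound `B` that a single odd block eventually exceeds.
  have hstep : ∀ n, D (n + 1) ≤ D n + (c n + 2 * a n) := by
    intro n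
    have := ha n
    have := hD n
    rcases le_or_gt (D n) (θ n) with h | h
    · linarith [hina n h]
    · have h3 : max (D n - S n) (2 * a n) ≤ D n + 2 * a n :=
        max_le (by linarith [hS n]) (by linarith)
      linarith [hact n h]
  have hsum : Summable fun n => c n + 2 * a n := hcs.add (has.mul_left 2)
  set B := D 0 + ∑' n, (c n + 2 * a n)
  have hB : ∀ n, D n ≤ B := by
    intro n
    have h3 : D n ≤ D 0 + ∑ i ∈ Finset.range n, (c i + 2 * a i) := by
      induction n with
      | zero => simp
      | succ n ih => rw [Finset.sum_range_succ]; linarith [hstep n]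
    have h4 := hsum.sum_le_tsum (Finset.range n) fun i _ => by
      have := ha i; have := hc i; positivity
    linarith
  have hodd : Filter.Tendsto (fun m : ℕ => 2 * m + 1) Filter.atTop Filter.atTop :=
    Filter.tendsto_atTop_mono (fun m => by simp only [id]; omega) Filter.tendsto_id
  have heven : Filter.Tendsto (fun m : ℕ => 2 * m + 2) Filter.atTop Filter.atTop :=
    Filter.tendsto_atTop_mono (fun m => by simp only [id]; omega) Filter.tendsto_id
  -- One odd–even cycle: the odd block leaves at most its threshold plus small terms, the even block
  -- has enough gain to erase that, and what remains lies below the next odd threshold.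
  have hev : ∀ᶠ m in Filter.atTop,
      D (2 * m + 2) ≤ θ (2 * m + 1) + c (2 * m + 1) + 2 * a (2 * m + 1) ∧
      D (2 * m + 3) ≤ c (2 * m + 2) + 2 * a (2 * m + 2) ∧ D (2 * m + 3) ≤ θ (2 * m + 3) := by
    filter_upwards [hΛ.eventually_ge_atTop B, hodd.eventually hSΛ, heven.eventually hSΛ, h1, h2]
      with m hm1 hm2 hm3 hm4 hm5
    have hn1 : D (2 * m + 2) ≤ θ (2 * m + 1) + c (2 * m + 1) + 2 * a (2 * m + 1) := by
      have := ha (2 * m + 1)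
      rcases le_or_gt (D (2 * m + 1)) (θ (2 * m + 1)) with h | h
      · linarith [hina _ h]
      · have h3 : max (D (2 * m + 1) - S (2 * m + 1)) (2 * a (2 * m + 1)) ≤ 2 * a (2 * m + 1) :=
          max_le (by linarith [hB (2 * m + 1)]) le_rfl
        linarith [hact _ h, hθ0 m]
    have hn2 : D (2 * m + 3) ≤ c (2 * m + 2) + 2 * a (2 * m + 2) := by
      have := ha (2 * m + 2)
      have e0 : θ (2 * m + 2) = 0 := hθe (m + 1)
      rcases le_or_gt (D (2 * m + 2)) (θ (2 * m + 2)) with h | h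
      · linarith [hina _ h]
      · have h3 : max (D (2 * m + 2) - S (2 * m + 2)) (2 * a (2 * m + 2)) ≤ 2 * a (2 * m + 2) :=
          max_le (by linarith) le_rfl
        linarith [hact _ h]
    exact ⟨hn1, hn2, hn2.trans hm5⟩
  have ha0 := has.tendsto_atTop_zero
  have hc0 := hcs.tendsto_atTop_zero
  have hDe : Filter.Tendsto (fun m => D (2 * m + 2)) Filter.atTop (nhds 0) := by
    refine squeeze_zero' (Filter.Eventually.of_forall fun m => hD _) (hev.mono fun m hm => hm.1) ?_
    simpa using (hθ.add (hc0.comp hodd)).add ((ha0.comp hodd).const_mul 2)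
  have hDo : Filter.Tendsto (fun m => D (2 * m + 3)) Filter.atTop (nhds 0) := by
    refine squeeze_zero' (Filter.Eventually.of_forall fun m => hD _) (hev.mono fun m hm => hm.2.1) ?_
    simpa using (hc0.comp heven).add ((ha0.comp heven).const_mul 2)
  constructor
  · rw [Metric.tendsto_atTop]
    intro ε hε
    obtain ⟨M₁, hM₁⟩ := Metric.tendsto_atTop.1 hDe ε hε
    obtain ⟨M₂, hM₂⟩ := Metric.tendsto_atTop.1 hDo ε hε
    refine ⟨2 * (M₁ + M₂) + 3, fun n hn => ?_⟩
    rcases Nat.even_or_odd' n with ⟨k, rfl | rfl⟩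
    · obtain ⟨j, rfl⟩ : ∃ j, k = j + 1 := ⟨k - 1, by omega⟩
      exact hM₁ j (by omega)
    · obtain ⟨j, rfl⟩ : ∃ j, k = j + 1 := ⟨k - 1, by omega⟩
      exact hM₂ j (by omega)
  · obtain ⟨M, hM⟩ := Filter.eventually_atTop.1 hev
    refine Filter.eventually_atTop.2 ⟨M + 1, fun m hm => ?_⟩
    obtain ⟨j, rfl⟩ : ∃ j, m = j + 1 := ⟨m - 1, by omega⟩
    exact (hM j (by omega)).2.2

/-! ### Partitions of `[0, T)` into blocks of geometrically decreasing length -/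

/-- Left end of the `n`-th block. -/
noncomputable def blockTime (T : ℝ) (n : ℕ) : ℝ := T * (1 - (1 / 2) ^ n)

/-- Mesh of the `n`-th block, divided into `N n` pieces. -/
noncomputable def mesh (T : ℝ) (N : ℕ → ℕ) (n : ℕ) : ℝ := T * (1 / 2) ^ (n + 1) / N n

/-- Partition points of the `n`-th block. -/
noncomputable def gridPt (T : ℝ) (N : ℕ → ℕ) (n k : ℕ) : ℝ := blockTime T n + (k : ℕ) * mesh T N n

section Grid

variable {T : ℝ} {N : ℕ → ℕ}

lemma mesh_pos (hT : 0 < T) (hN : ∀ n, 0 < N n) (n : ℕ) : 0 < mesh T N n := by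
  have : (0 : ℝ) < N n := Nat.cast_pos.2 (hN n)
  unfold mesh; positivity

lemma mul_mesh (hN : ∀ n, 0 < N n) (n : ℕ) : N n * mesh T N n = T * (1 / 2) ^ (n + 1) := by
  have : (N n : ℝ) ≠ 0 := Nat.cast_ne_zero.2 (hN n).ne'
  unfold mesh; field_simp

lemma blockTime_mem (hT : 0 < T) (n : ℕ) : blockTime T n ∈ Icc 0 T := by
  have h1 : (1 / 2 : ℝ) ^ n ≤ 1 := pow_le_one₀ (by norm_num) (by norm_num)
  have h2 : (0 : ℝ) < (1 / 2 : ℝ) ^ n := by positivity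
  constructor <;> unfold blockTime <;> nlinarith

lemma blockTime_succ_sub (n : ℕ) : blockTime T (n + 1) - blockTime T n = T * (1 / 2) ^ (n + 1) := by
  unfold blockTime; rw [pow_succ]; ring

lemma blockTime_mono (hT : 0 < T) {m n : ℕ} (h : m ≤ n) : blockTime T m ≤ blockTime T n := by
  have := pow_le_pow_of_le_one (show (0 : ℝ) ≤ 1 / 2 by norm_num) (by norm_num) h
  unfold blockTime; gcongr

lemma tendsto_blockTime : Filter.Tendsto (blockTime T) Filter.atTop (nhds T) := by
  have := ((tendsto_pow_atTop_nhds_zero_of_lt_one (show (0 : ℝ) ≤ 1 / 2 by norm_num)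
    (by norm_num)).const_sub 1).const_mul T
  rw [sub_zero, mul_one] at this
  exact this

lemma gridPt_zero (n : ℕ) : gridPt T N n 0 = blockTime T n := by simp [gridPt]

lemma gridPt_last (hN : ∀ n, 0 < N n) (n : ℕ) : gridPt T N n (N n) = blockTime T (n + 1) := by
  rw [gridPt, mul_mesh hN, ← blockTime_succ_sub]; ring

lemma gridPt_succ_sub (n k : ℕ) : gridPt T N n (k + 1) - gridPt T N n k = mesh T N n := by
  simp only [gridPt]; push_cast; ring

lemma gridPt_mono (hT : 0 < T) (hN : ∀ n, 0 < N n) (n : ℕ) {j k : ℕ} (h : j ≤ k) :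
    gridPt T N n j ≤ gridPt T N n k := by
  have := mesh_pos hT hN n
  unfold gridPt; gcongr

lemma gridPt_mem (hT : 0 < T) (hN : ∀ n, 0 < N n) {n k : ℕ} (hk : k ≤ N n) :
    gridPt T N n k ∈ Icc 0 T := by
  constructor
  · exact (blockTime_mem hT n).1.trans ((gridPt_zero n).symm.le.trans
      (gridPt_mono hT hN n (Nat.zero_le k)))
  · exact (gridPt_mono hT hN n hk).trans ((gridPt_last hN n).le.trans (blockTime_mem hT _).2)

lemma gridPt_le_of_lt (hT : 0 < T) (hN : ∀ n, 0 < N n) {m n j k : ℕ} (hj : j < N m) (h : m < n) :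
    gridPt T N m (j + 1) ≤ gridPt T N n k :=
  calc _ ≤ gridPt T N m (N m) := gridPt_mono hT hN m hj
    _ = blockTime T (m + 1) := gridPt_last hN m
    _ ≤ blockTime T n := blockTime_mono hT h
    _ = gridPt T N n 0 := (gridPt_zero n).symm
    _ ≤ _ := gridPt_mono hT hN n (Nat.zero_le k)

/-- The piece of the partition with a given index. -/
def piece (T : ℝ) (N : ℕ → ℕ) (i : Σ n, Fin (N n)) : Set ℝ :=
  Ico (gridPt T N i.1 i.2) (gridPt T N i.1 (i.2 + 1))

lemma notMem_piece_of_ne (hT : 0 < T) (hN : ∀ n, 0 < N n) {i j : Σ n, Fin (N n)} (hij : j ≠ i) {t : ℝ}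
    (ht : t ∈ piece T N i) : t ∉ piece T N j := by
  intro ht'
  obtain ⟨n, k⟩ := i
  obtain ⟨m, l⟩ := j
  obtain ⟨h1, h2⟩ := ht
  obtain ⟨h3, h4⟩ := ht'
  simp only at h1 h2 h3 h4
  rcases lt_trichotomy m n with h | rfl | h
  · linarith [gridPt_le_of_lt (k := k) hT hN l.2 h]
  · rcases lt_trichotomy l k with h | rfl | h
    · linarith [gridPt_mono hT hN m (show (l : ℕ) + 1 ≤ k from h)]
    · exact hij rfl
    · linarith [gridPt_mono hT hN m (show (k : ℕ) + 1 ≤ l from h)]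
  · linarith [gridPt_le_of_lt (k := l) hT hN k.2 h]

end Grid

/-! ### Asymptotics -/

lemma two_rpow_mul_natCast (x : ℝ) (n : ℕ) : (2 : ℝ) ^ (x * n) = ((2 : ℝ) ^ x) ^ n := by
  rw [Real.rpow_mul (by norm_num), Real.rpow_natCast]

lemma summable_two_rpow {x : ℝ} (hx : x < 0) : Summable fun n : ℕ => (2 : ℝ) ^ (x * n) := by
  simp_rw [two_rpow_mul_natCast]
  exact summable_geometric_of_lt_one (by positivity)
    (Real.rpow_lt_one_of_one_lt_of_neg (by norm_num) hx)

lemma eventually_two_rpow_le {x y c : ℝ} (C : ℝ) (hxy : x < y) (hc : 0 < c) :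
    ∀ᶠ n : ℕ in Filter.atTop, C * (2 : ℝ) ^ (x * n) ≤ c * (2 : ℝ) ^ (y * n) := by
  have h := ((summable_two_rpow (sub_neg.2 hxy)).tendsto_atTop_zero.const_mul C)
  rw [mul_zero] at h
  filter_upwards [h.eventually (gt_mem_nhds hc)] with n hn
  have e : (2 : ℝ) ^ (x * n) = (2 : ℝ) ^ ((x - y) * n) * (2 : ℝ) ^ (y * n) := by
    rw [← Real.rpow_add (by norm_num)]; ring_nf
  rw [e, ← mul_assoc]
  gcongr

lemma two_rpow_le {x y : ℝ} (hxy : x ≤ y) (n : ℕ) : (2 : ℝ) ^ (x * n) ≤ (2 : ℝ) ^ (y * n) :=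
  Real.rpow_le_rpow_of_exponent_le (by norm_num) (by gcongr)

/-- Number of pieces in a block, growing like `2 ^ (lam n * n)`. -/
noncomputable def pieceCount (lam : ℕ → ℝ) (n : ℕ) : ℕ := ⌈(2 : ℝ) ^ (lam n * n)⌉₊

section Asymptotics

variable {T : ℝ} {lam : ℕ → ℝ}

lemma pieceCount_pos (lam : ℕ → ℝ) (n : ℕ) : 0 < pieceCount lam n :=
  Nat.ceil_pos.2 (by positivity)

lemma le_pieceCount (lam : ℕ → ℝ) (n : ℕ) : (2 : ℝ) ^ (lam n * n) ≤ pieceCount lam n :=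
  Nat.le_ceil _

lemma pieceCount_le {n : ℕ} (h : 0 ≤ lam n) : (pieceCount lam n : ℝ) ≤ 2 * (2 : ℝ) ^ (lam n * n) := by
  have h1 : (1 : ℝ) ≤ (2 : ℝ) ^ (lam n * n) := Real.one_le_rpow (by norm_num) (by positivity)
  have := Nat.ceil_lt_add_one (show 0 ≤ (2 : ℝ) ^ (lam n * n) by positivity)
  unfold pieceCount
  linarith

lemma half_pow_succ (T : ℝ) (n : ℕ) : T * (1 / 2) ^ (n + 1) = T / 2 * (2 : ℝ) ^ (-1 * (n : ℝ)) := by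
  rw [two_rpow_mul_natCast, pow_succ, Real.rpow_neg_one, one_div]; ring

lemma mesh_le (hT : 0 < T) (n : ℕ) :
    mesh T (pieceCount lam) n ≤ T / 2 * (2 : ℝ) ^ (-(1 + lam n) * n) := by
  have h1 := le_pieceCount lam n
  have h2 : (0 : ℝ) < (2 : ℝ) ^ (lam n * n) := by positivity
  rw [mesh, half_pow_succ]
  calc _ ≤ T / 2 * (2 : ℝ) ^ (-1 * (n : ℝ)) / (2 : ℝ) ^ (lam n * n) := by gcongr
    _ = _ := by rw [mul_div_assoc, ← Real.rpow_sub (by norm_num)]; ring_nf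

lemma le_mesh (hT : 0 < T) {n : ℕ} (h : 0 ≤ lam n) :
    T / 4 * (2 : ℝ) ^ (-(1 + lam n) * n) ≤ mesh T (pieceCount lam) n := by
  have h1 := pieceCount_le h
  have h2 : (0 : ℝ) < (2 : ℝ) ^ (lam n * n) := by positivity
  have h3 : (0 : ℝ) < pieceCount lam n := Nat.cast_pos.2 (pieceCount_pos lam n)
  rw [mesh, half_pow_succ]
  calc _ = T / 2 * (2 : ℝ) ^ (-1 * (n : ℝ)) / (2 * (2 : ℝ) ^ (lam n * n)) := by
        have : (2 : ℝ) ^ (-(1 + lam n) * n) = (2 : ℝ) ^ (-1 * (n : ℝ)) / (2 : ℝ) ^ (lam n * n) := by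
          rw [← Real.rpow_sub (by norm_num)]; ring_nf
        rw [this]; field_simp; ring
    _ ≤ _ := by gcongr

lemma mesh_rpow_le {H ρ : ℝ} (hT : 0 < T) {n : ℕ} (h : 0 ≤ lam n) (hH : 0 ≤ H) (hρ : ρ ≤ H) :
    mesh T (pieceCount lam) n ^ H ≤ (T / 2) ^ H * (2 : ℝ) ^ (-ρ * n) := by
  have h0 := mesh_pos hT (pieceCount_pos lam) n
  calc _ ≤ (T / 2 * (2 : ℝ) ^ (-(1 + lam n) * n)) ^ H := Real.rpow_le_rpow h0.le (mesh_le hT n) hH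
    _ = (T / 2) ^ H * (2 : ℝ) ^ (-(1 + lam n) * H * n) := by
      rw [Real.mul_rpow (by positivity) (by positivity), ← Real.rpow_mul (by norm_num)]; ring_nf
    _ ≤ _ := by
      gcongr 1
      exact two_rpow_le (by nlinarith) n

/-- The scale of the total gain in a block. It decays or grows according to whether `(1 + lam n) *
(1 - H)` is below or above `1`. -/
lemma le_mesh_rpow_mul {H : ℝ} (hT : 0 < T) {n : ℕ} (h : 0 ≤ lam n) (hH : 0 ≤ H) :
    (T / 4) ^ H * (2 : ℝ) ^ (((1 + lam n) * (1 - H) - 1) * n) ≤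
      mesh T (pieceCount lam) n ^ H * pieceCount lam n := by
  have h0 := mesh_pos hT (pieceCount_pos lam) n
  calc _ = (T / 4 * (2 : ℝ) ^ (-(1 + lam n) * n)) ^ H * (2 : ℝ) ^ (lam n * n) := by
        rw [Real.mul_rpow (by positivity) (by positivity), ← Real.rpow_mul (by norm_num), mul_assoc,
          ← Real.rpow_add (by norm_num)]
        ring_nf
    _ ≤ _ := by
      gcongr
      · exact le_mesh hT h
      · exact le_pieceCount lam n

/-- Serves to bound the fractional-norm cost of a block, which has the same form with `x` slightly
above `1 - H`. -/
lemma pieceCount_mul_mesh_rpow_le {x : ℝ} (hT : 0 < T) {n : ℕ} (h : 0 ≤ lam n) (hx : 0 ≤ x) :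
    pieceCount lam n * mesh T (pieceCount lam) n ^ (1 - x) ≤
      T / 2 * (T / 4) ^ (-x) * (2 : ℝ) ^ (((1 + lam n) * x - 1) * n) := by
  have h0 := mesh_pos hT (pieceCount_pos lam) n
  have e : mesh T (pieceCount lam) n ^ (1 - x) =
      mesh T (pieceCount lam) n * mesh T (pieceCount lam) n ^ (-x) := by
    rw [sub_eq_add_neg, Real.rpow_add h0, Real.rpow_one]
  rw [e, ← mul_assoc, mul_mesh (pieceCount_pos lam), half_pow_succ]
  calc _ ≤ T / 2 * (2 : ℝ) ^ (-1 * (n : ℝ)) * (T / 4 * (2 : ℝ) ^ (-(1 + lam n) * n)) ^ (-x) := by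
        gcongr 1
        exact Real.rpow_le_rpow_of_nonpos (by positivity) (le_mesh hT h) (by linarith)
    _ = T / 2 * (T / 4) ^ (-x) * ((2 : ℝ) ^ (-1 * (n : ℝ)) * (2 : ℝ) ^ (-(1 + lam n) * n * -x)) := by
        rw [Real.mul_rpow (by positivity) (by positivity), ← Real.rpow_mul (by norm_num)]; ring
    _ = _ := by rw [← Real.rpow_add (by norm_num)]; ring_nf

/-- The Borel–Cantelli series: the ratio is `N ^ (2 * H - 2)`, with a negative exponent and `N`
growing at least geometrically. -/
lemma summable_pieceCount {H μ : ℝ} (hH : H < 1) (hμ : 0 < μ) (h : ∀ n, μ ≤ lam n) :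
    Summable fun n => (pieceCount lam n : ℝ) ^ (2 * H) / (pieceCount lam n : ℝ) ^ 2 := by
  refine Summable.of_nonneg_of_le (fun n => by positivity) (fun n => ?_)
    (summable_two_rpow (show μ * (2 * H - 2) < 0 by nlinarith))
  have h0 : (0 : ℝ) < pieceCount lam n := Nat.cast_pos.2 (pieceCount_pos lam n)
  rw [← Real.rpow_natCast, ← Real.rpow_sub h0]
  push_cast
  calc _ ≤ ((2 : ℝ) ^ (lam n * n)) ^ (2 * H - 2) :=
        Real.rpow_le_rpow_of_nonpos (by positivity) (le_pieceCount lam n) (by linarith)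
    _ = (2 : ℝ) ^ (lam n * (2 * H - 2) * n) := by rw [← Real.rpow_mul (by norm_num)]; ring_nf
    _ ≤ _ := two_rpow_le (mul_le_mul_of_nonpos_right (h n) (by linarith)) n

end Asymptotics

/-- Existence of block sizes and orders for the tracking strategy. -/
theorem exists_tracking_parameters {T H r : ℝ} (hT : 0 < T) (hH : H ∈ Ioo (1 / 2 : ℝ) 1) (hr : 0 < r) :
    ∃ (N : ℕ → ℕ) (θ : ℕ → ℝ) (α β : ℝ), (∀ n, 0 < N n) ∧ α ∈ Ioo (1 - H) 1 ∧ 1 - α < β ∧ α < β ∧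
      β < H ∧ (Summable fun n => (N n : ℝ) ^ (2 * H) / (N n : ℝ) ^ 2) ∧
      (Summable fun n => mesh T N n ^ H) ∧
      (Summable fun n => (T * (1 / 2) ^ (n + 1)) ^ r) ∧
      (Summable fun m => N (2 * m) * (mesh T N (2 * m) ^ (1 - α) +
        (mesh T N (2 * m) ^ H)⁻¹ * mesh T N (2 * m) ^ (1 + β - α))) ∧
      (∀ m, θ (2 * m) = 0) ∧ (∀ m, 0 ≤ θ (2 * m + 1)) ∧
      Filter.Tendsto (fun m => θ (2 * m + 1)) Filter.atTop (nhds 0) ∧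
      ∀ κ > 0, ∀ C ≥ 0,
        Filter.Tendsto (fun m => mesh T N (2 * m + 1) ^ H * (N (2 * m + 1) * κ))
          Filter.atTop Filter.atTop ∧
        (∀ᶠ m in Filter.atTop, θ (2 * m + 1) + C * (T * (1 / 2) ^ (2 * m + 1 + 1)) ^ r +
          2 * mesh T N (2 * m + 1) ^ H ≤ mesh T N (2 * m + 2) ^ H * (N (2 * m + 2) * κ)) ∧
        (∀ᶠ m in Filter.atTop, C * (T * (1 / 2) ^ (2 * m + 2 + 1)) ^ r +
          2 * mesh T N (2 * m + 2) ^ H ≤ θ (2 * m + 3)) := by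
  obtain ⟨hH1, hH2⟩ := hH
  have hH0 : 0 < H := by linarith
  have h1H : 0 < 1 - H := by linarith
  -- A common decay rate: both the Hölder increments of the target over a block and `mesh ^ H` are
  -- of order `2 ^ (-ρ * n)`.
  set ρ := min r H
  have hρ : 0 < ρ := lt_min hr hH0
  have hρr : ρ ≤ r := min_le_left _ _
  have hρH : ρ ≤ H := min_le_right _ _
  -- Chosen so that `(1 + l₀) * (1 - H) = 1 - ρ / 2` and `(1 + l₁) * (1 - H) = 2`: even blocks gain
  -- about `2 ^ (-(ρ / 2) * n)`, odd blocks about `2 ^ n`.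
  set l₀ := (1 - ρ / 2) / (1 - H) - 1
  set l₁ := 2 / (1 - H) - 1
  have hγ₀ : 0 < (1 - ρ / 2) / (1 - H) := div_pos (by linarith) h1H
  have hl₀ : 0 < l₀ := by
    have : 1 < (1 - ρ / 2) / (1 - H) := (one_lt_div h1H).2 (by linarith)
    simp only [l₀]; linarith
  have hl₀₁ : l₀ ≤ l₁ := by
    have : (1 - ρ / 2) / (1 - H) ≤ 2 / (1 - H) := by gcongr; linarith
    simp only [l₀, l₁]; linarith
  set lam : ℕ → ℝ := fun n => if Even n then l₀ else l₁
  have hlam : ∀ n, l₀ ≤ lam n := fun n => by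
    simp only [lam]; split_ifs
    · exact le_rfl
    · exact hl₀₁
  have hlam0 : ∀ n, 0 ≤ lam n := fun n => hl₀.le.trans (hlam n)
  have hlame : ∀ m, lam (2 * m) = l₀ := fun m => if_pos (even_two_mul m)
  have hlamo : ∀ m, lam (2 * m + 1) = l₁ := fun m =>
    if_neg (Nat.not_even_iff_odd.2 (odd_two_mul_add_one m))
  -- The margin of `α` over `1 - H`. The first bound keeps `(1 + l₀) * (1 - H + 3 * κ' / 2)` below
  -- `1`, as the cost of even blocks requires; the second ensures `α < β`.
  set κ' := min (ρ / (6 * ((1 - ρ / 2) / (1 - H)))) ((2 * H - 1) / 2)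
  have hκ' : 0 < κ' := lt_min (by positivity) (by linarith)
  have hκ1 : κ' * ((1 - ρ / 2) / (1 - H)) ≤ ρ / 6 := by
    have : κ' ≤ ρ / (6 * ((1 - ρ / 2) / (1 - H))) := min_le_left _ _
    rw [le_div_iff₀ (by positivity)] at this
    linarith
  have hκ2 : κ' ≤ (2 * H - 1) / 2 := min_le_right _ _
  set N := pieceCount lam
  -- The rate `3 * ρ / 4` lies between the rate `ρ` of the small errors and the rate `ρ / 2` of the
  -- even gains.
  set θ : ℕ → ℝ := fun n => if Even n then 0 else (2 : ℝ) ^ (-(3 * ρ / 4) * n)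
  have hθe : ∀ m, θ (2 * m) = 0 := fun m => if_pos (even_two_mul m)
  have hθo : ∀ m : ℕ, θ (2 * m + 1) = (2 : ℝ) ^ (-(3 * ρ / 4) * (2 * m + 1 : ℕ)) := fun m =>
    if_neg (Nat.not_even_iff_odd.2 (odd_two_mul_add_one m))
  have hodd : Filter.Tendsto (fun m : ℕ => 2 * m + 1) Filter.atTop Filter.atTop :=
    Filter.tendsto_atTop_mono (fun m => by simp only [id]; omega) Filter.tendsto_id
  have heven : Filter.Tendsto (fun m : ℕ => 2 * m + 2) Filter.atTop Filter.atTop :=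
    Filter.tendsto_atTop_mono (fun m => by simp only [id]; omega) Filter.tendsto_id
  have hN : ∀ n, 0 < N n := pieceCount_pos lam
  have hmesh : ∀ n, mesh T N n ^ H ≤ (T / 2) ^ H * (2 : ℝ) ^ (-ρ * n) := fun n =>
    mesh_rpow_le hT (hlam0 n) hH0.le hρH
  have hinc : ∀ n : ℕ, (T * (1 / 2) ^ (n + 1)) ^ r ≤ (T / 2) ^ r * (2 : ℝ) ^ (-ρ * n) := by
    intro n
    rw [half_pow_succ, Real.mul_rpow (by positivity) (by positivity), ← Real.rpow_mul (by norm_num)]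
    gcongr 1
    rw [show -1 * (n : ℝ) * r = -r * n by ring]
    exact two_rpow_le (by linarith) n
  have hsρ := summable_two_rpow (show -ρ < 0 by linarith)
  refine ⟨N, θ, 1 - H + κ', H - κ' / 2, hN, ⟨by linarith, by linarith⟩, by linarith, by linarith,
    by linarith, summable_pieceCount hH2 hl₀ hlam, ?_, ?_, ?_, hθe, ?_, ?_, ?_⟩
  · exact Summable.of_nonneg_of_le (fun n => Real.rpow_nonneg (mesh_pos hT hN n).le _) hmesh
      (hsρ.mul_left _)
  · exact Summable.of_nonneg_of_le (fun n => by positivity) hinc (hsρ.mul_left _)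
  · have hterm : ∀ x, 0 ≤ x → ((1 - ρ / 2) / (1 - H)) * x < 1 → Summable fun m : ℕ =>
        (N (2 * m) : ℝ) * mesh T N (2 * m) ^ (1 - x) := by
      intro x hx hx1
      refine Summable.of_nonneg_of_le (fun m => mul_nonneg (Nat.cast_nonneg _)
        (Real.rpow_nonneg (mesh_pos hT hN _).le _))
        (fun m => pieceCount_mul_mesh_rpow_le hT (hlam0 (2 * m)) hx) (Summable.mul_left _ ?_)
      have := summable_two_rpow (show 2 * ((1 - ρ / 2) / (1 - H) * x - 1) < 0 by linarith)
      refine this.congr fun m => ?_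
      rw [hlame]
      congr 1
      simp only [l₀]
      push_cast
      ring
    have e0 : (1 - ρ / 2) / (1 - H) * (1 - H) = 1 - ρ / 2 := div_mul_cancel₀ _ h1H.ne'
    have s1 := hterm (1 - H + κ') (by linarith) (by nlinarith)
    -- The Hölder part of the cost has exponent `1 + β - α - H`, which equals `1 - (1 - H + 3 * κ' /
    -- 2)`.
    have s2 := hterm (1 - H + κ' + κ' / 2) (by linarith) (by nlinarith)
    refine (s1.add s2).congr fun m => ?_
    have h0 := mesh_pos hT hN (2 * m)
    rw [← mul_add, ← Real.rpow_neg h0.le, ← Real.rpow_add h0]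
    ring_nf
  · intro m; rw [hθo]; positivity
  · have := (summable_two_rpow (show -(3 * ρ / 4) < 0 by linarith)).tendsto_atTop_zero.comp hodd
    exact this.congr fun m => (hθo m).symm
  · intro κ hκ C hC
    have hΛ : ∀ n, (T / 4) ^ H * κ * (2 : ℝ) ^ (((1 + lam n) * (1 - H) - 1) * n) ≤
        mesh T N n ^ H * (N n * κ) := by
      intro n
      have := mul_le_mul_of_nonneg_right (le_mesh_rpow_mul (H := H) hT (hlam0 n) hH0.le) hκ.le
      linarith
    set M := 1 + C * (T / 2) ^ r + 2 * (T / 2) ^ H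
    have hCr : 0 ≤ C * (T / 2) ^ r := by positivity
    have hTH : 0 ≤ (T / 2) ^ H := by positivity
    have hsmall : ∀ n : ℕ, C * (T * (1 / 2) ^ (n + 1)) ^ r + 2 * mesh T N n ^ H ≤
        (C * (T / 2) ^ r + 2 * (T / 2) ^ H) * (2 : ℝ) ^ (-ρ * n) := by
      intro n
      have h1 := mul_le_mul_of_nonneg_left (hinc n) hC
      have h2 := hmesh n
      linarith
    refine ⟨?_, ?_, ?_⟩
    · refine Filter.tendsto_atTop_mono (fun m => hΛ (2 * m + 1)) ?_
      have e : ∀ m : ℕ, (2 : ℝ) ^ (((1 + lam (2 * m + 1)) * (1 - H) - 1) * (2 * m + 1 : ℕ)) =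
          2 ^ (2 * m + 1) := by
        intro m
        rw [hlamo, ← Real.rpow_natCast 2]
        congr 1
        have : (1 + l₁) * (1 - H) = 2 := by
          simp only [l₁, add_sub_cancel]; exact div_mul_cancel₀ _ h1H.ne'
        rw [this]; ring
      simp_rw [e]
      refine Filter.Tendsto.const_mul_atTop (by positivity) ?_
      exact (tendsto_pow_atTop_atTop_of_one_lt (by norm_num : (1 : ℝ) < 2)).comp hodd
    · have h3 := eventually_two_rpow_le (x := -(3 * ρ / 4)) (y := -(ρ / 2)) M (by linarith)
        (show 0 < (T / 4) ^ H * κ * (2 : ℝ) ^ (-(ρ / 2)) by positivity)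
      filter_upwards [hodd.eventually h3] with m hm
      have h4 := hΛ (2 * m + 2)
      have e1 : (1 + lam (2 * m + 2)) * (1 - H) - 1 = -(ρ / 2) := by
        rw [show 2 * m + 2 = 2 * (m + 1) by ring, hlame]
        simp only [l₀, add_sub_cancel]
        rw [div_mul_cancel₀ _ h1H.ne']; ring
      rw [e1] at h4
      have e2 : (2 : ℝ) ^ (-(ρ / 2) * (2 * m + 2 : ℕ)) =
          (2 : ℝ) ^ (-(ρ / 2)) * (2 : ℝ) ^ (-(ρ / 2) * (2 * m + 1 : ℕ)) := by
        rw [← Real.rpow_add (by norm_num)]; push_cast; ring_nf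
      rw [e2] at h4
      have h5 := hsmall (2 * m + 1)
      have h6 := two_rpow_le (show -ρ ≤ -(3 * ρ / 4) by linarith) (2 * m + 1)
      have h7 := mul_le_mul_of_nonneg_left h6
        (show 0 ≤ C * (T / 2) ^ r + 2 * (T / 2) ^ H by positivity)
      rw [hθo]
      simp only [M] at hm
      linarith
    · have h3 := eventually_two_rpow_le (x := -ρ) (y := -(3 * ρ / 4))
        (C * (T / 2) ^ r + 2 * (T / 2) ^ H) (by linarith)
        (show 0 < (2 : ℝ) ^ (-(3 * ρ / 4)) by positivity)
      filter_upwards [heven.eventually h3] with m hm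
      have e2 : θ (2 * m + 3) =
          (2 : ℝ) ^ (-(3 * ρ / 4)) * (2 : ℝ) ^ (-(3 * ρ / 4) * (2 * m + 2 : ℕ)) := by
        rw [show 2 * m + 3 = 2 * (m + 1) + 1 by ring, hθo, ← Real.rpow_add (by norm_num)]
        push_cast; ring_nf
      rw [e2]
      exact (hsmall (2 * m + 2)).trans hm

/-! ### The integrand -/

/-- Gain over a piece, i.e. the integral of the corresponding sine bump. -/
noncomputable def gain (T : ℝ) (N : ℕ → ℕ) (H : ℝ) (g : ℝ → ℝ) (n k : ℕ) : ℝ :=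
  mesh T N n ^ H *
    (1 - Real.cos ((g (gridPt T N n (k + 1)) - g (gridPt T N n k)) / mesh T N n ^ H))

/-- Coefficient of the sine bump over a piece. -/
noncomputable def bumpCoef (T : ℝ) (N : ℕ → ℕ) (θ : ℕ → ℝ) (H : ℝ) (g z : ℝ → ℝ) (n k : ℕ) : ℝ :=
  trackCoef θ (fun i => z (blockTime T i)) (gain T N H g) N n k

/-- The term of the integrand attached to a piece. -/
noncomputable def bumpTerm (T : ℝ) (N : ℕ → ℕ) (θ : ℕ → ℝ) (H : ℝ) (g z : ℝ → ℝ)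
    (i : Σ n, Fin (N n)) (t : ℝ) : ℝ :=
  bumpCoef T N θ H g z i.1 i.2 *
    sinBump g (mesh T N i.1 ^ H) (gridPt T N i.1 i.2) (gridPt T N i.1 (i.2 + 1)) t

/-- The integrand whose integral against `g` tracks `z`. -/
noncomputable def integrand (T : ℝ) (N : ℕ → ℕ) (θ : ℕ → ℝ) (H : ℝ) (g z : ℝ → ℝ) (t : ℝ) : ℝ :=
  ∑' i, bumpTerm T N θ H g z i t

section Integrand

variable {T H : ℝ} {N : ℕ → ℕ} {θ : ℕ → ℝ} {g z : ℝ → ℝ} {t : ℝ}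

lemma abs_bumpCoef_le (n k : ℕ) : |bumpCoef T N θ H g z n k| ≤ 1 := abs_direction_le _ _ _ _

lemma bumpTerm_of_notMem {i : Σ n, Fin (N n)} (h : t ∉ piece T N i) :
    bumpTerm T N θ H g z i t = 0 := by
  rw [piece] at h
  rw [bumpTerm, sinBump, indicator_of_notMem h, mul_zero]

lemma hasSum_bumpTerm_of_mem (hT : 0 < T) (hN : ∀ n, 0 < N n) {i : Σ n, Fin (N n)}
    (h : t ∈ piece T N i) :
    HasSum (fun j => bumpTerm T N θ H g z j t) (bumpTerm T N θ H g z i t) :=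
  hasSum_single i fun _ hj => bumpTerm_of_notMem (notMem_piece_of_ne hT hN hj h)

lemma hasSum_bumpTerm_of_forall_notMem (h : ∀ i, t ∉ piece T N i) :
    HasSum (fun j => bumpTerm T N θ H g z j t) 0 := by
  simp_rw [bumpTerm_of_notMem (h _)]
  exact hasSum_zero

lemma hasSum_bumpTerm (hT : 0 < T) (hN : ∀ n, 0 < N n) :
    HasSum (fun j => bumpTerm T N θ H g z j t) (integrand T N θ H g z t) := by
  by_cases h : ∃ i, t ∈ piece T N i
  · obtain ⟨i, hi⟩ := h
    exact (hasSum_bumpTerm_of_mem hT hN hi).summable.hasSum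
  · exact (hasSum_bumpTerm_of_forall_notMem (not_exists.1 h)).summable.hasSum

lemma integrand_of_mem (hT : 0 < T) (hN : ∀ n, 0 < N n) {i : Σ n, Fin (N n)}
    (h : t ∈ piece T N i) : integrand T N θ H g z t = bumpTerm T N θ H g z i t :=
  (hasSum_bumpTerm_of_mem hT hN h).tsum_eq

lemma integrand_of_forall_notMem (h : ∀ i, t ∉ piece T N i) : integrand T N θ H g z t = 0 :=
  (hasSum_bumpTerm_of_forall_notMem h).tsum_eq

lemma abs_integrand_le (hT : 0 < T) (hN : ∀ n, 0 < N n) : |integrand T N θ H g z t| ≤ 1 := by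
  by_cases h : ∃ i, t ∈ piece T N i
  · obtain ⟨i, hi⟩ := h
    rw [integrand_of_mem hT hN hi, bumpTerm, abs_mul]
    exact mul_le_one₀ (abs_bumpCoef_le _ _) (abs_nonneg _) (abs_sinBump_le _ _)
  · rw [integrand_of_forall_notMem (not_exists.1 h)]; simp

lemma gain_nonneg (hT : 0 < T) (hN : ∀ n, 0 < N n) (n k : ℕ) : 0 ≤ gain T N H g n k :=
  mul_nonneg (Real.rpow_nonneg (mesh_pos hT hN n).le _) (sub_nonneg.2 (Real.cos_le_one _))

lemma gain_le (hT : 0 < T) (hN : ∀ n, 0 < N n) (n k : ℕ) :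
    gain T N H g n k ≤ 2 * mesh T N n ^ H := by
  rw [gain, mul_comm 2]
  have h0 := Real.rpow_nonneg (mesh_pos hT hN n).le H
  gcongr
  linarith [Real.neg_one_le_cos ((g (gridPt T N n (k + 1)) - g (gridPt T N n k)) / mesh T N n ^ H)]

end Integrand

/-- The integrand built from adapted processes is adapted. -/
theorem adapted_integrand {Ω : Type*} {mΩ : MeasurableSpace Ω} {T H : ℝ} (hT : 0 < T) {N : ℕ → ℕ}
    (hN : ∀ n, 0 < N n) (θ : ℕ → ℝ) (𝓕 : Filtration (Icc (0 : ℝ) T) mΩ) {G Z : ℝ → Ω → ℝ}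
    (hG : Adapted 𝓕 fun t : Icc (0 : ℝ) T => G t) (hZ : Adapted 𝓕 fun t : Icc (0 : ℝ) T => Z t) :
    Adapted 𝓕 fun (t : Icc (0 : ℝ) T) ω => integrand T N θ H (fun s => G s ω) (fun s => Z s ω) t := by
  -- The filtration is extended to all real times by clamping, which avoids carrying membership
  -- proofs for the grid points.
  set σ : ℝ → MeasurableSpace Ω := fun x => 𝓕 (projIcc 0 T hT.le x)
  have hσ : ∀ {x y : ℝ}, x ≤ y → σ x ≤ σ y := fun h => 𝓕.mono (monotone_projIcc hT.le h)
  have hσI : ∀ {X : ℝ → Ω → ℝ}, Adapted 𝓕 (fun t : Icc (0 : ℝ) T => X t) →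
      ∀ x ∈ Icc 0 T, Measurable[σ x] (X x) := by
    intro X hX x hx
    have e : σ x = 𝓕 ⟨x, hx⟩ := by simp only [σ, projIcc_of_mem hT.le hx]
    rw [e]
    exact hX ⟨x, hx⟩
  have hgain : ∀ n, ∀ k < N n,
      Measurable[σ (gridPt T N n (k + 1))] fun ω => gain T N H (fun s => G s ω) n k := by
    intro n k hk
    have h1 := hσI hG _ (gridPt_mem hT hN (show k + 1 ≤ N n from hk))
    have h2 := (hσI hG _ (gridPt_mem hT hN hk.le)).mono
      (hσ (gridPt_mono hT hN n (Nat.le_succ k))) le_rfl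
    let := σ (gridPt T N n (k + 1))
    unfold gain
    exact (measurable_const.sub
      (Real.measurable_cos.comp ((h1.sub h2).div_const _))).const_mul _
  have hcoef : ∀ n, ∀ k ≤ N n, Measurable[σ (gridPt T N n k)] fun ω =>
      bumpCoef T N θ H (fun s => G s ω) (fun s => Z s ω) n k := by
    intro n k hk
    refine measurable_trackCoef (m := fun n k => σ (gridPt T N n k))
      (ζ := fun n ω => Z (blockTime T n) ω) (F := fun n k ω => gain T N H (fun s => G s ω) n k)
      (fun n k _ => hσ (gridPt_mono hT hN n (Nat.le_succ k))) (fun n => hσ ?_) θ (fun n => ?_)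
      hgain n k hk
    · rw [gridPt_last hN, gridPt_zero]
    · rw [gridPt_zero]
      exact hσI hZ _ (blockTime_mem hT n)
  intro t
  -- The partition is deterministic, so for fixed `t` a single term survives for all `ω`; its
  -- coefficient and left endpoint value are known at the left end of the piece, hence at time `t`.
  by_cases h : ∃ i, (t : ℝ) ∈ piece T N i
  · obtain ⟨i, hi⟩ := h
    have hle : σ (gridPt T N i.1 i.2) ≤ 𝓕 t := by
      have := hσ hi.1
      simpa only [σ, projIcc_val] using this
    have h1 := (hσI hG _ (gridPt_mem hT hN i.2.2.le)).mono hle le_rfl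
    have h2 := (hcoef i.1 i.2 i.2.2.le).mono hle le_rfl
    have h3 := hG t
    have e : (fun ω => integrand T N θ H (fun s => G s ω) (fun s => Z s ω) t) = fun ω =>
        bumpCoef T N θ H (fun s => G s ω) (fun s => Z s ω) i.1 i.2 *
          Real.sin ((G t ω - G (gridPt T N i.1 i.2) ω) / mesh T N i.1 ^ H) := by
      ext ω
      rw [integrand_of_mem hT hN hi, bumpTerm, sinBump]
      rw [piece] at hi
      rw [indicator_of_mem hi]
    simp only [e]
    exact h2.mul (Real.measurable_sin.comp ((h3.sub h1).div_const _))
  · simp only [integrand_of_forall_notMem (not_exists.1 h)]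
    exact measurable_const

/-- Pathwise representation: the integral of the integrand is the final value of `z`. -/
theorem glsIntegral_integrand {T H r α β κ C K : ℝ} {N : ℕ → ℕ} {θ : ℕ → ℝ} {g z : ℝ → ℝ}
    (hT : 0 < T) (hr : 0 < r) (hN : ∀ n, 0 < N n) (hα : α ∈ Ioo (0 : ℝ) 1) (hβ : 1 - α < β)
    (hαβ : α < β) (hC : 0 ≤ C) (hK : 0 ≤ K)
    (hmesh : Summable fun n => mesh T N n ^ H)
    (hlen : Summable fun n => (T * (1 / 2) ^ (n + 1)) ^ r)
    (hcost : Summable fun m => N (2 * m) * (mesh T N (2 * m) ^ (1 - α) +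
      (mesh T N (2 * m) ^ H)⁻¹ * mesh T N (2 * m) ^ (1 + β - α)))
    (hθe : ∀ m, θ (2 * m) = 0) (hθ0 : ∀ m, 0 ≤ θ (2 * m + 1))
    (hθ : Filter.Tendsto (fun m => θ (2 * m + 1)) Filter.atTop (nhds 0))
    (hΛ : Filter.Tendsto (fun m => mesh T N (2 * m + 1) ^ H * (N (2 * m + 1) * κ))
      Filter.atTop Filter.atTop)
    (h1 : ∀ᶠ m in Filter.atTop, θ (2 * m + 1) + C * (T * (1 / 2) ^ (2 * m + 1 + 1)) ^ r +
      2 * mesh T N (2 * m + 1) ^ H ≤ mesh T N (2 * m + 2) ^ H * (N (2 * m + 2) * κ))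
    (h2 : ∀ᶠ m in Filter.atTop, C * (T * (1 / 2) ^ (2 * m + 2 + 1)) ^ r +
      2 * mesh T N (2 * m + 2) ^ H ≤ θ (2 * m + 3))
    (hg : ∀ s ∈ Icc 0 T, ∀ t ∈ Icc 0 T, |g s - g t| ≤ K * |s - t| ^ β)
    (hz : ∀ s ∈ Icc 0 T, ∀ t ∈ Icc 0 T, |z s - z t| ≤ C * |s - t| ^ r)
    (hgain : ∀ᶠ n in Filter.atTop, N n * κ ≤ ∑ k ∈ Finset.range (N n),
      (1 - Real.cos ((g (gridPt T N n (k + 1)) - g (gridPt T N n k)) / mesh T N n ^ H))) :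
    Measurable (fun t : Icc (0 : ℝ) T => integrand T N θ H g z t) ∧
      fracNorm α 0 T (integrand T N θ H g z) < ∞ ∧
      GLSIntegrable α 0 T (integrand T N θ H g z) g ∧
      z T = glsIntegral α 0 T (integrand T N θ H g z) g := by
  have hmp := mesh_pos hT hN
  have hap : ∀ n, 0 < mesh T N n ^ H := fun n => Real.rpow_pos_of_pos (hmp n) _
  have hβ0 : 0 < β := hα.1.trans hαβ
  set ζ : ℕ → ℝ := fun n => z (blockTime T n) with hζ
  set F := gain T N H g with hF
  set V := trackValue θ ζ F N with hV
  set D : ℕ → ℝ := fun n => |ζ n - V n| with hD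
  set S : ℕ → ℝ := fun n => ∑ k ∈ Finset.range (N n), F n k with hS
  set c : ℕ → ℝ := fun n => C * (T * (1 / 2) ^ (n + 1)) ^ r with hc
  have hF0 : ∀ n k, 0 ≤ F n k := gain_nonneg hT hN
  have hFa : ∀ n k, F n k ≤ 2 * mesh T N n ^ H := gain_le hT hN
  have hzc : ∀ n, |ζ (n + 1) - ζ n| ≤ c n := by
    intro n
    have := hz _ (blockTime_mem hT (n + 1)) _ (blockTime_mem hT n)
    rwa [blockTime_succ_sub, abs_of_nonneg (by positivity : 0 ≤ T * (1 / 2 : ℝ) ^ (n + 1))] at this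
  have hDstep : ∀ n, D (n + 1) ≤ c n + |ζ n - blockValue (θ n) (ζ n) (V n) (F n) (N n)| :=
    fun n => (abs_sub_le _ (ζ n) _).trans (add_le_add_left (hzc n) _)
  have hSΛ : ∀ᶠ n in Filter.atTop, mesh T N n ^ H * (N n * κ) ≤ S n := by
    filter_upwards [hgain] with n hn
    simp only [hS, hF, gain, ← Finset.mul_sum]
    exact mul_le_mul_of_nonneg_left hn (hap n).le
  obtain ⟨hD0, hDodd⟩ := tendsto_tracking_error (D := D) (a := fun n => mesh T N n ^ H) (c := c)
    (S := S) (Λ := fun n => mesh T N n ^ H * (N n * κ)) (θ := θ) (fun n => abs_nonneg _)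
    (fun n => (hap n).le) (fun n => by positivity) (fun n => Finset.sum_nonneg fun k _ => hF0 n k)
    hmesh (hlen.mul_left C)
    (fun n hn => (hDstep n).trans
      (add_le_add_right (abs_sub_blockValue_le hn (hF0 n) (hFa n) (N n)) _))
    (fun n hn => (hDstep n).trans (by rw [blockValue_of_le _ hn]))
    hSΛ hΛ hθe hθ0 hθ h1 h2
  set w : (Σ n, Fin (N n)) → ℝ := fun i => mesh T N i.1 ^ (1 - α) +
    (mesh T N i.1 ^ H)⁻¹ * mesh T N i.1 ^ (1 + β - α) with hw
  have hw0 : ∀ i, 0 ≤ w i := fun i => by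
    have := (hmp i.1).le
    positivity
  -- Even blocks are summable by `hcost`. Odd blocks contribute only finitely many nonzero terms,
  -- since eventually the error is below the threshold and their coefficients vanish.
  have hsum : Summable fun i : Σ n, Fin (N n) => |bumpCoef T N θ H g z i.1 i.2| * w i := by
    rw [summable_sigma_of_nonneg fun i => mul_nonneg (abs_nonneg _) (hw0 i)]
    refine ⟨fun n => (hasSum_fintype _).summable, ?_⟩
    have h0 : ∀ n, 0 ≤ ∑' k : Fin (N n), |bumpCoef T N θ H g z n k| * w ⟨n, k⟩ :=
      fun n => tsum_nonneg fun k => mul_nonneg (abs_nonneg _) (hw0 _)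
    have he : Summable fun m => ∑' k : Fin (N (2 * m)),
        |bumpCoef T N θ H g z (2 * m) k| * w ⟨2 * m, k⟩ := by
      refine Summable.of_nonneg_of_le (fun m => h0 _) (fun m => ?_) hcost
      rw [tsum_fintype]
      refine (Finset.sum_le_sum fun k _ => mul_le_of_le_one_left (hw0 _)
        (abs_bumpCoef_le _ _)).trans ?_
      simp only [hw, Finset.sum_const, Finset.card_univ, Fintype.card_fin, nsmul_eq_mul, le_rfl]
    have ho : Summable fun m => ∑' k : Fin (N (2 * m + 1)),
        |bumpCoef T N θ H g z (2 * m + 1) k| * w ⟨2 * m + 1, k⟩ := by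
      obtain ⟨M, hM⟩ := Filter.eventually_atTop.1 hDodd
      refine summable_of_hasFiniteSupport ((finite_lt_nat M).subset fun m hm => ?_)
      by_contra hlt
      refine hm ?_
      have : ∀ k, bumpCoef T N θ H g z (2 * m + 1) k = 0 := fun k =>
        direction_of_le (hM m (not_lt.1 hlt))
      simp [this]
    exact he.even_add_odd ho
  -- Clamping extends the path to a function on `ℝ` with the same Hölder constant, as the
  -- integration lemmas require.
  set g' : ℝ → ℝ := fun x => g (projIcc 0 T hT.le x) with hg'
  have hgg' : ∀ x ∈ Icc 0 T, g' x = g x := fun x hx => by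
    simp only [hg', projIcc_of_mem hT.le hx]
  have hgH : ∀ x y, |g' x - g' y| ≤ K * |x - y| ^ β := by
    intro x y
    refine (hg _ (projIcc 0 T hT.le x).2 _ (projIcc 0 T hT.le y).2).trans ?_
    exact mul_le_mul_of_nonneg_left (Real.rpow_le_rpow (abs_nonneg _)
      (abs_projIcc_sub_projIcc hT.le) hβ0.le) hK
  have hmem : ∀ (n : ℕ) (k : ℕ), k < N n → gridPt T N n k ∈ Icc 0 T ∧ gridPt T N n (k + 1) ∈ Icc 0 T :=
    fun n k hk => ⟨gridPt_mem hT hN hk.le, gridPt_mem hT hN hk⟩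
  have hbump : ∀ (i : Σ n, Fin (N n)) x,
      sinBump g' (mesh T N i.1 ^ H) (gridPt T N i.1 i.2) (gridPt T N i.1 (i.2 + 1)) x =
      sinBump g (mesh T N i.1 ^ H) (gridPt T N i.1 i.2) (gridPt T N i.1 (i.2 + 1)) x := by
    intro i x
    obtain ⟨hm1, hm2⟩ := hmem i.1 i.2 i.2.2
    by_cases hx : x ∈ Ico (gridPt T N i.1 i.2) (gridPt T N i.1 (i.2 + 1))
    · rw [sinBump, sinBump, indicator_of_mem hx, indicator_of_mem hx, hgg' _ hm1,
        hgg' x ⟨hm1.1.trans hx.1, hx.2.le.trans hm2.2⟩]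
    · rw [sinBump, sinBump, indicator_of_notMem hx, indicator_of_notMem hx]
  obtain ⟨hm, hfin, hint, hHS⟩ := hasSum_sinBump (ι := Σ n, Fin (N n)) (f := integrand T N θ H g z)
    (e := fun i => bumpCoef T N θ H g z i.1 i.2) (a := fun i => mesh T N i.1 ^ H)
    (l := fun i => gridPt T N i.1 i.2) (r := fun i => gridPt T N i.1 (i.2 + 1))
    hα hβ hαβ hT.le hK hgH (fun i => hap i.1) (fun i => (hmem i.1 i.2 i.2.2).1.1)
    (fun i => gridPt_mono hT hN i.1 (Nat.le_succ _)) (fun i => (hmem i.1 i.2 i.2.2).2.2)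
    (fun x => by
      simp_rw [hbump]
      exact hasSum_bumpTerm hT hN)
    (by simpa only [gridPt_succ_sub] using hsum)
  have hg'g : ∀ x ∈ Ioc 0 T, g' x = g x := fun x hx => hgg' x ⟨hx.1.le, hx.2⟩
  refine ⟨hm.comp measurable_subtype_coe, hfin, hint.congr_right hT hg'g, ?_⟩
  rw [← glsIntegral_congr_right hT hg'g]
  have hterm : ∀ i : Σ n, Fin (N n), bumpCoef T N θ H g z i.1 i.2 * (mesh T N i.1 ^ H *
      (1 - Real.cos ((g' (gridPt T N i.1 (i.2 + 1)) - g' (gridPt T N i.1 i.2)) / mesh T N i.1 ^ H)))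
      = bumpCoef T N θ H g z i.1 i.2 * F i.1 i.2 := by
    intro i
    obtain ⟨hm1, hm2⟩ := hmem i.1 i.2 i.2.2
    rw [hgg' _ hm1, hgg' _ hm2]; rfl
  simp_rw [hterm] at hHS
  -- Summed block by block, the partial sums of the series for the integral are the tracked values
  -- `V n`.
  have hVlim : Filter.Tendsto V Filter.atTop (nhds (glsIntegral α 0 T (integrand T N θ H g z) g')) := by
    have h3 := (hHS.sigma fun n => hasSum_fintype _).tendsto_sum_nat
    refine h3.congr fun n => ?_
    rw [hV, trackValue_eq_sum]
    refine Finset.sum_congr rfl fun m _ => ?_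
    exact Fin.sum_univ_eq_sum_range (fun k => bumpCoef T N θ H g z m k * F m k) (N m)
  have hζlim : Filter.Tendsto ζ Filter.atTop (nhds (z T)) := by
    rw [tendsto_iff_dist_tendsto_zero]
    refine squeeze_zero (fun n => dist_nonneg)
      (fun n => hz _ (blockTime_mem hT n) T ⟨hT.le, le_rfl⟩) ?_
    have h3 : Filter.Tendsto (fun n => |blockTime T n - T|) Filter.atTop (nhds 0) := by
      simpa using ((tendsto_blockTime (T := T)).sub_const T).abs
    simpa [Real.zero_rpow hr.ne'] using (h3.rpow_const (Or.inr hr.le)).const_mul C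
  have hdiff : Filter.Tendsto (fun n => ζ n - V n) Filter.atTop (nhds 0) :=
    (tendsto_zero_iff_abs_tendsto_zero _).2 hD0
  exact sub_eq_zero.1 (tendsto_nhds_unique (hζlim.sub hVlim) hdiff)

end FractionalIntegral

theorem mainTheorem1 {Ω : Type*} [mΩ : MeasurableSpace Ω] (P : Measure Ω) [IsProbabilityMeasure P]
    (T : ℝ) (hT : 0 < T)
    -- a filtration on `[0,T]` satisfying the usual conditions (complete and right-continuous)
    (𝓕 : Filtration (Icc (0 : ℝ) T) mΩ) (h𝓕_rc : 𝓕.IsRightContinuous)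
    (h𝓕_complete : ∀ (t : Icc (0 : ℝ) T) (N : Set Ω), P N = 0 → MeasurableSet[𝓕 t] N)
    -- an adapted continuous centered Gaussian process
    (G : ℝ → Ω → ℝ) (hG_adapted : Adapted 𝓕 fun t : Icc (0 : ℝ) T => G t)
    (hG_gauss : IsGaussianProcess (fun t : Icc (0 : ℝ) T => G t) P)
    (hG_centered : ∀ t ∈ Icc (0 : ℝ) T, ∫ ω, G t ω ∂P = 0)
    (hG_cont : ∀ᵐ ω ∂P, ContinuousOn (fun t => G t ω) (Icc 0 T))
    -- condition (A)
    (H : ℝ) (hH : H ∈ Ioo (1 / 2 : ℝ) 1)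
    (hA : ∃ C₁ > (0 : ℝ), ∃ C₂ > (0 : ℝ), ∀ s ∈ Icc (0 : ℝ) T, ∀ t ∈ Icc (0 : ℝ) T,
      C₁ * |t - s| ^ (2 * H) ≤ ∫ ω, |G t ω - G s ω| ^ 2 ∂P ∧
      ∫ ω, |G t ω - G s ω| ^ 2 ∂P ≤ C₂ * |t - s| ^ (2 * H))
    -- condition (B)
    (hB : ∀ s₁ t₁ s₂ t₂ : ℝ, 0 ≤ s₁ → s₁ ≤ t₁ → t₁ ≤ s₂ → s₂ ≤ t₂ → t₂ ≤ T →
      0 ≤ ∫ ω, (G t₁ ω - G s₁ ω) * (G t₂ ω - G s₂ ω) ∂P)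
    -- `ξ` is the terminal value of an adapted process with `r`-Hölder continuous paths
    (ξ : Ω → ℝ) (r : ℝ≥0) (hr : 0 < r)
    (Z : ℝ → Ω → ℝ) (hZ_adapted : Adapted 𝓕 fun t : Icc (0 : ℝ) T => Z t)
    (hZ_holder : ∀ᵐ ω ∂P, ∃ C : ℝ≥0, HolderOnWith C r (fun t => Z t ω) (Icc 0 T))
    (hZ_end : ∀ᵐ ω ∂P, Z T ω = ξ ω) :
    ∃ ψ : ℝ → Ω → ℝ,
      Adapted 𝓕 (fun t : Icc (0 : ℝ) T => ψ t) ∧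
      (∃ K : ℝ, ∀ t ∈ Icc (0 : ℝ) T, ∀ ω, |ψ t ω| ≤ K) ∧
      ∃ α ∈ Ioo (1 - H) 1, ∀ᵐ ω ∂P,
        Measurable (fun t : Icc (0 : ℝ) T => ψ t ω) ∧
        FractionalIntegral.fracNorm α 0 T (fun t => ψ t ω) < ∞ ∧
        FractionalIntegral.GLSIntegrable α 0 T (fun t => ψ t ω) (fun t => G t ω) ∧
        ξ ω = FractionalIntegral.glsIntegral α 0 T (fun t => ψ t ω) (fun t => G t ω) := by
  obtain ⟨C₁, hC₁, C₂, hC₂, hA⟩ := hA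
  simp only [sq_abs] at hA
  have hr' : (0 : ℝ) < r := hr
  have hA₁ := fun s hs t ht => (hA s hs t ht).1
  have hA₂ := fun s hs t ht => (hA s hs t ht).2
  obtain ⟨N, θ, α, β, hN, hα, hβ, hαβ, hβH, hNsum, hmesh, hlen, hcost, hθe, hθ0, hθ, hpar⟩ :=
    FractionalIntegral.exists_tracking_parameters hT hH hr'
  have hα0 : 0 < α := by linarith [hα.1, hH.2]
  -- Half of the lower bound for the mean of `1 - cos` of a normalized increment; the other half is
  -- the room left for Chebyshev.
  set κ := (1 - Real.exp (-C₁ / 2)) / 2 with hκdef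
  have hκ : 0 < κ := by
    have : Real.exp (-C₁ / 2) < 1 := Real.exp_lt_one_iff.2 (by linarith)
    simp only [κ]; linarith
  have hgain : ∀ᵐ ω ∂P, ∀ᶠ n in Filter.atTop, N n * κ ≤ ∑ k ∈ Finset.range (N n),
      (1 - Real.cos ((G (FractionalIntegral.gridPt T N n (k + 1)) ω -
        G (FractionalIntegral.gridPt T N n k) ω) / FractionalIntegral.mesh T N n ^ H)) := by
    have hbound := fun n => FractionalIntegral.measure_grid_lt hC₁ hG_gauss hG_centered hA₁ hA₂ hB
      (FractionalIntegral.blockTime_mem hT n).1 (FractionalIntegral.mesh_pos hT hN n) (hN n)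
      ((FractionalIntegral.gridPt_last hN n).le.trans (FractionalIntegral.blockTime_mem hT _).2)
    have hfin : ∑' n, P {ω | ∑ k ∈ Finset.range (N n),
        (1 - Real.cos ((G (FractionalIntegral.gridPt T N n (k + 1)) ω -
          G (FractionalIntegral.gridPt T N n k) ω) / FractionalIntegral.mesh T N n ^ H)) <
            N n * (1 - Real.exp (-C₁ / 2)) / 2} ≠ ∞ := by
      refine ne_top_of_le_ne_top ?_ (ENNReal.tsum_le_tsum hbound)
      -- The Chebyshev bounds are a constant times `N ^ (2 * H) / N ^ 2`, so Borel–Cantelli leaves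
      -- only finitely many blocks with too small a gain.
      refine ((hNsum.mul_left (C₂ / κ ^ 2)).congr fun n => ?_).tsum_ofReal_ne_top
      have : (N n : ℝ) ≠ 0 := Nat.cast_ne_zero.2 (hN n).ne'
      rw [mul_div_assoc (N n : ℝ), ← hκdef]
      field_simp
    filter_upwards [ae_eventually_notMem hfin] with ω hω
    filter_upwards [hω] with n hn
    simp only [not_lt, mul_div_assoc, ← hκdef] at hn
    exact hn
  refine ⟨fun t ω => FractionalIntegral.integrand T N θ H (fun s => G s ω) (fun s => Z s ω) t,
    FractionalIntegral.adapted_integrand hT hN θ 𝓕 hG_adapted hZ_adapted,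
    ⟨1, fun t _ ω => FractionalIntegral.abs_integrand_le hT hN⟩, α, hα, ?_⟩
  filter_upwards [hgain, hZ_holder, hZ_end, FractionalIntegral.ae_exists_holder hT (hα0.trans hαβ)
    hβH hC₂ hG_gauss hG_centered hG_cont hA₂] with ω hω ⟨C, hC⟩ hend ⟨K, hK, hGK⟩
  -- The Hölder constant `C` of the target is random, whereas the partition and thresholds are not;
  -- this is why the parameter inequalities hold eventually for every constant.
  obtain ⟨hΛ, h1, h2⟩ := hpar κ hκ C C.2
  rw [← hend]
  exact FractionalIntegral.glsIntegral_integrand hT hr' hN ⟨hα0, hα.2⟩ hβ hαβ C.2 hK hmesh hlen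
    hcost hθe hθ0 hθ hΛ h1 h2 hGK (fun s hs t ht => hC.dist_le hs ht) hω
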